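/- **Theorem.** Let $n\ge 1$, $s\in(0,1)$, $\alpha\ge 1$ and $\phi(x)=|x|^{\alpha}$. Write $\mathbb R^{n+1}_+=\{x\in\mathbb R^{n+1}: x_{n+1}>0\}$, $B_1^+=\{x\in\mathbb R^{n+1}_+: |x|\le 1\}$. There exist constants $C>1$ and $\tau_0>1$, depending only on $n,s,\alpha$, such that the following holds. Let $\tilde u:\mathbb R^{n+1}_+\to\mathbb R$ belong to $H^1(\mathbb R^{n+1}_+,x_{n+1}^{1-2s})$, i.e. $\tilde u$ has a weak gradient and $\int_{\mathbb R^{n+1}_+}x_{n+1}^{1-2s}(|\tilde u|^2+|\nabla\tilde u|^2)\,dx<\infty$, suppose that $\tilde u=0$ a.e. in $B_1^+$, and denote its trace on $\mathbb R^n\times\{0\}$ again by $\tilde u$. Let $f$ satisfy $\int_{\mathbb R^{n+1}_+}x_{n+1}^{2s-1}|f|^2\,dx<\infty$ and vanish a.e. outside a bounded set. Let $V:\mathbb R^n\to\mathbb R$ be continuous and such that the radial derivative $x\cdot\nabla V(x)=\frac{d}{dr}\big|_{r=1}V(rx)$ exists at every point and is locally bounded. Suppose that $\tilde u$ is a weak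 solution of $$\nabla\cdot x_{n+1}^{1-2s}\nabla\tilde u=f\ \text{ in }\mathbb R^{n+1}_+,\qquad \lim_{x_{n+1}\to0}x_{n+1}^{1-2s}\partial_{n+1}\tilde u=V\tilde u\ \text{ on }\mathbb R^n\times\{0\},$$ that is, for all $\psi\in C_c^\infty(\mathbb R^{n+1})$, $$\int_{\mathbb R^{n+1}_+}x_{n+1}^{1-2s}\nabla\tilde u\cdot\nabla\psi\,dx=-\int_{\mathbb R^{n+1}_+}f\psi\,dx-\int_{\mathbb R^n}V(x')\,\tilde u(x',0)\,\psi(x',0)\,dx'.$$ Then for every $\tau\ge\tau_0$ with $\int_{\mathbb R^{n+1}_+}e^{2\tau\phi}x_{n+1}^{1-2s}(|\tilde u|^2+|\nabla\tilde u|^2)\,dx<\infty$ (in particular for every $\tau\ge\tau_0$ if $\tilde u$ has bounded support), $$\begin{aligned} &\tau^{3}\big\|e^{\tau\phi}|x|^{\frac{3\alpha}{2}-1}x_{n+1}^{\frac{1-2s}{2}}\tilde u\big\|_{L^2(\mathbb R^{n+1}_+)}^2+\tau\big\|e^{\tau\phi}|x|^{\frac{\alpha}{2}}x_{n+1}^{\frac{1-2s}{2}}\nabla\tilde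 u\big\|_{L^2(\mathbb R^{n+1}_+)}^2\\ &\le C\Big(\big\|e^{\tau\phi}x_{n+1}^{\frac{2s-1}{2}}|x|f\big\|_{L^2(\mathbb R^{n+1}_+)}^2+\tau\big\|e^{\tau\phi}|x|^{\frac{\alpha}{2}}|x\cdot\nabla V|^{\frac12}\tilde u\big\|_{L^2(\mathbb R^n\times\{0\})}^2+\tau\big\|e^{\tau\phi}|x|^{\frac{\alpha}{2}}|V|^{\frac12}\tilde u\big\|_{L^2(\mathbb R^n\times\{0\})}^2\Big). \end{aligned}$$ The boundary norms on the right-hand side may be infinite, in which case the estimate is trivial. -/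

import Mathlib

open MeasureTheory

namespace Carleman

/-- The last coordinate `x_{n+1}` of a point `x` of `ℝ^{n+1}`. -/
noncomputable def height {n : ℕ} (x : EuclideanSpace ℝ (Fin (n + 1))) : ℝ := x (Fin.last n)

/-- The open upper half-space `{x ∈ ℝ^{n+1} : x_{n+1} > 0}`. -/
def halfSpace (n : ℕ) : Set (EuclideanSpace ℝ (Fin (n + 1))) := {x | 0 < height x}

/-- Lebesgue measure on the upper half-space. -/
noncomputable def halfVol (n : ℕ) : Measure (EuclideanSpace ℝ (Fin (n + 1))) :=
  volume.restrict (halfSpace n)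

/-- The point `(x', 0)` of `ℝ^{n+1}`, for `x' ∈ ℝ^n`. -/
noncomputable def bdry {n : ℕ} (x' : EuclideanSpace ℝ (Fin n)) : EuclideanSpace ℝ (Fin (n + 1)) :=
  WithLp.toLp 2 (Fin.snoc (α := fun _ => ℝ) (fun i => x' i) 0)

/-- The unit vector in the direction of `x_{n+1}`. -/
noncomputable def lastVec (n : ℕ) : EuclideanSpace ℝ (Fin (n + 1)) :=
  EuclideanSpace.single (Fin.last n) 1

/-- `ψ ∈ C_c^∞(ℝ^{n+1})`. Restricted to the half-space, these need not vanish at the boundary. -/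
structure IsTestFunction {n : ℕ} (ψ : EuclideanSpace ℝ (Fin (n + 1)) → ℝ) : Prop where
  smooth : ContDiff ℝ (⊤ : ℕ∞) ψ
  compact : HasCompactSupport ψ

/-- `G` is the weak gradient of `u` in the open upper half-space. -/
def HasWeakGradient {n : ℕ} (u : EuclideanSpace ℝ (Fin (n + 1)) → ℝ)
    (G : EuclideanSpace ℝ (Fin (n + 1)) → EuclideanSpace ℝ (Fin (n + 1))) : Prop :=
  ∀ ψ : EuclideanSpace ℝ (Fin (n + 1)) → ℝ, IsTestFunction ψ → tsupport ψ ⊆ halfSpace n →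
    ∀ e : EuclideanSpace ℝ (Fin (n + 1)),
      ∫ x, u x * fderiv ℝ ψ x e ∂(halfVol n) = - ∫ x, inner ℝ (G x) e * ψ x ∂(halfVol n)

/-- `u ∈ H^1(ℝ^{n+1}_+, x_{n+1}^{1-2s})`, with weak gradient `G`: both `x_{n+1}^{(1-2s)/2} u` and
`x_{n+1}^{(1-2s)/2} ∇u` are square integrable. -/
structure MemWeightedH1 {n : ℕ} (s : ℝ) (u : EuclideanSpace ℝ (Fin (n + 1)) → ℝ)
    (G : EuclideanSpace ℝ (Fin (n + 1)) → EuclideanSpace ℝ (Fin (n + 1))) : Prop where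
  memLp : MemLp (fun x => height x ^ ((1 - 2 * s) / 2) * u x) 2 (halfVol n)
  memLp_grad : MemLp (fun x => height x ^ ((1 - 2 * s) / 2) • G x) 2 (halfVol n)
  weakGradient : HasWeakGradient u G

/-- `u₀` is the trace on `ℝ^n × {0}` of the function `u` with weak gradient `G`, expressed by
integration by parts in the direction of `x_{n+1}`:
`∫ ∂_{n+1}u ψ dx = - ∫ u ∂_{n+1}ψ dx - ∫_{ℝ^n} u₀ ψ(·,0) dx'` for `ψ ∈ C_c^∞(ℝ^{n+1})`. -/
structure IsTrace {n : ℕ} (u : EuclideanSpace ℝ (Fin (n + 1)) → ℝ)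
    (G : EuclideanSpace ℝ (Fin (n + 1)) → EuclideanSpace ℝ (Fin (n + 1)))
    (u₀ : EuclideanSpace ℝ (Fin n) → ℝ) : Prop where
  locallyIntegrable : LocallyIntegrable u₀ volume
  green : ∀ ψ : EuclideanSpace ℝ (Fin (n + 1)) → ℝ, IsTestFunction ψ →
    ∫ x, height (G x) * ψ x ∂(halfVol n)
      = - ∫ x, u x * fderiv ℝ ψ x (lastVec n) ∂(halfVol n) - ∫ x', u₀ x' * ψ (bdry x')

/-- Weak form of `∇ · x_{n+1}^{1-2s} ∇u = f` in `ℝ^{n+1}_+` together with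
`lim_{x_{n+1} → 0} x_{n+1}^{1-2s} ∂_{n+1}u = V u` on `ℝ^n × {0}`, for a function `u` with weak
gradient `G` and trace `u₀`. Here `fderiv ℝ ψ x (G x)` is `∇ψ(x) · ∇u(x)`. -/
def IsWeakSolution {n : ℕ} (s : ℝ)
    (G : EuclideanSpace ℝ (Fin (n + 1)) → EuclideanSpace ℝ (Fin (n + 1)))
    (u₀ : EuclideanSpace ℝ (Fin n) → ℝ) (f : EuclideanSpace ℝ (Fin (n + 1)) → ℝ)
    (V : EuclideanSpace ℝ (Fin n) → ℝ) : Prop :=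
  ∀ ψ : EuclideanSpace ℝ (Fin (n + 1)) → ℝ, IsTestFunction ψ →
    ∫ x, height x ^ (1 - 2 * s) * fderiv ℝ ψ x (G x) ∂(halfVol n)
      = - ∫ x, f x * ψ x ∂(halfVol n) - ∫ x', V x' * u₀ x' * ψ (bdry x')

/-- The radial derivative `x · ∇V(x)`, i.e. the derivative of `r ↦ V (r x)` at `r = 1`. -/
noncomputable def radialDeriv {n : ℕ} (V : EuclideanSpace ℝ (Fin n) → ℝ)
    (x : EuclideanSpace ℝ (Fin n)) : ℝ :=
  deriv (fun r : ℝ => V (r • x)) 1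

/-- `V` is continuous and `x · ∇V` exists everywhere and is locally bounded (for instance,
continuous). -/
structure IsRadiallyDifferentiable {n : ℕ} (V : EuclideanSpace ℝ (Fin n) → ℝ) : Prop where
  continuous : Continuous V
  differentiableAt : ∀ x, DifferentiableAt ℝ (fun r : ℝ => V (r • x)) 1
  locallyBounded : ∀ R : ℝ, ∃ M : ℝ, ∀ x, ‖x‖ ≤ R → |radialDeriv V x| ≤ M

end Carleman

namespace Carleman

open MeasureTheory Filter Topology Set
open scoped ENNReal NNReal

/-! ### Coordinates and Lebesgue measure on the half-space -/

section Coordinates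

variable {n : ℕ}

/-! Write `a = 1 - 2s`, `p = |x|^α`, `D = x · ∇u`, and let `κ` satisfy `2κ + 2 = n + 1 + a`, the
degree of homogeneity of the measure `x_{n+1}^a dx`. In the variable `log |x|` the substitution `v =
|x|^κ e^{τφ} u` removes the first-order term that comes from the weight, and the Euler derivative of
`v` is `|x|^κ e^{τφ} P` with `P = D + (κ + ταp) u`. Since `φ = e^{α log |x|}` is convex in `log
|x|`, a positive commutator argument applies. The equation is multiplied by `e^{2τφ} (αp P + α²p u)`
and integrated by parts. The outcome is `WeakSolution.carleman_identity`: the integral of `bulk`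
equals a source integral plus a boundary integral. Here `bulk` is a combination of `P²`, of the
angular gradient `|x|²|∇u|² - D²` and of `u²`, and the coefficient of `u²` has the positive leading
part `τ²α⁴p³/2`. In the boundary term the parts with an additional factor `τp` cancel, and this is
why `V` and `x · ∇V` enter with the weight `|x|^α` only.

The estimate then follows from pointwise algebra. Two completed squares absorb the source
(`quadratic_form_ge`), and `D` is recovered from `P` and `u` (`quadratic_form_le`).

The multiplier contains `x · ∇u`, which is not an admissible test function for an `H¹` solution, and
`V` has only a radial derivative. Both difficulties disappear when derivatives are replaced by
dilations. The weak equation is tested with `ρ(x) u(e^h x)` (`WeakSolution.test_dilation`), and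
symmetric difference quotients in `h` are taken at `h = 0`. A change of variables in a quadratic
pairing `∫ ζ ⟨w(e^h x), w(x)⟩` moves the whole difference onto `ζ`
(`tendsto_central_difference_quadratic`), so no second derivative of `u` is needed. This gives
`WeakSolution.virial_identity`; the case `h = 0` is the energy identity, and the same device applied
to `u²` is the mass identity. Radial choices of the three weights combine them in `bulk_identity`.

The test functions are made smooth by a mollifier that looks only upwards (`tendstoL2_mollify`,
`gradient_mollify`). It commutes with the weak gradient up to the boundary and, together with a
weighted trace inequality, converges there to the given trace (`tendstoL2_bdry_mollify`).

Finally, the cutoffs are removed. This needs polynomial moments of the weighted functions, whereas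
only integrability against `e^{2τφ}` is given. The estimate is therefore proved for exponents `σ <
τ`, where the exponential gap pays for the polynomials, and Fatou's lemma carries it to `τ`
(`WeakSolution.lintegral_energyDensity_le`). -/

theorem continuous_height : Continuous (height (n := n)) := by
  unfold height; fun_prop

theorem measurable_height : Measurable (height (n := n)) := continuous_height.measurable

theorem height_add (x y : EuclideanSpace ℝ (Fin (n + 1))) :
    height (x + y) = height x + height y := by simp [height]

theorem height_sub (x y : EuclideanSpace ℝ (Fin (n + 1))) :
    height (x - y) = height x - height y := by simp [height]

theorem height_smul (c : ℝ) (x : EuclideanSpace ℝ (Fin (n + 1))) :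
    height (c • x) = c * height x := by simp [height]

theorem height_lastVec : height (lastVec n) = 1 := by simp [height, lastVec]

theorem norm_lastVec : ‖lastVec n‖ = 1 := by simp [lastVec]

theorem inner_lastVec (x : EuclideanSpace ℝ (Fin (n + 1))) : inner ℝ x (lastVec n) = height x := by
  simp [lastVec, height, EuclideanSpace.inner_single_right]

theorem abs_height_le (x : EuclideanSpace ℝ (Fin (n + 1))) : |height x| ≤ ‖x‖ := by
  rw [← inner_lastVec]
  simpa [norm_lastVec] using abs_real_inner_le_norm x (lastVec n)

theorem height_bdry (x' : EuclideanSpace ℝ (Fin n)) : height (bdry x') = 0 := by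
  simp [height, bdry]

theorem bdry_add (x' y' : EuclideanSpace ℝ (Fin n)) : bdry (x' + y') = bdry x' + bdry y' := by
  ext i
  refine Fin.lastCases ?_ (fun i => ?_) i <;> simp [bdry]

theorem bdry_smul (c : ℝ) (x' : EuclideanSpace ℝ (Fin n)) : bdry (c • x') = c • bdry x' := by
  ext i
  refine Fin.lastCases ?_ (fun i => ?_) i <;> simp [bdry]

theorem norm_bdry (x' : EuclideanSpace ℝ (Fin n)) : ‖bdry x'‖ = ‖x'‖ := by
  simp [EuclideanSpace.norm_eq, Fin.sum_univ_castSucc, bdry]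

/-- `x' ↦ (x', 0)` as a linear isometry. -/
noncomputable def bdryₗᵢ (n : ℕ) :
    EuclideanSpace ℝ (Fin n) →ₗᵢ[ℝ] EuclideanSpace ℝ (Fin (n + 1)) where
  toFun := bdry
  map_add' := bdry_add
  map_smul' := bdry_smul
  norm_map' := norm_bdry

theorem continuous_bdry : Continuous (bdry (n := n)) := (bdryₗᵢ n).continuous

/-- The first `n` coordinates of a point of `ℝ^{n+1}`. -/
noncomputable def horizontal (x : EuclideanSpace ℝ (Fin (n + 1))) : EuclideanSpace ℝ (Fin n) :=
  WithLp.toLp 2 fun i => x i.castSucc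

theorem contDiff_horizontal : ContDiff ℝ (⊤ : ℕ∞) (horizontal (n := n)) := by
  rw [contDiff_euclidean]
  intro i
  simp only [horizontal]
  fun_prop

theorem contDiff_height : ContDiff ℝ (⊤ : ℕ∞) (height (n := n)) := by
  unfold height; fun_prop

theorem horizontal_bdry (x' : EuclideanSpace ℝ (Fin n)) : horizontal (bdry x') = x' := by
  ext i; simp [horizontal, bdry]

theorem bdry_horizontal_add (x : EuclideanSpace ℝ (Fin (n + 1))) :
    bdry (horizontal x) + height x • lastVec n = x := by
  ext i
  refine Fin.lastCases ?_ (fun i => ?_) i <;> simp [bdry, horizontal, lastVec, height]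

/-- The point `(x', y)` of `ℝ^{n+1}`. -/
noncomputable def join (p : EuclideanSpace ℝ (Fin n) × ℝ) : EuclideanSpace ℝ (Fin (n + 1)) :=
  bdry p.1 + p.2 • lastVec n

theorem height_join (p : EuclideanSpace ℝ (Fin n) × ℝ) : height (join p) = p.2 := by
  simp [join, height_add, height_smul, height_bdry, height_lastVec]

theorem continuous_join : Continuous (join (n := n)) := by
  unfold join
  exact (continuous_bdry.comp continuous_fst).add (continuous_snd.smul continuous_const)

theorem horizontal_join (p : EuclideanSpace ℝ (Fin n) × ℝ) : horizontal (join p) = p.1 := by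
  ext i
  simp [horizontal, join, bdry, lastVec]

/-- The map is a composite of measure-preserving equivalences: pass to plain tuples, swap the
factors, insert the last coordinate, and return to Euclidean space. -/
theorem measurePreserving_join :
    MeasurePreserving (join (n := n)) ((volume : Measure (EuclideanSpace ℝ (Fin n))).prod volume)
      volume := by
  have h1 := (EuclideanSpace.volume_preserving_symm_measurableEquiv_toLp (Fin n)).prod
    (MeasurePreserving.id (volume : Measure ℝ))
  have h2 := Measure.measurePreserving_swap (μ := (volume : Measure (Fin n → ℝ)))
    (ν := (volume : Measure ℝ))
  have h3 := (volume_preserving_piFinSuccAbove (fun _ : Fin (n + 1) => ℝ) (Fin.last n)).symm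
  have h4 := (EuclideanSpace.volume_preserving_symm_measurableEquiv_toLp (Fin (n + 1))).symm
  have h := h4.comp (h3.comp (h2.comp h1))
  refine (congrArg (fun g => MeasurePreserving g _ _) ?_).mp h
  funext p
  ext i
  refine Fin.lastCases ?_ (fun i => ?_) i
  · simp [join, bdry, lastVec, Function.comp_def, MeasurableEquiv.piFinSuccAbove]
  · simp [join, bdry, lastVec, Function.comp_def, MeasurableEquiv.piFinSuccAbove]

theorem measurableEmbedding_join : MeasurableEmbedding (join (n := n)) :=
  continuous_join.measurableEmbedding fun p q h => by
    ext1
    · rw [← horizontal_join p, h, horizontal_join]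
    · rw [← height_join p, h, height_join]

theorem measurableSet_halfSpace : MeasurableSet (halfSpace n) :=
  measurableSet_lt measurable_const measurable_height

theorem ae_halfVol_pos : ∀ᵐ x ∂(halfVol n), 0 < height x :=
  ae_restrict_mem measurableSet_halfSpace

/-- Lebesgue measure on the half-space in the coordinates `(x', y)`. -/
theorem measurePreserving_join_halfVol :
    MeasurePreserving (join (n := n))
      ((volume : Measure (EuclideanSpace ℝ (Fin n))).prod (volume.restrict (Ioi (0 : ℝ))))
      (halfVol n) := by
  have h := measurePreserving_join (n := n).restrict_preimage (measurableSet_halfSpace (n := n))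
  have h2 : join (n := n) ⁻¹' halfSpace n = univ ×ˢ Ioi (0 : ℝ) := by
    ext p; simp [halfSpace, height_join]
  rwa [h2, ← Measure.prod_restrict, Measure.restrict_univ] at h

theorem lintegral_halfVol {F : EuclideanSpace ℝ (Fin (n + 1)) → ℝ≥0∞} (hF : Measurable F) :
    ∫⁻ x, F x ∂(halfVol n) = ∫⁻ x', ∫⁻ y in Ioi (0 : ℝ), F (join (x', y)) := by
  rw [← measurePreserving_join_halfVol.lintegral_comp hF, lintegral_prod]
  exact (hF.comp continuous_join.measurable).aemeasurable

end Coordinates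

/-! ### The measure `x_{n+1}^a dx`: homogeneity and local finiteness -/

section WeightedMeasure

variable {n : ℕ}

/-- The measure `x_{n+1}^a dx` on the upper half-space. -/
noncomputable def wVol (n : ℕ) (a : ℝ) : Measure (EuclideanSpace ℝ (Fin (n + 1))) :=
  (halfVol n).withDensity fun x => ENNReal.ofReal (height x ^ a)

theorem measurable_weight (a : ℝ) :
    Measurable fun x : EuclideanSpace ℝ (Fin (n + 1)) => ENNReal.ofReal (height x ^ a) :=
  (measurable_height.pow_const a).ennreal_ofReal

theorem wVol_absolutelyContinuous (a : ℝ) : wVol n a ≪ halfVol n :=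
  withDensity_absolutelyContinuous _ _

theorem halfVol_absolutelyContinuous (a : ℝ) : halfVol n ≪ wVol n a := by
  refine withDensity_absolutelyContinuous' (measurable_weight a).aemeasurable ?_
  filter_upwards [ae_halfVol_pos] with x hx
  simpa using Real.rpow_pos_of_pos hx a

theorem ae_wVol_pos (a : ℝ) : ∀ᵐ x ∂(wVol n a), 0 < height x :=
  (wVol_absolutelyContinuous a).ae_le ae_halfVol_pos

theorem lintegral_wVol (a : ℝ) (F : EuclideanSpace ℝ (Fin (n + 1)) → ℝ≥0∞) :
    ∫⁻ x, F x ∂(wVol n a) = ∫⁻ x, ENNReal.ofReal (height x ^ a) * F x ∂(halfVol n) := by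
  rw [wVol, lintegral_withDensity_eq_lintegral_mul_non_measurable _ (measurable_weight a)]
  · rfl
  · exact ae_of_all _ fun x => ENNReal.ofReal_lt_top

theorem integral_wVol (a : ℝ) {F : Type*} [NormedAddCommGroup F] [NormedSpace ℝ F]
    (g : EuclideanSpace ℝ (Fin (n + 1)) → F) :
    ∫ x, g x ∂(wVol n a) = ∫ x, height x ^ a • g x ∂(halfVol n) := by
  rw [wVol, integral_withDensity_eq_integral_toReal_smul (measurable_weight a)]
  · refine integral_congr_ae ?_
    filter_upwards [ae_halfVol_pos] with x hx
    rw [ENNReal.toReal_ofReal (Real.rpow_nonneg hx.le _)]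
  · exact ae_of_all _ fun x => ENNReal.ofReal_lt_top

/-- Homogeneity of degree `d` of a measure with respect to dilations. -/
def IsHomogeneous {E : Type*} [NormedAddCommGroup E] [NormedSpace ℝ E] [MeasurableSpace E]
    (μ : Measure E) (d : ℝ) : Prop :=
  ∀ c : ℝ, 0 < c → μ.map (fun x => c • x) = ENNReal.ofReal (c ^ (-d)) • μ

theorem isHomogeneous_volume (k : ℕ) :
    IsHomogeneous (volume : Measure (EuclideanSpace ℝ (Fin k))) k := by
  intro c hc
  rw [Measure.map_addHaar_smul _ hc.ne']
  congr 2
  rw [finrank_euclideanSpace_fin, abs_of_nonneg (by positivity), Real.rpow_neg hc.le,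
    Real.rpow_natCast]

/-- The half-space is invariant under dilations, Lebesgue measure contributes the degree `n + 1` and
the weight contributes `a`. All integrations by parts along dilations rest on this; the degree is
the divergence of the field `x` with respect to the measure. -/
theorem isHomogeneous_wVol (a : ℝ) : IsHomogeneous (wVol n a) (n + 1 + a) := by
  intro c hc
  have hm : Measurable fun x : EuclideanSpace ℝ (Fin (n + 1)) => c • x := measurable_const_smul c
  have hvol := isHomogeneous_volume (n + 1) c hc
  refine Measure.ext fun s hs => ?_
  have e1 : ∀ t : Set (EuclideanSpace ℝ (Fin (n + 1))), MeasurableSet t → wVol n a t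
      = ∫⁻ x, (halfSpace n ∩ t).indicator (fun x => ENNReal.ofReal (height x ^ a)) x := by
    intro t ht
    rw [wVol, withDensity_apply _ ht, halfVol, Measure.restrict_restrict ht, inter_comm,
      lintegral_indicator (measurableSet_halfSpace.inter ht)]
  rw [Measure.map_apply hm hs, Measure.smul_apply, e1 _ (hm hs), e1 _ hs]
  have hmeas : Measurable ((halfSpace n ∩ s).indicator
      (fun x : EuclideanSpace ℝ (Fin (n + 1)) => ENNReal.ofReal (height x ^ a))) :=
    (measurable_weight a).indicator (measurableSet_halfSpace.inter hs)
  have e2 : ∀ x : EuclideanSpace ℝ (Fin (n + 1)),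
      (halfSpace n ∩ (fun x => c • x) ⁻¹' s).indicator
        (fun x => ENNReal.ofReal (height x ^ a)) x
      = ENNReal.ofReal (c ^ (-a)) * (halfSpace n ∩ s).indicator
        (fun x => ENNReal.ofReal (height x ^ a)) (c • x) := by
    intro x
    by_cases hx : x ∈ halfSpace n ∩ (fun x => c • x) ⁻¹' s
    · have hx' : c • x ∈ halfSpace n ∩ s := by
        refine ⟨?_, hx.2⟩
        have := hx.1
        simp only [halfSpace, mem_ofPred_eq, height_smul] at this ⊢
        positivity
      rw [indicator_of_mem hx, indicator_of_mem hx', ← ENNReal.ofReal_mul (by positivity),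
        height_smul, Real.mul_rpow hc.le (le_of_lt hx.1), ← mul_assoc, ← Real.rpow_add hc]
      simp
    · have hx' : c • x ∉ halfSpace n ∩ s := by
        rintro ⟨h1, h2⟩
        refine hx ⟨?_, h2⟩
        simp only [halfSpace, mem_ofPred_eq, height_smul] at h1 ⊢
        exact pos_of_mul_pos_right h1 hc.le
      rw [indicator_of_notMem hx, indicator_of_notMem hx', mul_zero]
  simp_rw [e2]
  have e3 := lintegral_const_mul (μ := volume) (ENNReal.ofReal (c ^ (-a))) (hmeas.comp hm)
  simp only [Function.comp_apply] at e3
  rw [e3, ← lintegral_map hmeas hm, hvol,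
    lintegral_smul_measure, smul_eq_mul, smul_eq_mul, ← mul_assoc,
    ← ENNReal.ofReal_mul (by positivity), ← Real.rpow_add hc]
  congr 3
  push_cast; ring

theorem lintegral_rpow_Ioo_lt_top {a : ℝ} (ha : -1 < a) (R : ℝ) :
    ∫⁻ y in Ioo (0 : ℝ) R, ENNReal.ofReal (y ^ a) < ∞ := by
  rcases le_or_gt R 0 with h | h
  · simp [Ioo_eq_empty (not_lt.2 h)]
  · have h1 := (intervalIntegral.intervalIntegrable_rpow' (a := 0) (b := R) ha)
    rw [intervalIntegrable_iff_integrableOn_Ioo_of_le h.le] at h1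
    exact h1.lintegral_lt_top

/-- The part of the ball in the half-space lies in a cylinder over a ball of `ℝ^n` with heights in
`(0, R + 1)`, and `y^a` is integrable at `0` because `a > -1`. -/
theorem wVol_closedBall_lt_top {a : ℝ} (ha : -1 < a) (R : ℝ) :
    wVol n a (Metric.closedBall 0 R) < ∞ := by
  have hmeas : Measurable fun x : EuclideanSpace ℝ (Fin (n + 1)) =>
      ENNReal.ofReal (height x ^ a) * (Metric.closedBall 0 R).indicator 1 x :=
    (measurable_weight a).mul (measurable_one.indicator measurableSet_closedBall)
  rw [← lintegral_indicator_one measurableSet_closedBall, lintegral_wVol,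
    lintegral_halfVol hmeas]
  have hle : ∀ x' : EuclideanSpace ℝ (Fin n), ∫⁻ y in Ioi (0 : ℝ),
      ENNReal.ofReal (height (join (x', y)) ^ a) *
        (Metric.closedBall (0 : EuclideanSpace ℝ (Fin (n + 1))) R).indicator 1 (join (x', y))
      ≤ (Metric.closedBall (0 : EuclideanSpace ℝ (Fin n)) R).indicator
        (fun _ => ∫⁻ y in Ioo (0 : ℝ) (R + 1), ENNReal.ofReal (y ^ a)) x' := by
    intro x'
    by_cases hx : x' ∈ Metric.closedBall (0 : EuclideanSpace ℝ (Fin n)) R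
    · rw [indicator_of_mem hx, ← lintegral_indicator measurableSet_Ioi,
        ← lintegral_indicator measurableSet_Ioo]
      refine lintegral_mono fun y => ?_
      by_cases hy : y ∈ Ioi (0 : ℝ)
      · rw [indicator_of_mem hy]
        by_cases hb : join (x', y) ∈ Metric.closedBall (0 : EuclideanSpace ℝ (Fin (n + 1))) R
        · have : y ∈ Ioo (0 : ℝ) (R + 1) := by
            refine ⟨hy, ?_⟩
            have h1 := abs_height_le (join (x', y))
            rw [height_join] at h1
            rw [mem_closedBall_zero_iff] at hb
            have := le_abs_self y
            linarith
          rw [indicator_of_mem this, indicator_of_mem hb, height_join]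
          simp
        · rw [indicator_of_notMem hb]; simp
      · rw [indicator_of_notMem hy]; simp
    · have h0 : ∀ y : ℝ, join (x', y) ∉
          Metric.closedBall (0 : EuclideanSpace ℝ (Fin (n + 1))) R := by
        intro y hy
        apply hx
        rw [mem_closedBall_zero_iff] at hy ⊢
        refine le_trans ?_ hy
        have h1 : ‖join (x', y)‖ ^ 2 = ‖x'‖ ^ 2 + y ^ 2 := by
          rw [join, norm_add_sq_real, norm_bdry, real_inner_smul_right, inner_lastVec,
            height_bdry, norm_smul, norm_lastVec]
          simp
        exact abs_le_of_sq_le_sq' (by nlinarith [sq_nonneg y]) (norm_nonneg _) |>.2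
      simp [indicator_of_notMem (h0 _)]
  refine (lintegral_mono hle).trans_lt ?_
  rw [lintegral_indicator measurableSet_closedBall, setLIntegral_const]
  exact ENNReal.mul_lt_top (lintegral_rpow_Ioo_lt_top ha _) measure_closedBall_lt_top

theorem isFiniteMeasureOnCompacts_wVol {a : ℝ} (ha : -1 < a) :
    IsFiniteMeasureOnCompacts (wVol n a) where
  lt_top_of_isCompact K hK := by
    obtain ⟨R, hR⟩ := hK.isBounded.subset_closedBall 0
    exact (measure_mono hR).trans_lt (wVol_closedBall_lt_top ha R)

theorem measurePreserving_add_bdry (a : ℝ) (z : EuclideanSpace ℝ (Fin n)) :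
    MeasurePreserving (fun x => x + bdry z) (wVol n a) (wVol n a) := by
  have h0 : MeasurePreserving (fun x : EuclideanSpace ℝ (Fin (n + 1)) => x + bdry z)
      volume volume := measurePreserving_add_right _ _
  have hpre : (fun x : EuclideanSpace ℝ (Fin (n + 1)) => x + bdry z) ⁻¹' halfSpace n
      = halfSpace n := by
    ext x; simp [halfSpace, height_add, height_bdry]
  have h1 : MeasurePreserving (fun x => x + bdry z) (halfVol n) (halfVol n) := by
    have := h0.restrict_preimage (measurableSet_halfSpace (n := n))
    rwa [hpre] at this
  refine ⟨h1.measurable, Measure.ext fun s hs => ?_⟩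
  have hmeas : Measurable fun x : EuclideanSpace ℝ (Fin (n + 1)) =>
      ENNReal.ofReal (height x ^ a) * s.indicator 1 x :=
    (measurable_weight a).mul (measurable_one.indicator hs)
  rw [Measure.map_apply h1.measurable hs, ← lintegral_indicator_one (h1.measurable hs),
    ← lintegral_indicator_one hs, lintegral_wVol, lintegral_wVol, ← h1.lintegral_comp hmeas]
  refine lintegral_congr fun x => ?_
  simp only [height_add, height_bdry, add_zero]
  rfl

end WeightedMeasure

/-! ### Convergence in `L²` of functions and of pairings -/

section L2Convergence

variable {Ω ι F : Type*} [MeasurableSpace Ω] {μ : Measure Ω} [NormedAddCommGroup F] {l : Filter ι}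

theorem eLpNorm_two_sq (f : Ω → F) : eLpNorm f 2 μ ^ 2 = ∫⁻ x, ‖f x‖ₑ ^ 2 ∂μ := by
  have h := eLpNorm_nnreal_pow_eq_lintegral (μ := μ) (f := f) (p := 2) two_ne_zero
  simpa using h

theorem tendsto_eLpNorm_zero_iff (f : ι → Ω → F) :
    Tendsto (fun i => eLpNorm (f i) 2 μ) l (𝓝 0) ↔
      Tendsto (fun i => ∫⁻ x, ‖f i x‖ₑ ^ 2 ∂μ) l (𝓝 0) := by
  simp_rw [← eLpNorm_two_sq]
  constructor
  · intro h
    simpa using ENNReal.Tendsto.pow (n := 2) h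
  · intro h
    have := ((ENNReal.continuous_rpow_const (y := (1 / 2 : ℝ))).tendsto 0).comp h
    simp only [Function.comp_def] at this
    rw [ENNReal.zero_rpow_of_pos (by norm_num)] at this
    refine this.congr fun i => ?_
    rw [← ENNReal.rpow_natCast, ← ENNReal.rpow_mul]
    norm_num

/-- Convergence in `L²(μ)` of functions. -/
structure TendstoL2 (μ : Measure Ω) (f : ι → Ω → F) (l : Filter ι) (g : Ω → F) : Prop where
  memLp : ∀ i, MemLp (f i) 2 μ
  memLp_lim : MemLp g 2 μ
  tendsto : Tendsto (fun i => eLpNorm (f i - g) 2 μ) l (𝓝 0)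

theorem tendstoL2_const {g : Ω → F} (hg : MemLp g 2 μ) (l : Filter ι) :
    TendstoL2 μ (fun _ => g) l g :=
  ⟨fun _ => hg, hg, by simpa using tendsto_const_nhds⟩

theorem TendstoL2.comp {κ : Type*} {l' : Filter κ} {f : ι → Ω → F} {g : Ω → F}
    (h : TendstoL2 μ f l g) {φ : κ → ι} (hφ : Tendsto φ l' l) :
    TendstoL2 μ (fun k => f (φ k)) l' g :=
  ⟨fun _ => h.memLp _, h.memLp_lim, h.tendsto.comp hφ⟩

theorem TendstoL2.mono_ae {G : Type*} [NormedAddCommGroup G] {f : ι → Ω → F} {g : Ω → F}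
    {f' : ι → Ω → G} {g' : Ω → G} (h : TendstoL2 μ f l g) (hf' : ∀ i, MemLp (f' i) 2 μ)
    (hg' : MemLp g' 2 μ) (C : ℝ) (hC : ∀ i, ∀ᵐ x ∂μ, ‖f' i x - g' x‖ ≤ C * ‖f i x - g x‖) :
    TendstoL2 μ f' l g' := by
  refine ⟨hf', hg', ?_⟩
  have h1 : Tendsto (fun i => ENNReal.ofReal C * eLpNorm (f i - g) 2 μ) l (𝓝 0) := by
    simpa using ENNReal.Tendsto.const_mul h.tendsto (Or.inr ENNReal.ofReal_ne_top)
  exact tendsto_of_tendsto_of_tendsto_of_le_of_le tendsto_const_nhds h1 (fun _ => zero_le)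
    fun i => eLpNorm_le_mul_eLpNorm_of_ae_le_mul (hC i) _

theorem memLp_bdd_smul [NormedSpace ℝ F] {ζ : Ω → ℝ} {g : Ω → F} {K : ℝ}
    (hζ : AEStronglyMeasurable ζ μ) (hK : ∀ᵐ x ∂μ, |ζ x| ≤ K) (hg : MemLp g 2 μ) :
    MemLp (fun x => ζ x • g x) 2 μ := by
  refine MemLp.of_le_mul (c := K) hg (hζ.smul hg.1) ?_
  filter_upwards [hK] with x hx
  rw [norm_smul]
  exact mul_le_mul_of_nonneg_right hx (norm_nonneg _)

/-- Split `ζ i • f i - ζ₀ • g` into `ζ i • (f i - g)`, which the uniform bound controls, and `(ζ i -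
ζ₀) • g`, which tends to zero by dominated convergence with majorant `2K |g|`. -/
theorem TendstoL2.smul [NormedSpace ℝ F] [l.IsCountablyGenerated] {f : ι → Ω → F} {g : Ω → F}
    (h : TendstoL2 μ f l g) {ζ : ι → Ω → ℝ} {ζ₀ : Ω → ℝ} {K : ℝ}
    (hm : ∀ i, AEStronglyMeasurable (ζ i) μ) (hm0 : AEStronglyMeasurable ζ₀ μ)
    (hK : ∀ i, ∀ᵐ x ∂μ, |ζ i x| ≤ K) (hK0 : ∀ᵐ x ∂μ, |ζ₀ x| ≤ K)
    (hlim : ∀ᵐ x ∂μ, Tendsto (fun i => ζ i x) l (𝓝 (ζ₀ x))) :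
    TendstoL2 μ (fun i x => ζ i x • f i x) l (fun x => ζ₀ x • g x) := by
  have hm1 : ∀ i, MemLp (fun x => ζ i x • g x) 2 μ := fun i =>
    memLp_bdd_smul (hm i) (hK i) h.memLp_lim
  have hm2 : ∀ i, MemLp (fun x => ζ i x • f i x) 2 μ := fun i =>
    memLp_bdd_smul (hm i) (hK i) (h.memLp i)
  have hm3 : MemLp (fun x => ζ₀ x • g x) 2 μ := memLp_bdd_smul hm0 hK0 h.memLp_lim
  refine ⟨hm2, hm3, ?_⟩
  have h1 : Tendsto (fun i => ENNReal.ofReal K * eLpNorm (f i - g) 2 μ) l (𝓝 0) := by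
    simpa using ENNReal.Tendsto.const_mul h.tendsto (Or.inr ENNReal.ofReal_ne_top)
  have h2 : Tendsto (fun i => eLpNorm (fun x => (ζ i x - ζ₀ x) • g x) 2 μ) l (𝓝 0) := by
    rw [tendsto_eLpNorm_zero_iff]
    have hz : ∫⁻ _ : Ω, (0 : ℝ≥0∞) ∂μ = 0 := by simp
    rw [← hz]
    have hgm : MemLp (fun x => (2 * K) • g x) 2 μ := h.memLp_lim.const_smul _
    refine tendsto_lintegral_filter_of_dominated_convergence' (fun x => ‖(2 * K) • g x‖ₑ ^ 2)
      (Eventually.of_forall fun i => ?_) (Eventually.of_forall fun i => ?_) ?_ ?_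
    · exact (((hm i).sub hm0).smul h.memLp_lim.1).enorm.pow_const 2
    · filter_upwards [hK i, hK0] with x hx hx0
      gcongr ?_ ^ 2
      rw [enorm_smul, enorm_smul]
      gcongr
      rw [enorm_le_iff_norm_le, Real.norm_eq_abs, Real.norm_eq_abs]
      calc |ζ i x - ζ₀ x| ≤ |ζ i x| + |ζ₀ x| := abs_sub _ _
        _ ≤ 2 * K := by linarith
        _ ≤ |2 * K| := le_abs_self _
    · rw [← eLpNorm_two_sq]
      exact ENNReal.pow_ne_top hgm.2.ne
    · filter_upwards [hlim] with x hx
      have h3 : Tendsto (fun i => (ζ i x - ζ₀ x) • g x) l (𝓝 0) := by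
        simpa using (hx.sub_const (ζ₀ x)).smul_const (g x)
      simpa using ENNReal.Tendsto.pow (n := 2) h3.enorm
  have h3 := h1.add h2
  rw [add_zero] at h3
  refine tendsto_of_tendsto_of_tendsto_of_le_of_le tendsto_const_nhds h3 (fun _ => zero_le)
    fun i => ?_
  have heq : ((fun x => ζ i x • f i x) - fun x => ζ₀ x • g x)
      = (fun x => ζ i x • (f i - g) x) + fun x => (ζ i x - ζ₀ x) • g x := by
    funext x
    simp only [Pi.sub_apply, Pi.add_apply, smul_sub, sub_smul]
    abel
  simp only
  rw [heq]
  refine (eLpNorm_add_le ((hm i).smul ((h.memLp i).1.sub h.memLp_lim.1))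
    (((hm i).sub hm0).smul h.memLp_lim.1) (by norm_num)).trans ?_
  refine add_le_add ?_ le_rfl
  refine eLpNorm_le_mul_eLpNorm_of_ae_le_mul ?_ 2
  filter_upwards [hK i] with x hx
  rw [Pi.smul_apply', norm_smul]
  exact mul_le_mul_of_nonneg_right hx (norm_nonneg _)

theorem TendstoL2.bdd_smul [NormedSpace ℝ F] [l.IsCountablyGenerated] {f : ι → Ω → F} {g : Ω → F}
    (h : TendstoL2 μ f l g) {ζ : Ω → ℝ} {K : ℝ} (hm : AEStronglyMeasurable ζ μ)
    (hK : ∀ᵐ x ∂μ, |ζ x| ≤ K) :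
    TendstoL2 μ (fun i x => ζ x • f i x) l (fun x => ζ x • g x) :=
  h.smul (fun _ => hm) hm (fun _ => hK) hK (ae_of_all _ fun _ => tendsto_const_nhds)

theorem TendstoL2.tendsto_integral_inner [InnerProductSpace ℝ F] {f f' : ι → Ω → F} {g g' : Ω → F}
    (h : TendstoL2 μ f l g) (h' : TendstoL2 μ f' l g') :
    Tendsto (fun i => ∫ x, inner ℝ (f i x) (f' i x) ∂μ) l (𝓝 (∫ x, inner ℝ (g x) (g' x) ∂μ)) := by
  have key : ∀ {p q : Ω → F} (hp : MemLp p 2 μ) (hq : MemLp q 2 μ),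
      inner ℝ (hp.toLp p) (hq.toLp q) = ∫ x, inner ℝ (p x) (q x) ∂μ := by
    intro p q hp hq
    rw [L2.inner_def]
    refine integral_congr_ae ?_
    filter_upwards [hp.coeFn_toLp, hq.coeFn_toLp] with x h1 h2
    rw [h1, h2]
  have h1 := (Lp.tendsto_Lp_iff_tendsto_eLpNorm'' f h.memLp g h.memLp_lim).2 h.tendsto
  have h2 := (Lp.tendsto_Lp_iff_tendsto_eLpNorm'' f' h'.memLp g' h'.memLp_lim).2 h'.tendsto
  have h3 := h1.inner (𝕜 := ℝ) h2
  simpa only [key] using h3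

theorem TendstoL2.tendsto_integral_mul {f f' : ι → Ω → ℝ} {g g' : Ω → ℝ}
    (h : TendstoL2 μ f l g) (h' : TendstoL2 μ f' l g') :
    Tendsto (fun i => ∫ x, f i x * f' i x ∂μ) l (𝓝 (∫ x, g x * g' x ∂μ)) := by
  have := h'.tendsto_integral_inner h
  simpa [inner] using this

theorem integrable_inner [InnerProductSpace ℝ F] {f g : Ω → F} (hf : MemLp f 2 μ)
    (hg : MemLp g 2 μ) : Integrable (fun x => inner ℝ (f x) (g x)) μ := by
  refine (L2.integrable_inner (𝕜 := ℝ) (hf.toLp f) (hg.toLp g)).congr ?_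
  filter_upwards [hf.coeFn_toLp, hg.coeFn_toLp] with x h1 h2
  rw [h1, h2]

theorem integrable_mul {f g : Ω → ℝ} (hf : MemLp f 2 μ) (hg : MemLp g 2 μ) :
    Integrable (fun x => f x * g x) μ := by
  simpa [inner] using integrable_inner hg hf

/-- A uniformly bounded family of operators that converges on a dense set converges. -/
theorem tendsto_eLpNorm_of_dense {L : ι → (Ω → F) → Ω → F} {S : Set (Ω → F)} {C : ℝ≥0∞}
    (hC : C ≠ ∞) (hS : ∀ g ∈ S, MemLp g 2 μ)
    (hmem : ∀ i, ∀ g, MemLp g 2 μ → MemLp (L i g) 2 μ)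
    (hb : ∀ᶠ i in l, ∀ f g, MemLp f 2 μ → MemLp g 2 μ →
      eLpNorm (L i f - L i g) 2 μ ≤ C * eLpNorm (f - g) 2 μ)
    (hconv : ∀ g ∈ S, Tendsto (fun i => eLpNorm (L i g - g) 2 μ) l (𝓝 0))
    {f : Ω → F} (hf : MemLp f 2 μ)
    (hdense : ∀ ε : ℝ≥0∞, ε ≠ 0 → ∃ g ∈ S, eLpNorm (f - g) 2 μ ≤ ε) :
    TendstoL2 μ (fun i => L i f) l f := by
  refine ⟨fun i => hmem i f hf, hf, ?_⟩
  rw [ENNReal.tendsto_nhds_zero]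
  intro ε hε
  -- Replacing `f` by `g` costs `C δ` under the operator and `δ` in the limit; the other half of `ε`
  -- is left for the convergence at `g`.
  obtain ⟨δ, hδ0, hδ⟩ : ∃ δ : ℝ≥0∞, δ ≠ 0 ∧ (C + 1) * δ ≤ ε / 2 := by
    refine ⟨ε / 2 / (C + 1), ?_, ENNReal.mul_div_le⟩
    refine (ENNReal.div_pos (ENNReal.half_pos hε.ne').ne' ?_).ne'
    exact ENNReal.add_ne_top.2 ⟨hC, ENNReal.one_ne_top⟩
  obtain ⟨g, hgS, hg⟩ := hdense δ hδ0
  have hgm := hS g hgS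
  have hev := (ENNReal.tendsto_nhds_zero.1 (hconv g hgS)) (ε / 2) (ENNReal.half_pos hε.ne')
  filter_upwards [hb, hev] with i hi hi2
  have heq : L i f - f = (L i f - L i g) + ((L i g - g) + (g - f)) := by abel
  rw [heq]
  have m1 := hmem i f hf
  have m2 := hmem i g hgm
  calc eLpNorm ((L i f - L i g) + ((L i g - g) + (g - f))) 2 μ
      ≤ eLpNorm (L i f - L i g) 2 μ + (eLpNorm (L i g - g) 2 μ + eLpNorm (g - f) 2 μ) :=
        (eLpNorm_add_le (m1.sub m2).1 ((m2.sub hgm).add (hgm.sub hf)).1 (by norm_num)).trans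
          (add_le_add le_rfl (eLpNorm_add_le (m2.sub hgm).1 (hgm.sub hf).1 (by norm_num)))
    _ ≤ C * δ + (ε / 2 + δ) := by
        gcongr
        · exact (hi f g hf hgm).trans (mul_le_mul_right hg _)
        · rwa [eLpNorm_sub_comm]
    _ = (C + 1) * δ + ε / 2 := by ring
    _ ≤ ε / 2 + ε / 2 := by gcongr
    _ = ε := ENNReal.add_halves ε

/-- A bound by `ε` on a common set `K` of finite measure makes the norm at most `ε μ(K)^{1/2}`. This
settles convergence on the dense class of continuous compactly supported functions, for dilations
and for mollifiers. -/
theorem tendsto_eLpNorm_of_uniform {f : ι → Ω → F} {K : Set Ω} (hK : MeasurableSet K)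
    (hμK : μ K ≠ ∞) (hsupp : ∀ᶠ i in l, ∀ᵐ x ∂μ, x ∉ K → f i x = 0)
    (hunif : ∀ ε : ℝ, 0 < ε → ∀ᶠ i in l, ∀ᵐ x ∂μ, ‖f i x‖ ≤ ε) :
    Tendsto (fun i => eLpNorm (f i) 2 μ) l (𝓝 0) := by
  have hM : μ K ^ (1 / (2 : ℝ≥0∞).toReal) ≠ ∞ := ENNReal.rpow_ne_top_of_nonneg (by norm_num) hμK
  have h0 : Tendsto (fun ε : ℝ => ENNReal.ofReal ε * μ K ^ (1 / (2 : ℝ≥0∞).toReal))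
      (𝓝[>] 0) (𝓝 0) := by
    have h1 : Tendsto (fun ε : ℝ => ENNReal.ofReal ε) (𝓝[>] 0) (𝓝 0) := by
      have := (ENNReal.continuous_ofReal.tendsto 0).mono_left (nhdsWithin_le_nhds (s := Ioi 0))
      simpa using this
    simpa using ENNReal.Tendsto.mul_const h1 (Or.inr hM)
  rw [ENNReal.tendsto_nhds_zero]
  intro η hη
  obtain ⟨ε, hε, hε0⟩ :=
    (((ENNReal.tendsto_nhds_zero.1 h0) η hη).and self_mem_nhdsWithin).exists
  filter_upwards [hsupp, hunif ε hε0] with i h1 h2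
  refine le_trans ?_ hε
  have h3 : eLpNorm (f i) 2 μ ≤ eLpNorm (K.indicator fun _ => ε) 2 μ := by
    refine eLpNorm_mono_ae ?_
    filter_upwards [h1, h2] with x hx1 hx2
    by_cases hx : x ∈ K
    · rw [indicator_of_mem hx]
      exact hx2.trans (le_abs_self ε)
    · simp [hx1 hx]
  refine h3.trans ?_
  rw [eLpNorm_indicator_const hK (by norm_num) (by norm_num), Real.enorm_eq_ofReal (le_of_lt hε0)]

theorem tendsto_integral_bdd_mul [l.IsCountablyGenerated] {J : Ω → ℝ} (hJ : Integrable J μ)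
    {g : ι → Ω → ℝ} {g₀ : Ω → ℝ} {K : ℝ} (hm : ∀ i, AEStronglyMeasurable (g i) μ)
    (hK : ∀ i, ∀ᵐ x ∂μ, |g i x| ≤ K)
    (hlim : ∀ᵐ x ∂μ, Tendsto (fun i => g i x) l (𝓝 (g₀ x))) :
    Tendsto (fun i => ∫ x, g i x * J x ∂μ) l (𝓝 (∫ x, g₀ x * J x ∂μ)) := by
  refine tendsto_integral_filter_of_dominated_convergence (fun x => K * ‖J x‖)
    (Eventually.of_forall fun i => (hm i).mul hJ.1) (Eventually.of_forall fun i => ?_)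
    (hJ.norm.const_mul K) ?_
  · filter_upwards [hK i] with x hx
    rw [norm_mul]
    exact mul_le_mul_of_nonneg_right hx (norm_nonneg _)
  · filter_upwards [hlim] with x hx
    exact hx.mul_const _

end L2Convergence

/-! ### Strong continuity of dilations on `L²` of a homogeneous measure -/

section Dilations

variable {E F : Type*} [NormedAddCommGroup E] [NormedSpace ℝ E] [MeasurableSpace E] [BorelSpace E]
  [NormedAddCommGroup F] {μ : Measure E} {d : ℝ}

theorem measurableEmbedding_const_smul {c : ℝ} (hc : 0 < c) :
    MeasurableEmbedding fun x : E => c • x :=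
  (Homeomorph.smulOfNeZero c hc.ne').measurableEmbedding

theorem IsHomogeneous.integral_comp_smul [NormedSpace ℝ F] (hμ : IsHomogeneous μ d) {c : ℝ}
    (hc : 0 < c) (g : E → F) : ∫ x, g (c • x) ∂μ = c ^ (-d) • ∫ x, g x ∂μ := by
  rw [← (measurableEmbedding_const_smul hc).integral_map (μ := μ) g, hμ c hc,
    integral_smul_measure, ENNReal.toReal_ofReal (Real.rpow_nonneg hc.le _)]

theorem IsHomogeneous.eLpNorm_comp_smul (hμ : IsHomogeneous μ d) {c : ℝ}
    (hc : 0 < c) (g : E → F) :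
    eLpNorm (fun x => g (c • x)) 2 μ = ENNReal.ofReal (c ^ (-d)) ^ (1 / 2 : ℝ) * eLpNorm g 2 μ := by
  have h := (measurableEmbedding_const_smul (E := E) hc).eLpNorm_map_measure (g := g) (p := 2)
    (μ := μ)
  rw [hμ c hc, eLpNorm_smul_measure_of_ne_top (by norm_num)] at h
  rw [show (fun x => g (c • x)) = g ∘ fun x => c • x from rfl, ← h]
  simp

theorem IsHomogeneous.memLp_comp_smul (hμ : IsHomogeneous μ d) {c : ℝ} (hc : 0 < c) {g : E → F}
    (hg : MemLp g 2 μ) : MemLp (fun x => g (c • x)) 2 μ := by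
  have h := (measurableEmbedding_const_smul (E := E) hc).memLp_map_measure_iff (g := g) (p := 2)
    (μ := μ)
  refine h.1 ?_
  rw [hμ c hc]
  exact hg.smul_measure ENNReal.ofReal_ne_top

/-- By homogeneity the dilation by `e^h` multiplies the norm by `e^{-hd/2}`, which is bounded for
`|h| < 1`, so it is enough to treat continuous compactly supported functions, where uniform
continuity applies. A general `t` reduces to `0` by the group law, applied to the dilated function.
-/
theorem IsHomogeneous.tendstoL2_comp_exp_smul [NormedSpace ℝ F] [ProperSpace E]
    [IsFiniteMeasureOnCompacts μ] (hμ : IsHomogeneous μ d) {g : E → F} (hg : MemLp g 2 μ) (t : ℝ) :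
    TendstoL2 μ (fun h x => g (Real.exp h • x)) (𝓝 t) (fun x => g (Real.exp t • x)) := by
  have key : ∀ {g : E → F}, MemLp g 2 μ →
      TendstoL2 μ (fun (h : ℝ) x => g (Real.exp h • x)) (𝓝 0) g := by
    intro g hg
    refine tendsto_eLpNorm_of_dense (C := ENNReal.ofReal (Real.exp |d|) ^ (1 / 2 : ℝ))
      (L := fun (h : ℝ) (g : E → F) x => g (Real.exp h • x))
      (S := {g | Continuous g ∧ HasCompactSupport g})
      (ENNReal.rpow_ne_top_of_nonneg (by norm_num) ENNReal.ofReal_ne_top) ?_ ?_ ?_ ?_ hg ?_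
    · rintro g ⟨h1, h2⟩
      exact h1.memLp_of_hasCompactSupport h2
    · intro h g hg
      exact hμ.memLp_comp_smul (Real.exp_pos h) hg
    · filter_upwards [Metric.ball_mem_nhds (0 : ℝ) one_pos] with h hh f g hf hg
      have := hμ.eLpNorm_comp_smul (Real.exp_pos h) (f - g)
      refine this.le.trans ?_
      gcongr
      rw [← Real.exp_mul]
      gcongr
      rw [Metric.mem_ball, dist_zero_right, Real.norm_eq_abs] at hh
      calc h * -d ≤ |h * -d| := le_abs_self _
        _ = |h| * |d| := by rw [abs_mul, abs_neg]
        _ ≤ 1 * |d| := by gcongr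
        _ = |d| := one_mul _
    · rintro g ⟨h1, h2⟩
      obtain ⟨R, hR⟩ := h2.isCompact.isBounded.subset_closedBall 0
      have hz : ∀ x, R < ‖x‖ → g x = 0 := fun x hx => by
        refine image_eq_zero_of_notMem_tsupport fun h => ?_
        have := hR h
        rw [mem_closedBall_zero_iff] at this
        linarith
      have hexp1 : ∀ᶠ h : ℝ in 𝓝 0, |h| < 1 := by
        filter_upwards [Metric.ball_mem_nhds (0 : ℝ) one_pos] with h hh
        simpa using hh
      -- For `|h| < 1` the supports of all dilates stay in one ball, enlarged by the factor `e`.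
      have hfar : ∀ h : ℝ, |h| < 1 → ∀ x : E, Real.exp 1 * |R| < ‖x‖ →
          g (Real.exp h • x) = 0 ∧ g x = 0 := by
        intro h hh x hx
        refine ⟨hz _ ?_, hz _ ?_⟩
        · rw [norm_smul, Real.norm_eq_abs, abs_of_pos (Real.exp_pos _)]
          have h3 : Real.exp (-1) ≤ Real.exp h := Real.exp_le_exp.2 (by linarith [(abs_lt.1 hh).1])
          have h4 : Real.exp (-1) * Real.exp 1 = 1 := by rw [← Real.exp_add]; simp
          calc R ≤ |R| := le_abs_self R
            _ = Real.exp (-1) * (Real.exp 1 * |R|) := by rw [← mul_assoc, h4, one_mul]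
            _ < Real.exp (-1) * ‖x‖ := by gcongr
            _ ≤ Real.exp h * ‖x‖ := by gcongr
        · have h3 : 1 ≤ Real.exp 1 := Real.one_le_exp zero_le_one
          nlinarith [le_abs_self R, abs_nonneg R]
      refine tendsto_eLpNorm_of_uniform (K := Metric.closedBall 0 (Real.exp 1 * |R|))
        measurableSet_closedBall (isCompact_closedBall _ _).measure_lt_top.ne ?_ ?_
      · filter_upwards [hexp1] with h hh
        refine ae_of_all _ fun x hx => ?_
        rw [mem_closedBall_zero_iff, not_le] at hx
        simp only [Pi.sub_apply]
        rw [(hfar h hh x hx).1, (hfar h hh x hx).2, sub_zero]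
      · intro ε hε
        obtain ⟨δ, hδ, hδ'⟩ := Metric.uniformContinuous_iff.1
          (h2.uniformContinuous_of_continuous h1) ε hε
        have h5 : ∀ᶠ h : ℝ in 𝓝 0, |Real.exp h - 1| * (Real.exp 1 * |R| + 1) < δ := by
          have : Tendsto (fun h : ℝ => |Real.exp h - 1| * (Real.exp 1 * |R| + 1)) (𝓝 0) (𝓝 0) := by
            have hc : Continuous fun h : ℝ => |Real.exp h - 1| * (Real.exp 1 * |R| + 1) := by
              fun_prop
            simpa using hc.tendsto 0
          exact this.eventually (gt_mem_nhds hδ)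
        filter_upwards [h5, hexp1] with h hh hh1
        refine ae_of_all _ fun x => ?_
        simp only [Pi.sub_apply]
        by_cases hx : ‖x‖ ≤ Real.exp 1 * |R|
        · rw [← dist_eq_norm]
          refine (hδ' ?_).le
          rw [dist_eq_norm, show Real.exp h • x - x = (Real.exp h - 1) • x by
            rw [sub_smul, one_smul], norm_smul, Real.norm_eq_abs]
          refine lt_of_le_of_lt ?_ hh
          gcongr
          linarith
        · rw [not_le] at hx
          rw [(hfar h hh1 x hx).1, (hfar h hh1 x hx).2, sub_zero, norm_zero]
          exact hε.le
    · intro ε hε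
      obtain ⟨g', h1, h2, h3, -⟩ := hg.exists_hasCompactSupport_eLpNorm_sub_le (by norm_num) hε
      exact ⟨g', ⟨h3, h1⟩, h2⟩
  have h := (key (hμ.memLp_comp_smul (Real.exp_pos t) hg)).comp
    (φ := fun h : ℝ => h - t) (l' := 𝓝 t) (by
      have : Continuous fun h : ℝ => h - t := by fun_prop
      simpa using this.tendsto t)
  convert h using 4 with h x
  rw [smul_smul, ← Real.exp_add]
  ring_nf

end Dilations

/-! ### The Cauchy–Schwarz inequality for lower integrals -/

theorem lintegral_mul_sq_le {Ω : Type*} [MeasurableSpace Ω] {μ : Measure Ω} {f g : Ω → ℝ≥0∞}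
    (hf : AEMeasurable f μ) (hg : AEMeasurable g μ) :
    (∫⁻ x, f x * g x ∂μ) ^ 2 ≤ (∫⁻ x, f x ^ 2 ∂μ) * ∫⁻ x, g x ^ 2 ∂μ := by
  have h := ENNReal.lintegral_mul_le_Lp_mul_Lq μ Real.HolderConjugate.two_two hf hg
  simp only [Pi.mul_apply] at h
  calc (∫⁻ x, f x * g x ∂μ) ^ 2
      ≤ ((∫⁻ x, f x ^ (2 : ℝ) ∂μ) ^ (1 / (2 : ℝ)) * (∫⁻ x, g x ^ (2 : ℝ) ∂μ) ^ (1 / (2 : ℝ))) ^ 2 := by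
        gcongr
    _ = _ := by
        rw [mul_pow, ← ENNReal.rpow_natCast, ← ENNReal.rpow_natCast, ← ENNReal.rpow_mul,
          ← ENNReal.rpow_mul]
        norm_num

/-- Cauchy–Schwarz for the factors `w^{1/2}` and `w^{1/2} g`. -/
theorem lintegral_weight_mul_sq_le {Ω : Type*} [MeasurableSpace Ω] {μ : Measure Ω}
    {w g : Ω → ℝ≥0∞} (hw : AEMeasurable w μ) (hg : AEMeasurable g μ) :
    (∫⁻ x, w x * g x ∂μ) ^ 2 ≤ (∫⁻ x, w x ∂μ) * ∫⁻ x, w x * g x ^ 2 ∂μ := by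
  have h := lintegral_mul_sq_le (hw.pow_const (1 / 2 : ℝ))
    ((hw.pow_const (1 / 2 : ℝ)).mul hg)
  have e : ∀ z : ℝ≥0∞, (z ^ (1 / 2 : ℝ)) ^ 2 = z := fun z => by
    rw [← ENNReal.rpow_natCast, ← ENNReal.rpow_mul]; norm_num
  simp only [Pi.mul_apply, mul_pow, e] at h
  refine le_trans (le_of_eq ?_) h
  congr 1
  refine lintegral_congr fun x => ?_
  rw [← mul_assoc, ← sq, e]

/-! ### Weighted `L²` against Lebesgue measure, and weights of small balls -/

section Weights

variable {n : ℕ} {a : ℝ} {F : Type*} [NormedAddCommGroup F]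

/-- The square integral against `y^a` is at most `K²` times the integral of `y^{-a}` over a ball,
finite because `a < 1`. This turns unweighted integrals against bounded, boundedly supported
functions into pairings in `L²(y^a)`, and it makes functions of that space locally integrable for
Lebesgue measure. -/
theorem memLp_mul_weight_neg (ha : a < 1) {ζ : EuclideanSpace ℝ (Fin (n + 1)) → ℝ} {K R : ℝ}
    (hm : AEStronglyMeasurable ζ (wVol n a)) (hK : ∀ x, |ζ x| ≤ K)
    (hR : ∀ x, R < ‖x‖ → ζ x = 0) :
    MemLp (fun x => ζ x * height x ^ (-a)) 2 (wVol n a) := by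
  refine ⟨hm.mul (measurable_height.pow_const (-a)).aestronglyMeasurable, ?_⟩
  have h1 : eLpNorm (fun x => ζ x * height x ^ (-a)) 2 (wVol n a) ^ 2 < ∞ := by
    rw [eLpNorm_two_sq, lintegral_wVol]
    calc ∫⁻ x, ENNReal.ofReal (height x ^ a) * ‖ζ x * height x ^ (-a)‖ₑ ^ 2 ∂(halfVol n)
        ≤ ∫⁻ x, ENNReal.ofReal (height x ^ (-a)) *
          (ENNReal.ofReal K ^ 2 * (Metric.closedBall 0 R).indicator 1 x) ∂(halfVol n) := by
          refine lintegral_mono_ae ?_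
          filter_upwards [ae_halfVol_pos] with x hx
          by_cases hxR : R < ‖x‖
          · simp [hR x hxR]
          · rw [indicator_of_mem (by simpa using hxR), enorm_mul, mul_pow,
              Real.enorm_eq_ofReal (Real.rpow_nonneg hx.le _), Pi.one_apply, mul_one,
              mul_left_comm, mul_comm (ENNReal.ofReal (height x ^ (-a))),
              ← ENNReal.ofReal_pow (Real.rpow_nonneg hx.le _),
              ← ENNReal.ofReal_mul (Real.rpow_nonneg hx.le _)]
            have e : height x ^ a * (height x ^ (-a)) ^ 2 = height x ^ (-a) := by
              rw [sq, ← mul_assoc, ← Real.rpow_add hx]; simp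
            rw [e]
            gcongr
            rw [← ofReal_norm]
            exact ENNReal.ofReal_le_ofReal (hK x)
      _ = ENNReal.ofReal K ^ 2 * wVol n (-a) (Metric.closedBall 0 R) := by
          rw [← lintegral_indicator_one measurableSet_closedBall, lintegral_wVol,
            ← lintegral_const_mul']
          · refine lintegral_congr fun x => ?_
            ring
          · exact ENNReal.pow_ne_top ENNReal.ofReal_ne_top
      _ < ∞ := ENNReal.mul_lt_top (ENNReal.pow_lt_top ENNReal.ofReal_lt_top)
          (wVol_closedBall_lt_top (by linarith) R)
  by_contra h
  rw [not_lt, top_le_iff] at h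
  rw [h] at h1
  simp at h1

theorem integral_halfVol_smul [NormedSpace ℝ F] (ζ : EuclideanSpace ℝ (Fin (n + 1)) → ℝ)
    (g : EuclideanSpace ℝ (Fin (n + 1)) → F) :
    ∫ x, ζ x • g x ∂(halfVol n) = ∫ x, (ζ x * height x ^ (-a)) • g x ∂(wVol n a) := by
  rw [integral_wVol]
  refine integral_congr_ae ?_
  filter_upwards [ae_halfVol_pos] with x hx
  rw [smul_smul, mul_left_comm, ← Real.rpow_add hx]
  simp

theorem integrable_wVol_iff [NormedSpace ℝ F] {g : EuclideanSpace ℝ (Fin (n + 1)) → F} :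
    Integrable g (wVol n a) ↔ Integrable (fun x => height x ^ a • g x) (halfVol n) := by
  rw [wVol, integrable_withDensity_iff_integrable_smul' (measurable_weight a)
    (ae_of_all _ fun x => ENNReal.ofReal_lt_top)]
  refine integrable_congr ?_
  filter_upwards [ae_halfVol_pos] with x hx
  rw [ENNReal.toReal_ofReal (Real.rpow_nonneg hx.le _)]

theorem integrable_halfVol_smul [NormedSpace ℝ F] (ha : a < 1)
    {ζ : EuclideanSpace ℝ (Fin (n + 1)) → ℝ} {K R : ℝ}
    (hm : AEStronglyMeasurable ζ (wVol n a)) (hK : ∀ x, |ζ x| ≤ K)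
    (hR : ∀ x, R < ‖x‖ → ζ x = 0) {g : EuclideanSpace ℝ (Fin (n + 1)) → F}
    (hg : MemLp g 2 (wVol n a)) : Integrable (fun x => ζ x • g x) (halfVol n) := by
  have h := (memLp_mul_weight_neg ha hm hK hR).integrable_mul hg.norm
  have h2 : Integrable (fun x => (ζ x * height x ^ (-a)) • g x) (wVol n a) := by
    refine h.mono ?_ (ae_of_all _ fun x => ?_)
    · exact ((memLp_mul_weight_neg ha hm hK hR).1).smul hg.1
    · simp [norm_smul]
  rw [integrable_wVol_iff] at h2
  refine h2.congr ?_
  filter_upwards [ae_halfVol_pos] with x hx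
  rw [smul_smul, mul_left_comm, ← Real.rpow_add hx]
  simp

theorem locallyIntegrable_indicator [NormedSpace ℝ F] (ha : a < 1)
    {g : EuclideanSpace ℝ (Fin (n + 1)) → F} (hg : MemLp g 2 (wVol n a)) :
    LocallyIntegrable ((halfSpace n).indicator g) volume := by
  rw [locallyIntegrable_iff]
  intro K hK
  obtain ⟨R, hR⟩ := hK.isBounded.subset_closedBall 0
  have h := integrable_halfVol_smul (K := 1) (R := R) ha
    (ζ := (Metric.closedBall 0 R).indicator 1)
    (measurable_one.indicator measurableSet_closedBall).aestronglyMeasurable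
    (fun x => by by_cases hx : x ∈ Metric.closedBall (0 : EuclideanSpace ℝ (Fin (n + 1))) R <;>
      simp [indicator, hx])
    (fun x hx => by rw [indicator_of_notMem]; simpa using hx) hg
  rw [halfVol, ← IntegrableOn, ← integrable_indicator_iff measurableSet_halfSpace] at h
  refine IntegrableOn.mono_set ?_ hR
  rw [← integrable_indicator_iff measurableSet_closedBall]
  refine h.congr (ae_of_all _ fun x => ?_)
  by_cases h1 : x ∈ halfSpace n <;>
    by_cases h2 : x ∈ Metric.closedBall (0 : EuclideanSpace ℝ (Fin (n + 1))) R <;>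
      simp [indicator, h1, h2]

/-- The ball sits below `p`, so heights in it are smaller than that of `p`; for `a ≥ 0` this alone
bounds the weight. For `a < 0` a lower bound on heights is needed. If `p` has height at least `4δ`,
every height in the ball is at least a quarter of it. If the height is at most `δ`, the ball misses
the open half-space. In between, the height is comparable with `δ` and homogeneity gives the size of
the ball. Such a bound is what makes the mollifiers uniformly bounded in the weighted space for both
signs of `a`. -/
theorem wVol_closedBall_le (ha : -1 < a) :
    ∃ C : ℝ≥0∞, C ≠ ∞ ∧ ∀ δ : ℝ, 0 < δ → ∀ p : EuclideanSpace ℝ (Fin (n + 1)), 0 < height p →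
      wVol n a (Metric.closedBall (p - (2 * δ) • lastVec n) δ)
        ≤ C * ENNReal.ofReal (δ ^ (n + 1)) * ENNReal.ofReal (height p ^ a) := by
  set v1 := (volume : Measure (EuclideanSpace ℝ (Fin (n + 1)))) (Metric.closedBall 0 1) with hv1
  set m3 := wVol n a (Metric.closedBall 0 3) with hm3
  refine ⟨4 * v1 + 4 * m3, ?_, fun δ hδ p hp => ?_⟩
  · exact ENNReal.add_ne_top.2 ⟨ENNReal.mul_ne_top (by norm_num) measure_closedBall_lt_top.ne,
      ENNReal.mul_ne_top (by norm_num) (wVol_closedBall_lt_top ha 3).ne⟩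
  have hheight : ∀ x ∈ Metric.closedBall (p - (2 * δ) • lastVec n) δ,
      height p - 3 * δ ≤ height x ∧ height x ≤ height p - δ := by
    intro x hx
    rw [Metric.mem_closedBall, dist_eq_norm] at hx
    have := (abs_height_le _).trans hx
    rw [height_sub, height_sub, height_smul, height_lastVec, abs_le] at this
    constructor <;> linarith
  rcases le_or_gt (4 * δ) (height p) with h4 | h4
  · have h1 : wVol n a (Metric.closedBall (p - (2 * δ) • lastVec n) δ)
        ≤ ENNReal.ofReal (4 * height p ^ a) *
          volume (Metric.closedBall (p - (2 * δ) • lastVec n) δ) := by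
      rw [← lintegral_indicator_one measurableSet_closedBall, lintegral_wVol]
      calc _ ≤ ∫⁻ x, ENNReal.ofReal (4 * height p ^ a) *
            (Metric.closedBall (p - (2 * δ) • lastVec n) δ).indicator 1 x ∂(halfVol n) := by
            refine lintegral_mono fun x => ?_
            by_cases hx : x ∈ Metric.closedBall (p - (2 * δ) • lastVec n) δ
            · obtain ⟨h5, h6⟩ := hheight x hx
              gcongr
              rcases le_or_gt 0 a with h0 | h0
              · calc height x ^ a ≤ height p ^ a :=
                      Real.rpow_le_rpow (by linarith) (by linarith) h0
                  _ ≤ 4 * height p ^ a := by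
                      linarith [Real.rpow_nonneg hp.le a]
              · calc height x ^ a ≤ (height p / 4) ^ a :=
                      Real.rpow_le_rpow_of_nonpos (by linarith) (by linarith) h0.le
                  _ = height p ^ a * (4 : ℝ) ^ (-a) := by
                      rw [Real.div_rpow hp.le (by norm_num), Real.rpow_neg (by norm_num)]; rfl
                  _ ≤ height p ^ a * (4 : ℝ) ^ (1 : ℝ) := by
                      gcongr
                      · norm_num
                      · linarith
                  _ = 4 * height p ^ a := by rw [Real.rpow_one]; ring
            · simp [indicator_of_notMem hx]
        _ ≤ ∫⁻ x, ENNReal.ofReal (4 * height p ^ a) *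
            (Metric.closedBall (p - (2 * δ) • lastVec n) δ).indicator 1 x :=
            lintegral_mono' Measure.restrict_le_self le_rfl
        _ = _ := by
            rw [lintegral_const_mul' _ _ ENNReal.ofReal_ne_top,
              lintegral_indicator_one measurableSet_closedBall]
    refine h1.trans ?_
    rw [Measure.addHaar_closedBall' _ _ hδ.le, finrank_euclideanSpace_fin,
      ENNReal.ofReal_mul (by norm_num)]
    calc _ = (4 * v1) * ENNReal.ofReal (δ ^ (n + 1)) * ENNReal.ofReal (height p ^ a) := by
          rw [show ENNReal.ofReal 4 = 4 by norm_num]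
          ring
      _ ≤ _ := by gcongr; exact le_self_add
  · rcases le_or_gt (height p) δ with h1 | h1
    · have h0 : wVol n a (Metric.closedBall (p - (2 * δ) • lastVec n) δ) = 0 := by
        have := ae_wVol_pos (n := n) a
        refine measure_mono_null (fun x hx => ?_) (ae_iff.1 this)
        have := (hheight x hx).2
        simp only [mem_ofPred_eq, not_lt]
        linarith
      rw [h0]
      exact zero_le
    -- A horizontal translation moves the centre onto the vertical axis, at distance at most `2δ`
    -- from the origin, so the ball lies in the one of radius `3δ`, whose weight scales exactly.
    · have hmp := measurePreserving_add_bdry a (horizontal p)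
      have h2 : wVol n a (Metric.closedBall (p - (2 * δ) • lastVec n) δ)
          ≤ wVol n a (Metric.closedBall 0 (δ * 3)) := by
        rw [← hmp.measure_preimage measurableSet_closedBall.nullMeasurableSet]
        refine measure_mono fun x hx => ?_
        rw [mem_preimage, Metric.mem_closedBall, dist_eq_norm] at hx
        rw [mem_closedBall_zero_iff]
        have e : x + bdry (horizontal p) - (p - (2 * δ) • lastVec n)
            = x - (height p - 2 * δ) • lastVec n := by
          nth_rewrite 2 [← bdry_horizontal_add p]
          rw [sub_smul]; abel
        rw [e] at hx
        have h3 := norm_le_norm_sub_add x ((height p - 2 * δ) • lastVec n)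
        rw [norm_smul (height p - 2 * δ), norm_lastVec, mul_one, Real.norm_eq_abs] at h3
        have h5 : |height p - 2 * δ| ≤ 2 * δ := abs_le.2 ⟨by linarith, by linarith⟩
        linarith
      have h3 : wVol n a (Metric.closedBall 0 (δ * 3)) = ENNReal.ofReal (δ ^ ((n : ℝ) + 1 + a)) * m3 := by
        have h := isHomogeneous_wVol (n := n) a δ⁻¹ (inv_pos.2 hδ)
        have h5 := congrArg (fun ν => ν (Metric.closedBall 0 3)) h
        simp only [Measure.smul_apply, smul_eq_mul] at h5
        rw [Measure.map_apply (measurable_const_smul _) measurableSet_closedBall] at h5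
        rw [Real.inv_rpow hδ.le, Real.rpow_neg hδ.le, inv_inv] at h5
        rw [← h5]
        congr 1
        ext x
        simp only [mem_preimage, mem_closedBall_zero_iff, norm_smul, norm_inv, Real.norm_eq_abs,
          abs_of_pos hδ]
        rw [inv_mul_le_iff₀ hδ]
      have h6 : δ ^ a ≤ 4 * height p ^ a := by
        rcases le_or_gt 0 a with h0 | h0
        · linarith [Real.rpow_le_rpow hδ.le h1.le h0, Real.rpow_nonneg hδ.le a]
        · calc δ ^ a ≤ (height p / 4) ^ a :=
                Real.rpow_le_rpow_of_nonpos (by linarith) (by linarith) h0.le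
            _ = height p ^ a * (4 : ℝ) ^ (-a) := by
                rw [Real.div_rpow hp.le (by norm_num), Real.rpow_neg (by norm_num)]; rfl
            _ ≤ height p ^ a * (4 : ℝ) ^ (1 : ℝ) := by
                gcongr
                · norm_num
                · linarith
            _ = 4 * height p ^ a := by rw [Real.rpow_one]; ring
      refine h2.trans (h3.le.trans ?_)
      calc ENNReal.ofReal (δ ^ ((n : ℝ) + 1 + a)) * m3
          = ENNReal.ofReal (δ ^ (n + 1)) * ENNReal.ofReal (δ ^ a) * m3 := by
            rw [← ENNReal.ofReal_mul (by positivity), Real.rpow_add hδ, ← Real.rpow_natCast]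
            push_cast; rfl
        _ ≤ ENNReal.ofReal (δ ^ (n + 1)) * ENNReal.ofReal (4 * height p ^ a) * m3 := by gcongr
        _ = (4 * m3) * ENNReal.ofReal (δ ^ (n + 1)) * ENNReal.ofReal (height p ^ a) := by
            rw [ENNReal.ofReal_mul (by norm_num), show ENNReal.ofReal 4 = 4 by norm_num]
            ring
        _ ≤ _ := by gcongr; exact le_add_self

end Weights

/-! ### Mollification from above the boundary -/

section Mollifier

variable {n : ℕ} {a : ℝ} {F : Type*} [NormedAddCommGroup F] [NormedSpace ℝ F]

/-- The scales of the mollifiers. -/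
noncomputable def scale (k : ℕ) : ℝ := 1 / ((k : ℝ) + 1)

theorem scale_pos (k : ℕ) : 0 < scale k := by unfold scale; positivity

theorem tendsto_scale : Tendsto scale atTop (𝓝 0) := tendsto_one_div_add_atTop_nhds_zero_nat

/-- A bump function supported in a ball below the boundary. -/
noncomputable def bump (n k : ℕ) :
    ContDiffBump (-((2 * scale k) • lastVec n) : EuclideanSpace ℝ (Fin (n + 1))) where
  rIn := scale k / 2
  rOut := scale k
  rIn_pos := half_pos (scale_pos k)
  rIn_lt_rOut := half_lt_self (scale_pos k)

/-- The normalized mollification kernel. -/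
noncomputable def kern (n k : ℕ) : EuclideanSpace ℝ (Fin (n + 1)) → ℝ := (bump n k).normed volume

theorem contDiff_kern (k : ℕ) : ContDiff ℝ (⊤ : ℕ∞) (kern n k) := (bump n k).contDiff_normed

theorem hasCompactSupport_kern (k : ℕ) : HasCompactSupport (kern n k) :=
  (bump n k).hasCompactSupport_normed

theorem kern_nonneg (k : ℕ) (x : EuclideanSpace ℝ (Fin (n + 1))) : 0 ≤ kern n k x :=
  (bump n k).nonneg_normed x

theorem integral_kern (k : ℕ) : ∫ x, kern n k x = 1 := (bump n k).integral_normed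

theorem norm_sub_le_of_kern_ne_zero {k : ℕ} {x p : EuclideanSpace ℝ (Fin (n + 1))}
    (h : kern n k (x - p) ≠ 0) : ‖x - (p - (2 * scale k) • lastVec n)‖ < scale k := by
  have h1 : x - p ∈ Function.support (kern n k) := h
  rw [kern, (bump n k).support_normed_eq, Metric.mem_ball, dist_eq_norm] at h1
  rwa [sub_neg_eq_add, sub_add] at h1

/-- The kernel is centred at distance `2 * scale k` below the origin and has radius `scale k`, so
the average at `x` sees only points strictly above `x`. At points of the closed half-space the
boundary therefore plays no role. -/
theorem height_of_kern_ne_zero {k : ℕ} {x p : EuclideanSpace ℝ (Fin (n + 1))}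
    (h : kern n k (x - p) ≠ 0) : height x + scale k < height p := by
  have h1 := (abs_height_le _).trans_lt (norm_sub_le_of_kern_ne_zero h)
  rw [height_sub, height_sub, height_smul, height_lastVec, abs_lt] at h1
  linarith

theorem norm_sub_lt_of_kern_ne_zero {k : ℕ} {x p : EuclideanSpace ℝ (Fin (n + 1))}
    (h : kern n k (x - p) ≠ 0) : ‖x - p‖ < 3 * scale k := by
  have h1 := norm_sub_le_of_kern_ne_zero h
  have h2 : x - p = (x - (p - (2 * scale k) • lastVec n)) - (2 * scale k) • lastVec n := by abel
  have h3 : ‖(2 * scale k) • lastVec n‖ = 2 * scale k := by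
    rw [norm_smul, norm_lastVec, mul_one, Real.norm_eq_abs, abs_of_pos (by linarith [scale_pos k])]
  rw [h2]
  linarith [norm_sub_le (x - (p - (2 * scale k) • lastVec n)) ((2 * scale k) • lastVec n)]

theorem exists_kern_bound (n k : ℕ) : ∃ K : ℝ, ∀ x, |kern n k x| ≤ K := by
  obtain ⟨K, hK⟩ := (hasCompactSupport_kern (n := n) k).exists_bound_of_continuous
    (contDiff_kern k).continuous
  exact ⟨K, hK⟩

/-- Mollification of a function on the half-space, at points above the boundary. -/
noncomputable def mollify (k : ℕ) (g : EuclideanSpace ℝ (Fin (n + 1)) → F)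
    (x : EuclideanSpace ℝ (Fin (n + 1))) : F := ∫ p, kern n k (x - p) • g p ∂(halfVol n)

/-- Extension by zero yields an ordinary convolution, hence a function smooth on the whole space.
The jump of the extension at the boundary affects its values only at points below the boundary. -/
theorem mollify_eq_convolution (k : ℕ) (g : EuclideanSpace ℝ (Fin (n + 1)) → F) :
    mollify k g = convolution ((halfSpace n).indicator g) (kern n k)
      (ContinuousLinearMap.lsmul ℝ ℝ).flip volume := by
  funext x
  rw [mollify, convolution, halfVol, ← integral_indicator measurableSet_halfSpace]
  refine integral_congr_ae (ae_of_all _ fun p => ?_)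
  by_cases hp : p ∈ halfSpace n <;> simp [hp]

theorem contDiff_mollify (ha : a < 1) (k : ℕ) {g : EuclideanSpace ℝ (Fin (n + 1)) → F}
    (hg : MemLp g 2 (wVol n a)) : ContDiff ℝ (⊤ : ℕ∞) (mollify k g) := by
  rw [mollify_eq_convolution]
  exact (hasCompactSupport_kern k).contDiff_convolution_right _ (locallyIntegrable_indicator ha hg)
    (contDiff_kern k)

theorem integrable_kern_smul (ha : a < 1) (k : ℕ) {g : EuclideanSpace ℝ (Fin (n + 1)) → F}
    (hg : MemLp g 2 (wVol n a)) (x : EuclideanSpace ℝ (Fin (n + 1))) :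
    Integrable (fun p => kern n k (x - p) • g p) (halfVol n) := by
  obtain ⟨K, hK⟩ := exists_kern_bound n k
  refine integrable_halfVol_smul (K := K) (R := ‖x‖ + 3 * scale k) ha
    ((contDiff_kern k).continuous.comp (continuous_const.sub continuous_id)).aestronglyMeasurable
    (fun p => hK _) (fun p hp => ?_) hg
  by_contra h
  have h1 : ‖x - p‖ < 3 * scale k := norm_sub_lt_of_kern_ne_zero h
  have h2 := norm_sub_norm_le p x
  rw [norm_sub_rev] at h2
  linarith

theorem mollify_sub (ha : a < 1) (k : ℕ) {f g : EuclideanSpace ℝ (Fin (n + 1)) → F}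
    (hf : MemLp f 2 (wVol n a)) (hg : MemLp g 2 (wVol n a)) :
    mollify k f - mollify k g = mollify k (f - g) := by
  funext x
  simp only [Pi.sub_apply, mollify, smul_sub]
  rw [integral_sub (integrable_kern_smul ha k hf x) (integrable_kern_smul ha k hg x)]

/-- The kernel is at most `2^{n+1}` divided by the volume of its supporting ball, the factor `2`
being the ratio of the outer to the inner radius of the bump. The weight of that ball is bounded by
`wVol_closedBall_le`. -/
theorem lintegral_kern_le (ha : -1 < a) : ∃ C : ℝ≥0∞, C ≠ ∞ ∧ ∀ k,
    ∀ p : EuclideanSpace ℝ (Fin (n + 1)), 0 < height p →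
      ∫⁻ x, ENNReal.ofReal (kern n k (x - p)) ∂(wVol n a) ≤ C * ENNReal.ofReal (height p ^ a) := by
  obtain ⟨C, hC, hb⟩ := wVol_closedBall_le (n := n) ha
  set v1 := (volume : Measure (EuclideanSpace ℝ (Fin (n + 1)))).real (Metric.ball 0 1) with hv1
  have hv1pos : 0 < v1 := by
    rw [hv1, Measure.real, ENNReal.toReal_pos_iff]
    exact ⟨Metric.measure_ball_pos _ _ one_pos, measure_ball_lt_top⟩
  refine ⟨ENNReal.ofReal (2 ^ (n + 1) / v1) * C, ENNReal.mul_ne_top ENNReal.ofReal_ne_top hC,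
    fun k p hp => ?_⟩
  have hδ := scale_pos k
  have hle : ∀ z, kern n k z ≤ 2 ^ (n + 1) / (scale k ^ (n + 1) * v1) := by
    intro z
    have h := (bump n k).normed_le_div_measure_closedBall_rOut volume 2
      (by simp only [bump]; linarith) z
    rw [finrank_euclideanSpace_fin, Measure.addHaar_real_closedBall _ _ (bump n k).rOut_pos.le,
      finrank_euclideanSpace_fin] at h
    exact h
  calc ∫⁻ x, ENNReal.ofReal (kern n k (x - p)) ∂(wVol n a)
      ≤ ∫⁻ x, ENNReal.ofReal (2 ^ (n + 1) / (scale k ^ (n + 1) * v1)) *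
        (Metric.closedBall (p - (2 * scale k) • lastVec n) (scale k)).indicator 1 x
        ∂(wVol n a) := by
        refine lintegral_mono fun x => ?_
        by_cases hx : kern n k (x - p) = 0
        · simp [hx]
        · have h1 := norm_sub_le_of_kern_ne_zero hx
          rw [indicator_of_mem (by rw [Metric.mem_closedBall, dist_eq_norm]; exact h1.le)]
          simpa using ENNReal.ofReal_le_ofReal (hle (x - p))
    _ = ENNReal.ofReal (2 ^ (n + 1) / (scale k ^ (n + 1) * v1)) *
        wVol n a (Metric.closedBall (p - (2 * scale k) • lastVec n) (scale k)) := by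
        rw [lintegral_const_mul' _ _ ENNReal.ofReal_ne_top,
          lintegral_indicator_one measurableSet_closedBall]
    _ ≤ ENNReal.ofReal (2 ^ (n + 1) / (scale k ^ (n + 1) * v1)) *
        (C * ENNReal.ofReal (scale k ^ (n + 1)) * ENNReal.ofReal (height p ^ a)) := by
        gcongr
        exact hb _ hδ p hp
    _ = (ENNReal.ofReal (2 ^ (n + 1) / (scale k ^ (n + 1) * v1)) *
        ENNReal.ofReal (scale k ^ (n + 1))) * C * ENNReal.ofReal (height p ^ a) := by ring
    _ = _ := by
        rw [← ENNReal.ofReal_mul (by positivity)]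
        congr 3
        field_simp

theorem lintegral_kern_halfVol_le (k : ℕ) (x : EuclideanSpace ℝ (Fin (n + 1))) :
    ∫⁻ p, ENNReal.ofReal (kern n k (x - p)) ∂(halfVol n) ≤ 1 := by
  calc ∫⁻ p, ENNReal.ofReal (kern n k (x - p)) ∂(halfVol n)
      ≤ ∫⁻ p, ENNReal.ofReal (kern n k (x - p)) :=
        lintegral_mono' Measure.restrict_le_self le_rfl
    _ = ∫⁻ p, ENNReal.ofReal (kern n k p) :=
        lintegral_sub_left_eq_self (fun p => ENNReal.ofReal (kern n k p)) x
    _ = 1 := by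
        have hInt : Integrable (kern n k) volume := (bump n k).integrable_normed
        rw [← ofReal_integral_eq_lintegral_ofReal hInt
          (ae_of_all _ (kern_nonneg k)), integral_kern, ENNReal.ofReal_one]

/-- A Schur-type argument: since the kernel has mass at most one in `p`, Cauchy–Schwarz bounds the
square of the mollification by the average of `|g|²`. Tonelli's theorem and `lintegral_kern_le`,
which integrates in the other variable, then return the weight at `p`. -/
theorem eLpNorm_mollify_le (ha : -1 < a) : ∃ C : ℝ≥0∞, C ≠ ∞ ∧ ∀ k,
    ∀ g : EuclideanSpace ℝ (Fin (n + 1)) → F, MemLp g 2 (wVol n a) →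
      eLpNorm (mollify k g) 2 (wVol n a) ≤ C * eLpNorm g 2 (wVol n a) := by
  obtain ⟨C, hC, hb⟩ := lintegral_kern_le (n := n) ha
  refine ⟨C ^ (1 / 2 : ℝ), ENNReal.rpow_ne_top_of_nonneg (by norm_num) hC, fun k g hg => ?_⟩
  have hgm : AEStronglyMeasurable g (halfVol n) := hg.1.mono_ac (halfVol_absolutelyContinuous a)
  have hkm : Measurable fun z : EuclideanSpace ℝ (Fin (n + 1)) × EuclideanSpace ℝ (Fin (n + 1)) =>
      ENNReal.ofReal (kern n k (z.1 - z.2)) :=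
    ((contDiff_kern k).continuous.comp (continuous_fst.sub continuous_snd)).measurable.ennreal_ofReal
  have : SFinite (halfVol n) := by unfold halfVol; infer_instance
  have : SFinite (wVol n a) := by unfold wVol; infer_instance
  have hsq : eLpNorm (mollify k g) 2 (wVol n a) ^ 2 ≤ C * eLpNorm g 2 (wVol n a) ^ 2 := by
    rw [eLpNorm_two_sq, eLpNorm_two_sq]
    calc ∫⁻ x, ‖mollify k g x‖ₑ ^ 2 ∂(wVol n a)
        ≤ ∫⁻ x, ∫⁻ p, ENNReal.ofReal (kern n k (x - p)) * ‖g p‖ₑ ^ 2 ∂(halfVol n)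
          ∂(wVol n a) := by
          refine lintegral_mono fun x => ?_
          have h1 : ‖mollify k g x‖ₑ ≤ ∫⁻ p, ENNReal.ofReal (kern n k (x - p)) * ‖g p‖ₑ
              ∂(halfVol n) := by
            refine (enorm_integral_le_lintegral_enorm _).trans (le_of_eq ?_)
            refine lintegral_congr fun p => ?_
            rw [enorm_smul, Real.enorm_eq_ofReal (kern_nonneg k _)]
          calc ‖mollify k g x‖ₑ ^ 2
              ≤ (∫⁻ p, ENNReal.ofReal (kern n k (x - p)) * ‖g p‖ₑ ∂(halfVol n)) ^ 2 := by gcongr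
            _ ≤ (∫⁻ p, ENNReal.ofReal (kern n k (x - p)) ∂(halfVol n)) *
                ∫⁻ p, ENNReal.ofReal (kern n k (x - p)) * ‖g p‖ₑ ^ 2 ∂(halfVol n) :=
                lintegral_weight_mul_sq_le (hkm.comp measurable_prodMk_left).aemeasurable
                  hgm.enorm
            _ ≤ 1 * _ := by gcongr; exact lintegral_kern_halfVol_le k x
            _ = _ := one_mul _
      _ = ∫⁻ p, ∫⁻ x, ENNReal.ofReal (kern n k (x - p)) * ‖g p‖ₑ ^ 2 ∂(wVol n a)
          ∂(halfVol n) := by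
          refine lintegral_lintegral_swap ?_
          exact hkm.aemeasurable.mul ((hgm.enorm.comp_snd).pow_const 2)
      _ ≤ ∫⁻ p, C * (ENNReal.ofReal (height p ^ a) * ‖g p‖ₑ ^ 2) ∂(halfVol n) := by
          refine lintegral_mono_ae ?_
          filter_upwards [ae_halfVol_pos] with p hp
          rw [lintegral_mul_const' _ _ (by simp), ← mul_assoc]
          gcongr
          exact hb k p hp
      _ = C * ∫⁻ x, ‖g x‖ₑ ^ 2 ∂(wVol n a) := by
          rw [lintegral_const_mul' _ _ hC, lintegral_wVol]
  have h2 := ENNReal.rpow_le_rpow hsq (z := 1 / 2) (by norm_num)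
  have e : ∀ z : ℝ≥0∞, (z ^ 2) ^ (1 / 2 : ℝ) = z := fun z => by
    rw [← ENNReal.rpow_natCast, ← ENNReal.rpow_mul]; norm_num
  rwa [ENNReal.mul_rpow_of_nonneg _ _ (by norm_num), e, e] at h2

theorem tendsto_mollify_of_continuous [CompleteSpace F] (ha : -1 < a)
    {g : EuclideanSpace ℝ (Fin (n + 1)) → F} (hg : Continuous g) (hgs : HasCompactSupport g) :
    Tendsto (fun k => eLpNorm (mollify k g - g) 2 (wVol n a)) atTop (𝓝 0) := by
  have hfin := isFiniteMeasureOnCompacts_wVol (n := n) ha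
  obtain ⟨R, hR⟩ := hgs.isCompact.isBounded.subset_closedBall 0
  have hz : ∀ x, R < ‖x‖ → g x = 0 := fun x hx => by
    refine image_eq_zero_of_notMem_tsupport fun h => ?_
    have := hR h
    rw [mem_closedBall_zero_iff] at this
    linarith
  have hscale : ∀ k, scale k ≤ 1 := fun k => by
    unfold scale
    rw [div_le_one (by positivity)]
    linarith [Nat.cast_nonneg (α := ℝ) k]
  refine tendsto_eLpNorm_of_uniform (K := Metric.closedBall 0 (R + 3)) measurableSet_closedBall
    (isCompact_closedBall _ _).measure_lt_top.ne ?_ ?_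
  · refine Eventually.of_forall fun k => ae_of_all _ fun x hx => ?_
    rw [mem_closedBall_zero_iff, not_le] at hx
    have h1 : mollify k g x = 0 := by
      rw [mollify]
      refine integral_eq_zero_of_ae (ae_of_all _ fun p => ?_)
      by_cases hp : kern n k (x - p) = 0
      · simp [hp]
      · have h1 := norm_sub_lt_of_kern_ne_zero hp
        have h2 := norm_sub_norm_le x p
        have h3 := hscale k
        simp [hz p (by linarith)]
    rw [Pi.sub_apply, h1, hz x (by linarith), sub_zero]
  · intro ε hε
    obtain ⟨δ, hδ, hδ'⟩ := Metric.uniformContinuous_iff.1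
      (hgs.uniformContinuous_of_continuous hg) ε hε
    have h5 : ∀ᶠ k in atTop, 3 * scale k < δ := by
      have := tendsto_scale.const_mul 3
      rw [mul_zero] at this
      exact this.eventually (gt_mem_nhds hδ)
    filter_upwards [h5] with k hk
    filter_upwards [ae_wVol_pos a] with x hx
    have hInt : Integrable (fun p => kern n k (x - p)) volume :=
      (bump n k).integrable_normed.comp_sub_left x
    -- Above the boundary the kernel charges only the half-space, so restricting the integral loses
    -- no mass and the kernel still integrates to one.
    have h1 : mollify k g x = ∫ p, kern n k (x - p) • g p := by
      rw [mollify, halfVol, ← integral_indicator measurableSet_halfSpace]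
      refine integral_congr_ae (ae_of_all _ fun p => ?_)
      by_cases hp : kern n k (x - p) = 0
      · simp [indicator, hp]
      · have := height_of_kern_ne_zero hp
        have hp' : p ∈ halfSpace n := by
          simp only [halfSpace, mem_ofPred_eq]; linarith [scale_pos k]
        simp [hp']
    have h2 : g x = ∫ p, kern n k (x - p) • g x := by
      rw [integral_smul_const, integral_sub_left_eq_self (fun p => kern n k p), integral_kern,
        one_smul]
    have hInt2 : Integrable (fun p => kern n k (x - p) • g p) volume := by
      obtain ⟨M, hM⟩ := hgs.exists_bound_of_continuous hg
      exact hInt.smul_bdd M hg.aestronglyMeasurable (ae_of_all _ hM)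
    rw [Pi.sub_apply, h1]
    nth_rewrite 1 [h2]
    rw [← integral_sub hInt2 (hInt.smul_const _)]
    calc ‖∫ p, (kern n k (x - p) • g p - kern n k (x - p) • g x)‖
        ≤ ∫ p, kern n k (x - p) * ε := by
          refine norm_integral_le_of_norm_le (hInt.mul_const ε) (ae_of_all _ fun p => ?_)
          rw [← smul_sub, norm_smul, Real.norm_eq_abs, abs_of_nonneg (kern_nonneg k _)]
          by_cases hp : kern n k (x - p) = 0
          · simp [hp]
          · refine mul_le_mul_of_nonneg_left ?_ (kern_nonneg k _)
            rw [← dist_eq_norm]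
            refine (hδ' ?_).le
            rw [dist_comm, dist_eq_norm]
            exact (norm_sub_lt_of_kern_ne_zero hp).trans hk
      _ = ε := by
          rw [integral_mul_const, integral_sub_left_eq_self (fun p => kern n k p), integral_kern,
            one_mul]

theorem tendstoL2_mollify [CompleteSpace F] (ha : -1 < a) (ha' : a < 1)
    {g : EuclideanSpace ℝ (Fin (n + 1)) → F} (hg : MemLp g 2 (wVol n a)) :
    TendstoL2 (wVol n a) (fun k => mollify k g) atTop g := by
  have hfin := isFiniteMeasureOnCompacts_wVol (n := n) ha
  obtain ⟨C, hC, hb⟩ := eLpNorm_mollify_le (n := n) (F := F) ha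
  have hmem : ∀ k, ∀ g : EuclideanSpace ℝ (Fin (n + 1)) → F, MemLp g 2 (wVol n a) →
      MemLp (mollify k g) 2 (wVol n a) := fun k g hg =>
    ⟨(contDiff_mollify ha' k hg).continuous.aestronglyMeasurable,
      (hb k g hg).trans_lt (ENNReal.mul_lt_top hC.lt_top hg.2)⟩
  refine tendsto_eLpNorm_of_dense (L := fun k => mollify k) (C := C)
    (S := {g | Continuous g ∧ HasCompactSupport g}) hC ?_ hmem ?_ ?_ hg ?_
  · rintro g ⟨h1, h2⟩
    exact h1.memLp_of_hasCompactSupport h2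
  · refine Eventually.of_forall fun k f g hf hg => ?_
    rw [mollify_sub ha' k hf hg]
    exact hb k _ (hf.sub hg)
  · rintro g ⟨h1, h2⟩
    exact tendsto_mollify_of_continuous ha h1 h2
  · intro ε hε
    obtain ⟨g', h1, h2, h3, -⟩ := hg.exists_hasCompactSupport_eLpNorm_sub_le (by norm_num) hε
    exact ⟨g', ⟨h3, h1⟩, h2⟩

theorem isTestFunction_kern (k : ℕ) (x : EuclideanSpace ℝ (Fin (n + 1))) :
    IsTestFunction fun p => kern n k (x - p) where
  smooth := (contDiff_kern k).comp (contDiff_const.sub contDiff_id)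
  compact := (hasCompactSupport_kern k).comp_homeomorph (Homeomorph.subLeft x)

/-- For `x` in the closed half-space, `p ↦ kern n k (x - p)` is supported at heights at least `scale
k`, so it is admissible in the definition of the weak gradient. The derivative thus passes from the
kernel to `u` even at boundary points. -/
theorem gradient_mollify (ha : a < 1) (k : ℕ) {u : EuclideanSpace ℝ (Fin (n + 1)) → ℝ}
    {G : EuclideanSpace ℝ (Fin (n + 1)) → EuclideanSpace ℝ (Fin (n + 1))}
    (hu : MemLp u 2 (wVol n a)) (hG : MemLp G 2 (wVol n a)) (hw : HasWeakGradient u G)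
    {x : EuclideanSpace ℝ (Fin (n + 1))} (hx : 0 ≤ height x) :
    gradient (mollify k u) x = mollify k G x := by
  have hd := (hasCompactSupport_kern (n := n) k).hasFDerivAt_convolution_right
    (ContinuousLinearMap.lsmul ℝ ℝ).flip (locallyIntegrable_indicator ha hu)
    ((contDiff_kern k).of_le (by exact_mod_cast le_top)) x
  rw [← mollify_eq_convolution] at hd
  refine ext_inner_right ℝ fun e => ?_
  rw [gradient, InnerProductSpace.toDual_symm_apply, hd.fderiv]
  rw [convolution_precompR_apply _ (locallyIntegrable_indicator ha hu)
    ((hasCompactSupport_kern k).fderiv ℝ)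
    ((contDiff_kern k).continuous_fderiv (by simp))]
  have hts : tsupport (fun p => kern n k (x - p)) ⊆ halfSpace n := by
    have hcl : tsupport (fun p => kern n k (x - p)) ⊆ {p | height x + scale k ≤ height p} := by
      refine closure_minimal (fun p hp => ?_) (isClosed_le continuous_const continuous_height)
      exact (height_of_kern_ne_zero hp).le
    intro p hp
    have := hcl hp
    simp only [mem_ofPred_eq, halfSpace] at this ⊢
    linarith [scale_pos k]
  have h1 := hw _ (isTestFunction_kern k x) hts e
  have h2 : ∀ p, fderiv ℝ (fun p => kern n k (x - p)) p e = - fderiv ℝ (kern n k) (x - p) e := by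
    intro p
    have h3 : HasFDerivAt (fun p => x - p)
        (-ContinuousLinearMap.id ℝ (EuclideanSpace ℝ (Fin (n + 1)))) p :=
      (hasFDerivAt_id p).const_sub x
    have h4 : HasFDerivAt (kern n k) (fderiv ℝ (kern n k) (x - p)) (x - p) :=
      ((contDiff_kern k).differentiable (by simp) _).hasFDerivAt
    have h5 := h4.comp p h3
    rw [Function.comp_def] at h5
    rw [h5.fderiv]
    simp
  simp only [h2, mul_neg, integral_neg, neg_inj] at h1
  have h6 : convolution ((halfSpace n).indicator u) (fun z => fderiv ℝ (kern n k) z e)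
      (ContinuousLinearMap.lsmul ℝ ℝ).flip volume x
      = ∫ p, u p * fderiv ℝ (kern n k) (x - p) e ∂(halfVol n) := by
    rw [convolution, halfVol, ← integral_indicator measurableSet_halfSpace]
    refine integral_congr_ae (ae_of_all _ fun p => ?_)
    by_cases hp : p ∈ halfSpace n <;> simp [hp, mul_comm]
  rw [h6, h1, mollify, real_inner_comm, ← integral_inner (integrable_kern_smul ha k hG x)]
  refine integral_congr_ae (ae_of_all _ fun p => ?_)
  simp only [real_inner_smul_right, real_inner_comm, mul_comm]

theorem mollify_eq_zero {k : ℕ} {u : EuclideanSpace ℝ (Fin (n + 1)) → ℝ}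
    (hu : ∀ᵐ x ∂(halfVol n), ‖x‖ ≤ 1 → u x = 0) {x : EuclideanSpace ℝ (Fin (n + 1))}
    (hx : ‖x‖ + 3 * scale k ≤ 1) : mollify k u x = 0 := by
  rw [mollify]
  refine integral_eq_zero_of_ae ?_
  filter_upwards [hu] with p hp
  by_cases h : kern n k (x - p) = 0
  · simp [h]
  · have h1 := norm_sub_lt_of_kern_ne_zero h
    have h2 := norm_sub_norm_le p x
    rw [norm_sub_rev] at h2
    simp [hp (by linarith)]

end Mollifier

/-! ### The weighted trace inequality, convergence of traces, and vanishing in the ball -/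

section Trace

variable {n : ℕ} {a : ℝ}

theorem hasDerivAt_comp_join {ψ : EuclideanSpace ℝ (Fin (n + 1)) → ℝ} (hψ : ContDiff ℝ 1 ψ)
    (x' : EuclideanSpace ℝ (Fin n)) (y : ℝ) :
    HasDerivAt (fun y => ψ (join (x', y))) (fderiv ℝ ψ (join (x', y)) (lastVec n)) y := by
  have h1 : HasDerivAt (fun y : ℝ => join (x', y)) (lastVec n) y := by
    have := ((hasDerivAt_id y).smul_const (lastVec n)).const_add (bdry x')
    simpa [join] using this
  exact ((hψ.differentiable (by simp) _).hasFDerivAt).comp_hasDerivAt y h1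

theorem join_zero (x' : EuclideanSpace ℝ (Fin n)) : join (x', 0) = bdry x' := by simp [join]

theorem enorm_fderiv_lastVec_le (ψ : EuclideanSpace ℝ (Fin (n + 1)) → ℝ)
    (x : EuclideanSpace ℝ (Fin (n + 1))) :
    ‖fderiv ℝ ψ x (lastVec n)‖ₑ ≤ ‖gradient ψ x‖ₑ := by
  rw [enorm_le_iff_norm_le]
  have h : fderiv ℝ ψ x (lastVec n) = inner ℝ (gradient ψ x) (lastVec n) := by
    rw [gradient, InnerProductSpace.toDual_symm_apply]
  rw [h]
  simpa [norm_lastVec] using abs_real_inner_le_norm (gradient ψ x) (lastVec n)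

/-- The fundamental theorem of calculus for `(1 - y) ψ(x', y)` on `[0, 1]`; the factor removes the
endpoint `y = 1`. -/
theorem enorm_bdry_le {ψ : EuclideanSpace ℝ (Fin (n + 1)) → ℝ} (hψ : ContDiff ℝ 1 ψ)
    (x' : EuclideanSpace ℝ (Fin n)) :
    ‖ψ (bdry x')‖ₑ ≤ ∫⁻ y in Ioo (0 : ℝ) 1,
      (‖ψ (join (x', y))‖ₑ + ‖gradient ψ (join (x', y))‖ₑ) := by
  have hc : Continuous fun y : ℝ => fderiv ℝ ψ (join (x', y)) (lastVec n) :=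
    ((hψ.continuous_fderiv (by simp)).comp
      (continuous_join.comp (continuous_const.prodMk continuous_id))).clm_apply continuous_const
  have hc2 : Continuous fun y : ℝ => ψ (join (x', y)) :=
    hψ.continuous.comp (continuous_join.comp (continuous_const.prodMk continuous_id))
  have hd : ∀ y ∈ uIcc (0 : ℝ) 1, HasDerivAt (fun y => (1 - y) * ψ (join (x', y)))
      (-1 * ψ (join (x', y)) + (1 - y) * fderiv ℝ ψ (join (x', y)) (lastVec n)) y := by
    intro y _
    exact ((hasDerivAt_id y).const_sub 1).mul (hasDerivAt_comp_join hψ x' y)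
  have h := intervalIntegral.integral_eq_sub_of_hasDerivAt hd
    (Continuous.intervalIntegrable
      ((continuous_const.mul hc2).add ((continuous_const.sub continuous_id).mul hc)) _ _)
  simp only [sub_self, zero_mul, sub_zero, one_mul, zero_sub, join_zero] at h
  have h2 : ‖ψ (bdry x')‖ₑ = ‖∫ y in Ioo (0 : ℝ) 1,
      (-1 * ψ (join (x', y)) + (1 - y) * fderiv ℝ ψ (join (x', y)) (lastVec n))‖ₑ := by
    rw [← integral_Ioc_eq_integral_Ioo, ← intervalIntegral.integral_of_le zero_le_one, h,
      enorm_neg]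
  rw [h2]
  refine (enorm_integral_le_lintegral_enorm _).trans ?_
  refine lintegral_mono_ae ?_
  filter_upwards [ae_restrict_mem measurableSet_Ioo] with y hy
  refine (enorm_add_le _ _).trans ?_
  refine add_le_add (by simp) ?_
  rw [enorm_mul]
  calc ‖1 - y‖ₑ * ‖fderiv ℝ ψ (join (x', y)) (lastVec n)‖ₑ
      ≤ 1 * ‖gradient ψ (join (x', y))‖ₑ := by
        gcongr
        · rw [Real.enorm_eq_ofReal (by linarith [hy.2])]
          exact ENNReal.ofReal_le_one.2 (by linarith [hy.1])
        · exact enorm_fderiv_lastVec_le ψ _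
    _ = _ := one_mul _

theorem measurable_gradient {ψ : EuclideanSpace ℝ (Fin (n + 1)) → ℝ} (hψ : ContDiff ℝ 1 ψ) :
    Continuous (gradient ψ) :=
  (InnerProductSpace.toDual ℝ _).symm.continuous.comp (hψ.continuous_fderiv (by simp))

/-- Insert `y^{-a/2} y^{a/2}` in the one-dimensional bound and apply Cauchy–Schwarz. The constant is
the integral of `y^{-a}` over `(0, 1)`, finite because `a < 1`. -/
theorem lintegral_bdry_le (ha : a < 1) : ∃ C : ℝ≥0∞, C ≠ ∞ ∧
    ∀ ψ : EuclideanSpace ℝ (Fin (n + 1)) → ℝ, ContDiff ℝ 1 ψ →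
      ∫⁻ x', ‖ψ (bdry x')‖ₑ ^ 2 ≤ C * ∫⁻ x, (‖ψ x‖ₑ + ‖gradient ψ x‖ₑ) ^ 2 ∂(wVol n a) := by
  refine ⟨∫⁻ y in Ioo (0 : ℝ) 1, ENNReal.ofReal (y ^ (-a)),
    (lintegral_rpow_Ioo_lt_top (by linarith) 1).ne, fun ψ hψ => ?_⟩
  set I := ∫⁻ y in Ioo (0 : ℝ) 1, ENNReal.ofReal (y ^ (-a)) with hI
  have hHm : Measurable fun x => ‖ψ x‖ₑ + ‖gradient ψ x‖ₑ :=
    hψ.continuous.measurable.enorm.add (measurable_gradient hψ).measurable.enorm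
  have hjm : ∀ x' : EuclideanSpace ℝ (Fin n), Measurable fun y : ℝ => join (x', y) := fun x' =>
    (continuous_join.comp (continuous_const.prodMk continuous_id)).measurable
  have hwm : Measurable fun x : EuclideanSpace ℝ (Fin (n + 1)) =>
      ENNReal.ofReal (height x ^ a) * (‖ψ x‖ₑ + ‖gradient ψ x‖ₑ) ^ 2 :=
    (measurable_weight a).mul (hHm.pow_const 2)
  rw [lintegral_wVol, lintegral_halfVol hwm, ← lintegral_const_mul']
  swap
  · exact (lintegral_rpow_Ioo_lt_top (by linarith) 1).ne
  refine lintegral_mono fun x' => ?_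
  have e : ∀ (y b : ℝ), 0 < y → ENNReal.ofReal (y ^ (b / 2)) ^ 2 = ENNReal.ofReal (y ^ b) := by
    intro y b hy
    rw [← ENNReal.ofReal_pow (Real.rpow_nonneg hy.le _), ← Real.rpow_natCast,
      ← Real.rpow_mul hy.le]
    norm_num
  have h1 : ‖ψ (bdry x')‖ₑ ≤ ∫⁻ y in Ioo (0 : ℝ) 1, ENNReal.ofReal (y ^ (-a / 2)) *
      (ENNReal.ofReal (y ^ (a / 2)) *
        (‖ψ (join (x', y))‖ₑ + ‖gradient ψ (join (x', y))‖ₑ)) := by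
    refine (enorm_bdry_le hψ x').trans (le_of_eq ?_)
    refine setLIntegral_congr_fun measurableSet_Ioo fun y hy => ?_
    rw [← mul_assoc, ← ENNReal.ofReal_mul (Real.rpow_nonneg hy.1.le _), ← Real.rpow_add hy.1]
    simp [neg_div]
  calc ‖ψ (bdry x')‖ₑ ^ 2
      ≤ (∫⁻ y in Ioo (0 : ℝ) 1, ENNReal.ofReal (y ^ (-a / 2)) *
      (ENNReal.ofReal (y ^ (a / 2)) *
        (‖ψ (join (x', y))‖ₑ + ‖gradient ψ (join (x', y))‖ₑ))) ^ 2 := by gcongr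
    _ ≤ (∫⁻ y in Ioo (0 : ℝ) 1, ENNReal.ofReal (y ^ (-a / 2)) ^ 2) *
        ∫⁻ y in Ioo (0 : ℝ) 1, (ENNReal.ofReal (y ^ (a / 2)) *
        (‖ψ (join (x', y))‖ₑ + ‖gradient ψ (join (x', y))‖ₑ)) ^ 2 := by
        refine lintegral_mul_sq_le (measurable_id.pow_const _).ennreal_ofReal.aemeasurable ?_
        exact ((measurable_id.pow_const _).ennreal_ofReal.mul (hHm.comp (hjm x'))).aemeasurable
    _ = I * ∫⁻ y in Ioo (0 : ℝ) 1, ENNReal.ofReal (height (join (x', y)) ^ a) *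
        (‖ψ (join (x', y))‖ₑ + ‖gradient ψ (join (x', y))‖ₑ) ^ 2 := by
        congr 1
        · exact setLIntegral_congr_fun measurableSet_Ioo fun y hy => e y _ hy.1
        · refine setLIntegral_congr_fun measurableSet_Ioo fun y hy => ?_
          simp only [mul_pow, height_join]
          rw [e y _ hy.1]
    _ ≤ _ := by
        gcongr
        exact Ioo_subset_Ioi_self

theorem eLpNorm_bdry_le (ha : a < 1) : ∃ C : ℝ≥0∞, C ≠ ∞ ∧
    ∀ ψ : EuclideanSpace ℝ (Fin (n + 1)) → ℝ, ContDiff ℝ 1 ψ →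
      eLpNorm (fun x' => ψ (bdry x')) 2 volume
        ≤ C * (eLpNorm ψ 2 (wVol n a) + eLpNorm (gradient ψ) 2 (wVol n a)) := by
  obtain ⟨C, hC, hb⟩ := lintegral_bdry_le (n := n) ha
  refine ⟨C ^ (1 / 2 : ℝ), ENNReal.rpow_ne_top_of_nonneg (by norm_num) hC, fun ψ hψ => ?_⟩
  have h := hb ψ hψ
  set H : EuclideanSpace ℝ (Fin (n + 1)) → ℝ := fun x => ‖ψ x‖ + ‖gradient ψ x‖ with hH
  have hHe : ∀ x, ‖ψ x‖ₑ + ‖gradient ψ x‖ₑ = ‖H x‖ₑ := by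
    intro x
    have h0 : 0 ≤ H x := by positivity
    rw [Real.enorm_eq_ofReal h0, hH]
    simp only
    rw [ENNReal.ofReal_add (norm_nonneg _) (norm_nonneg _), ofReal_norm, ofReal_norm]
  simp only [hHe] at h
  rw [← eLpNorm_two_sq, ← eLpNorm_two_sq] at h
  have h2 := ENNReal.rpow_le_rpow h (z := 1 / 2) (by norm_num)
  have e : ∀ z : ℝ≥0∞, (z ^ 2) ^ (1 / 2 : ℝ) = z := fun z => by
    rw [← ENNReal.rpow_natCast, ← ENNReal.rpow_mul]; norm_num
  rw [ENNReal.mul_rpow_of_nonneg _ _ (by norm_num), e, e] at h2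
  refine h2.trans ?_
  gcongr
  rw [← eLpNorm_norm ψ, ← eLpNorm_norm (gradient ψ)]
  exact eLpNorm_add_le hψ.continuous.norm.aestronglyMeasurable
    (measurable_gradient hψ).norm.aestronglyMeasurable (by norm_num)

theorem integral_fderiv_lastVec {w : EuclideanSpace ℝ (Fin (n + 1)) → ℝ} (hw : ContDiff ℝ 1 w)
    (hs : HasCompactSupport w) :
    ∫ x, fderiv ℝ w x (lastVec n) ∂(halfVol n) = - ∫ x', w (bdry x') := by
  have hc : Continuous fun x => fderiv ℝ w x (lastVec n) :=
    (hw.continuous_fderiv (by simp)).clm_apply continuous_const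
  have hcs : HasCompactSupport fun x => fderiv ℝ w x (lastVec n) :=
    hs.fderiv_apply ℝ (lastVec n)
  have hInt : Integrable (fun x => fderiv ℝ w x (lastVec n)) (halfVol n) :=
    (hc.integrable_of_hasCompactSupport hcs).restrict
  rw [← measurePreserving_join_halfVol.integral_comp measurableEmbedding_join,
    integral_prod]
  swap
  · exact (measurePreserving_join_halfVol.integrable_comp_emb measurableEmbedding_join).2 hInt
  rw [← integral_neg]
  refine integral_congr_ae (ae_of_all _ fun x' => ?_)
  have hcd : ContDiff ℝ 1 fun y : ℝ => join (x', y) := by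
    change ContDiff ℝ 1 fun y : ℝ => bdry x' + y • lastVec n
    fun_prop
  have hcomp : HasCompactSupport fun y : ℝ => w (join (x', y)) := by
    obtain ⟨R, hR⟩ := hs.isCompact.isBounded.subset_closedBall 0
    refine HasCompactSupport.intro (isCompact_closedBall (0 : ℝ) R) fun y hy => ?_
    refine image_eq_zero_of_notMem_tsupport fun h => hy ?_
    have h1 := hR h
    rw [mem_closedBall_zero_iff] at h1 ⊢
    have := abs_height_le (join (x', y))
    rw [height_join] at this
    exact this.trans h1
  have h := HasCompactSupport.integral_Ioi_deriv_eq (hw.comp hcd) hcomp 0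
  simp only [Function.comp_apply, join_zero] at h
  simp only [← h]
  refine integral_congr_ae (ae_of_all _ fun y => ?_)
  exact ((hasDerivAt_comp_join hw x' y).deriv).symm

/-- Boundary values of test functions exhaust the test functions on `ℝ^n`, so Green's formula
determines the trace almost everywhere. -/
theorem exists_isTestFunction_bdry {g : EuclideanSpace ℝ (Fin n) → ℝ}
    (hg : ContDiff ℝ (⊤ : ℕ∞) g) (hs : HasCompactSupport g) :
    ∃ ψ : EuclideanSpace ℝ (Fin (n + 1)) → ℝ, IsTestFunction ψ ∧ ∀ x', ψ (bdry x') = g x' := by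
  let χ : ContDiffBump (0 : ℝ) := ⟨1, 2, one_pos, one_lt_two⟩
  refine ⟨fun x => g (horizontal x) * χ (height x), ⟨?_, ?_⟩, fun x' => ?_⟩
  · exact (hg.comp contDiff_horizontal).mul (χ.contDiff.comp contDiff_height)
  · obtain ⟨R, hR⟩ := hs.isCompact.isBounded.subset_closedBall 0
    refine HasCompactSupport.intro (isCompact_closedBall 0 (R + 2)) fun x hx => ?_
    by_contra h
    apply hx
    have h1 : horizontal x ∈ tsupport g :=
      subset_tsupport _ (left_ne_zero_of_mul h)
    have h2 : height x ∈ Function.support χ := right_ne_zero_of_mul h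
    rw [χ.support_eq, mem_ball_zero_iff, Real.norm_eq_abs] at h2
    have h3 := hR h1
    rw [mem_closedBall_zero_iff] at h3 ⊢
    rw [← bdry_horizontal_add x]
    refine (norm_add_le _ _).trans ?_
    rw [norm_bdry, norm_smul, norm_lastVec, mul_one, Real.norm_eq_abs]
    exact add_le_add h3 h2.le
  · simp only [horizontal_bdry, height_bdry]
    rw [χ.one_of_mem_closedBall (by simp [χ]), mul_one]

theorem isTestFunction_bounds {ψ : EuclideanSpace ℝ (Fin (n + 1)) → ℝ} (hψ : Continuous ψ)
    (hs : HasCompactSupport ψ) : ∃ K R : ℝ, (∀ x, |ψ x| ≤ K) ∧ ∀ x, R < ‖x‖ → ψ x = 0 := by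
  obtain ⟨K, hK⟩ := hs.exists_bound_of_continuous hψ
  obtain ⟨R, hR⟩ := hs.isCompact.isBounded.subset_closedBall 0
  refine ⟨K, R, hK, fun x hx => image_eq_zero_of_notMem_tsupport fun h => ?_⟩
  have := hR h
  rw [mem_closedBall_zero_iff] at this
  linarith

theorem tendsto_integral_halfVol (ha : a < 1) {ψ : EuclideanSpace ℝ (Fin (n + 1)) → ℝ}
    (hψ : Continuous ψ) (hs : HasCompactSupport ψ) {f : ℕ → EuclideanSpace ℝ (Fin (n + 1)) → ℝ}
    {g : EuclideanSpace ℝ (Fin (n + 1)) → ℝ} (h : TendstoL2 (wVol n a) f atTop g) :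
    Tendsto (fun k => ∫ x, f k x * ψ x ∂(halfVol n)) atTop (𝓝 (∫ x, g x * ψ x ∂(halfVol n))) := by
  obtain ⟨K, R, hK, hR⟩ := isTestFunction_bounds hψ hs
  have e : ∀ q : EuclideanSpace ℝ (Fin (n + 1)) → ℝ, ∫ x, q x * ψ x ∂(halfVol n)
      = ∫ x, (ψ x * height x ^ (-a)) * q x ∂(wVol n a) := by
    intro q
    rw [← integral_congr_ae (ae_of_all _ fun x => mul_comm (ψ x) (q x))]
    exact integral_halfVol_smul ψ q
  simp only [e]
  exact (tendstoL2_const (memLp_mul_weight_neg ha hψ.aestronglyMeasurable hK hR)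
    atTop).tendsto_integral_mul h

theorem fderiv_eq_inner_gradient (ψ : EuclideanSpace ℝ (Fin (n + 1)) → ℝ)
    (x v : EuclideanSpace ℝ (Fin (n + 1))) : fderiv ℝ ψ x v = inner ℝ (gradient ψ x) v := by
  rw [gradient, InnerProductSpace.toDual_symm_apply]

theorem integral_bdry_mollify (ha : a < 1) {u : EuclideanSpace ℝ (Fin (n + 1)) → ℝ}
    {G : EuclideanSpace ℝ (Fin (n + 1)) → EuclideanSpace ℝ (Fin (n + 1))}
    (hu : MemLp u 2 (wVol n a)) (hG : MemLp G 2 (wVol n a)) (hw : HasWeakGradient u G) (k : ℕ)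
    {ψ : EuclideanSpace ℝ (Fin (n + 1)) → ℝ} (hψ : IsTestFunction ψ) :
    ∫ x', mollify k u (bdry x') * ψ (bdry x')
      = - ∫ x, mollify k u x * fderiv ℝ ψ x (lastVec n) ∂(halfVol n)
        - ∫ x, height (mollify k G x) * ψ x ∂(halfVol n) := by
  have hU := contDiff_mollify ha k hu
  have hU1 : ContDiff ℝ 1 (mollify k u) := hU.of_le (by exact_mod_cast le_top)
  have hψ1 : ContDiff ℝ 1 ψ := hψ.smooth.of_le (by exact_mod_cast le_top)
  have h := integral_fderiv_lastVec (hU1.mul hψ1) (hψ.compact.mul_left (f := mollify k u))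
  have hGc := (contDiff_mollify ha k hG).continuous
  have i1 : Integrable (fun x => mollify k u x * fderiv ℝ ψ x (lastVec n)) (halfVol n) := by
    refine Integrable.restrict (Continuous.integrable_of_hasCompactSupport ?_ ?_)
    · exact hU.continuous.mul ((hψ1.continuous_fderiv (by simp)).clm_apply continuous_const)
    · exact (hψ.compact.fderiv_apply ℝ (lastVec n)).mul_left
  have i2 : Integrable (fun x => height (mollify k G x) * ψ x) (halfVol n) := by
    refine Integrable.restrict (Continuous.integrable_of_hasCompactSupport ?_ ?_)
    · exact (continuous_height.comp hGc).mul hψ.smooth.continuous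
    · exact hψ.compact.mul_left
  have h2 : ∫ x, fderiv ℝ (mollify k u * ψ) x (lastVec n) ∂(halfVol n)
      = ∫ x, mollify k u x * fderiv ℝ ψ x (lastVec n) ∂(halfVol n)
        + ∫ x, height (mollify k G x) * ψ x ∂(halfVol n) := by
    rw [← integral_add i1 i2]
    refine integral_congr_ae ?_
    filter_upwards [ae_halfVol_pos] with x hx
    rw [fderiv_mul (hU1.differentiable (by simp) x) (hψ1.differentiable (by simp) x)]
    simp only [_root_.add_apply, _root_.smul_apply, smul_eq_mul]
    rw [fderiv_eq_inner_gradient (mollify k u), gradient_mollify ha k hu hG hw hx.le,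
      inner_lastVec]
    ring
  have h' : ∫ x, fderiv ℝ (mollify k u * ψ) x (lastVec n) ∂(halfVol n)
      = - ∫ x', mollify k u (bdry x') * ψ (bdry x') := h
  rw [h2] at h'
  linarith

/-- The trace inequality applied to differences of mollifications shows that their boundary values
form a Cauchy sequence in `L²(ℝ^n)`. Green's formula passes to the limit and identifies what they
converge to. In particular the trace, assumed only locally integrable, is square integrable. -/
theorem tendstoL2_bdry_mollify (ha : -1 < a) (ha' : a < 1)
    {u : EuclideanSpace ℝ (Fin (n + 1)) → ℝ}
    {G : EuclideanSpace ℝ (Fin (n + 1)) → EuclideanSpace ℝ (Fin (n + 1))}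
    {u₀ : EuclideanSpace ℝ (Fin n) → ℝ}
    (hu : MemLp u 2 (wVol n a)) (hG : MemLp G 2 (wVol n a)) (hw : HasWeakGradient u G)
    (ht : IsTrace u G u₀) :
    TendstoL2 volume (fun k x' => mollify k u (bdry x')) atTop u₀ := by
  obtain ⟨C, hC, hb⟩ := eLpNorm_bdry_le (n := n) ha'
  have hTu := tendstoL2_mollify ha ha' hu
  have hTG := tendstoL2_mollify ha ha' hG
  have hU1 : ∀ k, ContDiff ℝ 1 (mollify k u) := fun k =>
    (contDiff_mollify ha' k hu).of_le (by exact_mod_cast le_top)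
  have hgrad : ∀ k, gradient (mollify k u) =ᵐ[wVol n a] mollify k G := fun k => by
    filter_upwards [ae_wVol_pos a] with x hx
    exact gradient_mollify ha' k hu hG hw hx.le
  have hmem : ∀ k, MemLp (fun x' => mollify k u (bdry x')) 2 volume := fun k => by
    refine ⟨((hU1 k).continuous.comp continuous_bdry).aestronglyMeasurable, ?_⟩
    refine (hb _ (hU1 k)).trans_lt (ENNReal.mul_lt_top hC.lt_top (ENNReal.add_lt_top.2
      ⟨(hTu.memLp k).2, ?_⟩))
    rw [eLpNorm_congr_ae (hgrad k)]
    exact (hTG.memLp k).2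
  set b : ℕ → ℝ≥0∞ := fun k =>
    C * (eLpNorm (mollify k u - u) 2 (wVol n a) + eLpNorm (mollify k G - G) 2 (wVol n a)) with hbdef
  have hb0 : Tendsto b atTop (𝓝 0) := by
    have := ENNReal.Tendsto.const_mul (a := C) (hTu.tendsto.add hTG.tendsto) (Or.inr hC)
    simpa using this
  have hdist : ∀ k l, eLpNorm ((fun x' => mollify k u (bdry x')) - fun x' => mollify l u (bdry x'))
      2 volume ≤ b k + b l := by
    intro k l
    have h1 := hb _ ((hU1 k).sub (hU1 l))
    have h2 : gradient (fun x => mollify k u x - mollify l u x)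
        =ᵐ[wVol n a] mollify k G - mollify l G := by
      filter_upwards [hgrad k, hgrad l] with x hk hl
      rw [Pi.sub_apply, ← hk, ← hl, gradient, gradient, gradient,
        fderiv_fun_sub ((hU1 k).differentiable (by simp) x) ((hU1 l).differentiable (by simp) x),
        map_sub]
    rw [eLpNorm_congr_ae h2] at h1
    refine h1.trans ?_
    have tri : ∀ {H : Type} [NormedAddCommGroup H] {p q r : EuclideanSpace ℝ (Fin (n + 1)) → H},
        MemLp p 2 (wVol n a) → MemLp q 2 (wVol n a) → MemLp r 2 (wVol n a) →
        eLpNorm (p - q) 2 (wVol n a) ≤ eLpNorm (p - r) 2 (wVol n a) + eLpNorm (q - r) 2 (wVol n a) := by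
      intro H _ p q r hp hq hr
      have : p - q = (p - r) - (q - r) := by abel
      rw [this]
      exact eLpNorm_sub_le (hp.sub hr).1 (hq.sub hr).1 (by norm_num)
    calc C * (eLpNorm (fun x => mollify k u x - mollify l u x) 2 (wVol n a)
          + eLpNorm (mollify k G - mollify l G) 2 (wVol n a))
        ≤ C * ((eLpNorm (mollify k u - u) 2 (wVol n a) + eLpNorm (mollify l u - u) 2 (wVol n a))
          + (eLpNorm (mollify k G - G) 2 (wVol n a)
            + eLpNorm (mollify l G - G) 2 (wVol n a))) := by
          gcongr
          · exact tri (hTu.memLp k) (hTu.memLp l) hu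
          · exact tri (hTG.memLp k) (hTG.memLp l) hG
      _ = b k + b l := by simp only [hbdef]; ring
  have hcauchy : CauchySeq fun k => (hmem k).toLp _ := by
    rw [EMetric.cauchySeq_iff]
    intro ε hε
    obtain ⟨N, hN⟩ := eventually_atTop.1
      (hb0.eventually (gt_mem_nhds (ENNReal.half_pos hε.ne')))
    refine ⟨N, fun k hk l hl => ?_⟩
    rw [Lp.edist_toLp_toLp]
    refine (hdist k l).trans_lt ?_
    rw [← ENNReal.add_halves ε]
    exact ENNReal.add_lt_add (hN k hk) (hN l hl)
  obtain ⟨L, hL⟩ := cauchySeq_tendsto_of_complete hcauchy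
  have hLm : MemLp L 2 volume := Lp.memLp L
  have hLlim : TendstoL2 volume (fun k x' => mollify k u (bdry x')) atTop L := by
    refine ⟨hmem, hLm, ?_⟩
    refine (Lp.tendsto_Lp_iff_tendsto_eLpNorm'' _ hmem L hLm).1 ?_
    rwa [Lp.toLp_coeFn]
  -- Green's formula holds classically for each mollification; its two interior terms converge, and
  -- their limit is the expression that defines the trace.
  have hident : ∀ ψ : EuclideanSpace ℝ (Fin (n + 1)) → ℝ, IsTestFunction ψ →
      ∫ x', L x' * ψ (bdry x') = ∫ x', u₀ x' * ψ (bdry x') := by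
    intro ψ hψ
    have hψ1 : ContDiff ℝ 1 ψ := hψ.smooth.of_le (by exact_mod_cast le_top)
    have hψb : MemLp (fun x' => ψ (bdry x')) 2 volume := by
      refine (hψ.smooth.continuous.comp continuous_bdry).memLp_of_hasCompactSupport ?_
      exact hψ.compact.comp_isClosedEmbedding (bdryₗᵢ n).isometry.isClosedEmbedding
    have t1 := hLlim.tendsto_integral_mul (tendstoL2_const hψb atTop)
    have t2 := tendsto_integral_halfVol ha'
      ((hψ1.continuous_fderiv (by simp)).clm_apply (continuous_const (y := lastVec n)))
      (hψ.compact.fderiv_apply ℝ (lastVec n)) hTu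
    have hTh : TendstoL2 (wVol n a) (fun k x => height (mollify k G x)) atTop
        (fun x => height (G x)) := by
      have hm : ∀ g : EuclideanSpace ℝ (Fin (n + 1)) → EuclideanSpace ℝ (Fin (n + 1)),
          MemLp g 2 (wVol n a) → MemLp (fun x => height (g x)) 2 (wVol n a) := fun g hg =>
        hg.of_le (continuous_height.comp_aestronglyMeasurable hg.1)
          (ae_of_all _ fun x => abs_height_le _)
      refine hTG.mono_ae (fun k => hm _ (hTG.memLp k)) (hm _ hG) 1 fun k => ae_of_all _ fun x => ?_
      rw [← height_sub, one_mul]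
      exact abs_height_le _
    have t3 := tendsto_integral_halfVol ha' hψ.smooth.continuous hψ.compact hTh
    have t4 := t2.neg.sub t3
    simp only [integral_bdry_mollify ha' hu hG hw _ hψ] at t1
    have h5 := tendsto_nhds_unique t1 t4
    rw [h5, ht.green ψ hψ]
    ring
  have hae : ∀ᵐ x', L x' = u₀ x' := by
    refine ae_eq_of_integral_contDiff_smul_eq (hLm.locallyIntegrable (by norm_num))
      ht.locallyIntegrable fun g hg hgs => ?_
    obtain ⟨ψ, hψ, hψg⟩ := exists_isTestFunction_bdry hg hgs
    have := hident ψ hψ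
    simp only [hψg] at this
    simpa [mul_comm] using this
  refine ⟨hmem, hLm.ae_eq hae, ?_⟩
  refine hLlim.tendsto.congr fun k => eLpNorm_congr_ae ?_
  filter_upwards [hae] with x hx
  simp [hx]

theorem eLpNorm_restrict_eq_zero_of_tendsto {Ω F : Type*} [MeasurableSpace Ω] {μ : Measure Ω}
    [NormedAddCommGroup F] {f : ℕ → Ω → F} {g : Ω → F} (h : TendstoL2 μ f atTop g) {S : Set Ω}
    (hS : MeasurableSet S) (h0 : ∀ᶠ k in atTop, ∀ᵐ x ∂μ, x ∈ S → f k x = 0) :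
    ∀ᵐ x ∂μ, x ∈ S → g x = 0 := by
  have h1 : eLpNorm g 2 (μ.restrict S) ≤ 0 := by
    refine ge_of_tendsto h.tendsto ?_
    filter_upwards [h0] with k hk
    rw [eLpNorm_sub_comm]
    calc eLpNorm g 2 (μ.restrict S) = eLpNorm (g - f k) 2 (μ.restrict S) := by
          refine eLpNorm_congr_ae ?_
          filter_upwards [(ae_restrict_iff' hS).2 hk] with x hx
          simp [hx]
      _ ≤ eLpNorm (g - f k) 2 μ := eLpNorm_mono_measure _ Measure.restrict_le_self
  have h2 := (eLpNorm_eq_zero_iff h.memLp_lim.1.restrict (by norm_num)).1 (le_antisymm h1 zero_le)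
  exact (ae_restrict_iff' hS).1 h2

theorem eventually_scale_lt {r : ℝ} (hr : r < 1) : ∀ᶠ k in atTop, r + 3 * scale k < 1 := by
  have := (tendsto_scale.const_mul 3).const_add r
  rw [mul_zero, add_zero] at this
  exact this.eventually (gt_mem_nhds hr)

/-- An open ball is exhausted by smaller balls. -/
theorem ae_ball_of_forall_lt {E : Type*} [NormedAddCommGroup E] [MeasurableSpace E]
    {μ : Measure E} {p : E → Prop} (h : ∀ r : ℝ, r < 1 → ∀ᵐ x ∂μ, x ∈ Metric.ball 0 r → p x) :
    ∀ᵐ x ∂μ, ‖x‖ < 1 → p x := by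
  have h1 : ∀ᵐ x ∂μ, ∀ k : ℕ, x ∈ Metric.ball 0 (1 - scale k) → p x :=
    ae_all_iff.2 fun k => h _ (by linarith [scale_pos k])
  filter_upwards [h1] with x hx hx1
  obtain ⟨k, hk⟩ := (tendsto_scale.eventually (gt_mem_nhds (sub_pos.2 hx1))).exists
  exact hx k (by rw [mem_ball_zero_iff]; linarith)

/-- Mollifications vanish on each smaller ball once the reach `3 * scale k` of the kernel fits into
the gap; their gradients vanish there too and converge to `G`. Only the open unit ball is obtained,
which suffices because the sphere is covered by the estimates for `|x| ≥ 1`. -/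
theorem ae_gradient_eq_zero (ha : -1 < a) (ha' : a < 1)
    {u : EuclideanSpace ℝ (Fin (n + 1)) → ℝ}
    {G : EuclideanSpace ℝ (Fin (n + 1)) → EuclideanSpace ℝ (Fin (n + 1))}
    (hu : MemLp u 2 (wVol n a)) (hG : MemLp G 2 (wVol n a)) (hw : HasWeakGradient u G)
    (h0 : ∀ᵐ x ∂(halfVol n), ‖x‖ ≤ 1 → u x = 0) : ∀ᵐ x ∂(wVol n a), ‖x‖ < 1 → G x = 0 := by
  refine ae_ball_of_forall_lt fun r hr => ?_
  refine eLpNorm_restrict_eq_zero_of_tendsto (tendstoL2_mollify ha ha' hG) measurableSet_ball ?_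
  filter_upwards [eventually_scale_lt hr] with k hk
  filter_upwards [ae_wVol_pos a] with x hx hxr
  rw [← gradient_mollify ha' k hu hG hw hx.le]
  have : mollify k u =ᶠ[𝓝 x] fun _ => 0 := by
    filter_upwards [Metric.isOpen_ball.mem_nhds hxr] with z hz
    rw [mem_ball_zero_iff] at hz
    exact mollify_eq_zero h0 (by linarith)
  rw [gradient, this.fderiv_eq]
  simp

theorem ae_trace_eq_zero (ha : -1 < a) (ha' : a < 1)
    {u : EuclideanSpace ℝ (Fin (n + 1)) → ℝ}
    {G : EuclideanSpace ℝ (Fin (n + 1)) → EuclideanSpace ℝ (Fin (n + 1))}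
    {u₀ : EuclideanSpace ℝ (Fin n) → ℝ}
    (hu : MemLp u 2 (wVol n a)) (hG : MemLp G 2 (wVol n a)) (hw : HasWeakGradient u G)
    (ht : IsTrace u G u₀)
    (h0 : ∀ᵐ x ∂(halfVol n), ‖x‖ ≤ 1 → u x = 0) : ∀ᵐ x', ‖x'‖ < 1 → u₀ x' = 0 := by
  refine ae_ball_of_forall_lt fun r hr => ?_
  refine eLpNorm_restrict_eq_zero_of_tendsto (tendstoL2_bdry_mollify ha ha' hu hG hw ht)
    measurableSet_ball ?_
  filter_upwards [eventually_scale_lt hr] with k hk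
  refine ae_of_all _ fun x' hx' => mollify_eq_zero h0 ?_
  rw [mem_ball_zero_iff] at hx'
  rw [norm_bdry]
  linarith

end Trace

/-! ### Difference quotients of pairings along dilations -/

section Pairings

variable {Ω ι F : Type*} [MeasurableSpace Ω] {μ : Measure Ω} [NormedAddCommGroup F] {l : Filter ι}

theorem TendstoL2.add {f f' : ι → Ω → F} {g g' : Ω → F} (h : TendstoL2 μ f l g)
    (h' : TendstoL2 μ f' l g') :
    TendstoL2 μ (fun i x => f i x + f' i x) l (fun x => g x + g' x) := by
  refine ⟨fun i => (h.memLp i).add (h'.memLp i), h.memLp_lim.add h'.memLp_lim, ?_⟩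
  have h0 := h.tendsto.add h'.tendsto
  rw [add_zero] at h0
  refine tendsto_of_tendsto_of_tendsto_of_le_of_le tendsto_const_nhds h0 (fun _ => zero_le)
    fun i => ?_
  have e : ((fun x => f i x + f' i x) - fun x => g x + g' x) = (f i - g) + (f' i - g') := by
    funext x
    simp only [Pi.sub_apply, Pi.add_apply]
    abel
  simp only [e]
  exact eLpNorm_add_le ((h.memLp i).1.sub h.memLp_lim.1) ((h'.memLp i).1.sub h'.memLp_lim.1)
    (by norm_num)

theorem abs_integral_inner_le [InnerProductSpace ℝ F] {p q : Ω → F} (hp : MemLp p 2 μ)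
    (hq : MemLp q 2 μ) :
    |∫ x, inner ℝ (p x) (q x) ∂μ| ≤ (eLpNorm p 2 μ).toReal * (eLpNorm q 2 μ).toReal := by
  have key : inner ℝ (hp.toLp p) (hq.toLp q) = ∫ x, inner ℝ (p x) (q x) ∂μ := by
    rw [L2.inner_def]
    refine integral_congr_ae ?_
    filter_upwards [hp.coeFn_toLp, hq.coeFn_toLp] with x h1 h2
    rw [h1, h2]
  rw [← key]
  refine (abs_real_inner_le_norm _ _).trans ?_
  rw [Lp.norm_toLp, Lp.norm_toLp]

variable {E : Type*} [NormedAddCommGroup E] [NormedSpace ℝ E] [MeasurableSpace E] [BorelSpace E]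
  {ν : Measure E} {d : ℝ}

theorem TendstoL2.comp_smul (hν : IsHomogeneous ν d) {c : ℝ} (hc : 0 < c) {f : ι → E → F}
    {g : E → F} (h : TendstoL2 ν f l g) :
    TendstoL2 ν (fun i x => f i (c • x)) l (fun x => g (c • x)) := by
  refine ⟨fun i => hν.memLp_comp_smul hc (h.memLp i), hν.memLp_comp_smul hc h.memLp_lim, ?_⟩
  have h1 : ∀ i, eLpNorm ((fun x => f i (c • x)) - fun x => g (c • x)) 2 ν
      = ENNReal.ofReal (c ^ (-d)) ^ (1 / 2 : ℝ) * eLpNorm (f i - g) 2 ν := fun i =>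
    hν.eLpNorm_comp_smul hc (f i - g)
  simp only [h1]
  simpa using ENNReal.Tendsto.const_mul h.tendsto
    (Or.inr (ENNReal.rpow_ne_top_of_nonneg (by norm_num) ENNReal.ofReal_ne_top))

/-- A bounded continuous function with a bounded derivative `Z` along dilations. -/
structure RadiallyC1 (ζ Z : E → ℝ) : Prop where
  continuous : Continuous ζ
  measurable : Measurable Z
  bounded : ∃ K, ∀ x, |ζ x| ≤ K ∧ |Z x| ≤ K
  hasDerivAt : ∀ x, HasDerivAt (fun h : ℝ => ζ (Real.exp h • x)) (Z x) 0

theorem RadiallyC1.hasDerivAt_exp {ζ Z : E → ℝ} (h : RadiallyC1 ζ Z) (x : E) (t : ℝ) :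
    HasDerivAt (fun h : ℝ => ζ (Real.exp h • x)) (Z (Real.exp t • x)) t := by
  have h1 := h.hasDerivAt (Real.exp t • x)
  have h2 : HasDerivAt (fun r : ℝ => r - t) 1 t := (hasDerivAt_id t).sub_const t
  have h1' : HasDerivAt (fun h : ℝ => ζ (Real.exp h • Real.exp t • x)) (Z (Real.exp t • x))
      ((fun r : ℝ => r - t) t) := by simpa using h1
  have h3 := HasDerivAt.comp (h := fun r : ℝ => r - t) t h1' h2
  rw [mul_one] at h3
  refine h3.congr_of_eventuallyEq (Eventually.of_forall fun r => ?_)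
  simp only [Function.comp_apply, smul_smul, ← Real.exp_add]
  ring_nf

theorem scale_le_one (k : ℕ) : scale k ≤ 1 := by
  unfold scale
  rw [div_le_one (by positivity)]
  linarith [Nat.cast_nonneg (α := ℝ) k]

theorem tendsto_central_difference {Φ : ℝ → ℝ} {Φ' : ℝ} (h : HasDerivAt Φ Φ' 0) :
    Tendsto (fun j => (Φ (scale j) - Φ (-scale j)) / (2 * scale j)) atTop (𝓝 Φ') := by
  have hs : Tendsto scale atTop (𝓝[≠] 0) :=
    tendsto_nhdsWithin_iff.2 ⟨tendsto_scale, Eventually.of_forall fun k => (scale_pos k).ne'⟩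
  have hs' : Tendsto (fun j => -scale j) atTop (𝓝[≠] 0) :=
    tendsto_nhdsWithin_iff.2 ⟨by simpa using tendsto_scale.neg,
      Eventually.of_forall fun k => (neg_neg_of_pos (scale_pos k)).ne⟩
  have h0 := hasDerivAt_iff_tendsto_slope_zero.1 h
  have h1 := ((h0.comp hs).add (h0.comp hs')).div_const 2
  rw [add_self_div_two] at h1
  refine h1.congr fun j => ?_
  have := (scale_pos j).ne'
  simp only [Function.comp_apply, smul_eq_mul, zero_add]
  field_simp
  ring

/-- Substituting `e^h x` for `x` in the pairing at `-h` produces `⟨w(e^h x), w(x)⟩` again, with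
another coefficient. The symmetric difference is then one pairing whose coefficient is a difference
quotient of `ζ`, so the limit exists for every `w` in `L²`, with no differentiability of `w`. The
number `d` comes from the Jacobian, and `γ` from a power of `e^h` that the pairing may carry: `1`
for gradients, `0` for functions. -/
theorem tendsto_central_difference_quadratic [InnerProductSpace ℝ F] [ProperSpace E]
    [IsFiniteMeasureOnCompacts ν] (hν : IsHomogeneous ν d) {w : E → F} (hw : MemLp w 2 ν)
    {ζ Z : E → ℝ} (hζ : RadiallyC1 ζ Z) (γ : ℝ) :
    Tendsto (fun j =>
      (∫ x, (Real.exp (γ * scale j) * ζ x) * inner ℝ (w (Real.exp (scale j) • x)) (w x) ∂ν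
      - ∫ x, (Real.exp (γ * -scale j) * ζ x) * inner ℝ (w (Real.exp (-scale j) • x)) (w x) ∂ν)
        / (2 * scale j)) atTop
      (𝓝 (∫ x, ((2 * γ - d) * ζ x - Z x) / 2 * ‖w x‖ ^ 2 ∂ν)) := by
  obtain ⟨K, hK⟩ := hζ.bounded
  have hK0 : 0 ≤ K := (abs_nonneg _).trans (hK 0).1
  -- The difference of the two coefficients once both pairings have been brought to the same form;
  -- it vanishes at `h = 0`, with derivative `(2γ - d) ζ - Z`.
  set N : ℝ → E → ℝ := fun h x =>
    Real.exp (γ * h) * ζ x - Real.exp ((d - γ) * h) * ζ (Real.exp h • x) with hN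
  set q : ℕ → E → ℝ := fun j x => N (scale j) x / (2 * scale j) with hq
  have hNd : ∀ x t, HasDerivAt (fun h => N h x) (Real.exp (γ * t) * (γ * 1) * ζ x
      - (Real.exp ((d - γ) * t) * ((d - γ) * 1) * ζ (Real.exp t • x)
        + Real.exp ((d - γ) * t) * Z (Real.exp t • x))) t := by
    intro x t
    exact ((((hasDerivAt_id t).const_mul γ).exp).mul_const _).sub
      ((((hasDerivAt_id t).const_mul (d - γ)).exp).mul (hζ.hasDerivAt_exp x t))
  have hN0 : ∀ x, N 0 x = 0 := fun x => by simp [hN]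
  set M := Real.exp |γ| * |γ| * K + (Real.exp |d - γ| * |d - γ| * K + Real.exp |d - γ| * K) with hM
  have hexp : ∀ b t : ℝ, |t| ≤ 1 → b * t ≤ |b| := fun b t ht => by
    refine (le_abs_self _).trans ?_
    rw [abs_mul]
    exact mul_le_of_le_one_right (abs_nonneg _) ht
  have hNb : ∀ x t, |t| ≤ 1 → |N t x| ≤ M * |t| := by
    intro x t ht
    have h := (convex_Icc (-1 : ℝ) 1).norm_image_sub_le_of_norm_hasDerivWithin_le
      (f := fun h => N h x) (C := M) (x := 0) (y := t)
      (fun r _ => (hNd x r).hasDerivWithinAt) (fun r hr => ?_) (by simp) (abs_le.1 ht)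
    · simpa [hN0] using h
    · have hr' : |r| ≤ 1 := abs_le.2 hr
      refine (norm_sub_le _ _).trans (add_le_add ?_ ((norm_add_le _ _).trans (add_le_add ?_ ?_)))
      all_goals
        simp only [norm_mul, Real.norm_eq_abs, Real.abs_exp, mul_one]
      · gcongr
        · exact hexp _ _ hr'
        · exact (hK _).1
      · gcongr
        · exact hexp _ _ hr'
        · exact (hK _).1
      · gcongr
        · exact hexp _ _ hr'
        · exact (hK _).2
  have hqm : ∀ j, Measurable (q j) := fun j => by
    have := hζ.continuous.measurable
    have h2 : Measurable fun x : E => ζ (Real.exp (scale j) • x) :=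
      this.comp (measurable_const_smul _)
    simp only [hq, hN]
    fun_prop
  have hqb : ∀ j x, |q j x| ≤ M := fun j x => by
    have h1 := hNb x (scale j) (by rw [abs_of_pos (scale_pos j)]; exact scale_le_one j)
    have hp := scale_pos j
    have hM0 : 0 ≤ M := by positivity
    simp only [hq]
    rw [abs_div, abs_of_pos (by linarith : 0 < 2 * scale j), div_le_iff₀ (by linarith)]
    rw [abs_of_pos hp] at h1
    nlinarith
  have hql : ∀ x, Tendsto (fun j => q j x) atTop (𝓝 (((2 * γ - d) * ζ x - Z x) / 2)) := by
    intro x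
    have h0 := hasDerivAt_iff_tendsto_slope_zero.1 (hNd x 0)
    have hs : Tendsto scale atTop (𝓝[≠] 0) :=
      tendsto_nhdsWithin_iff.2 ⟨tendsto_scale, Eventually.of_forall fun k => (scale_pos k).ne'⟩
    have h1 := (h0.comp hs).div_const 2
    simp only [Function.comp_def, smul_eq_mul, zero_add, hN0, sub_zero, mul_zero, Real.exp_zero,
      one_smul, one_mul, mul_one] at h1
    convert h1 using 2 with j
    · simp only [hq]
      have := (scale_pos j).ne'
      field_simp
    · ring
  have hT : TendstoL2 ν (fun j x => w (Real.exp (scale j) • x)) atTop w := by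
    have := (hν.tendstoL2_comp_exp_smul hw 0).comp tendsto_scale
    simpa using this
  have hT2 := hT.smul (fun j => (hqm j).aestronglyMeasurable)
    (ζ₀ := fun x => ((2 * γ - d) * ζ x - Z x) / 2) (K := M)
    (by
      have h1 := hζ.continuous.measurable
      have h2 := hζ.measurable
      exact (show Measurable _ by fun_prop).aestronglyMeasurable)
    (fun j => ae_of_all _ (hqb j))
    (ae_of_all _ fun x => le_of_tendsto (hql x).abs (Eventually.of_forall fun j => hqb j x))
    (ae_of_all _ hql)
  have hlim := hT2.tendsto_integral_inner (tendstoL2_const hw atTop)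
  have e1 : ∀ x, inner ℝ ((((2 * γ - d) * ζ x - Z x) / 2) • w x) (w x)
      = ((2 * γ - d) * ζ x - Z x) / 2 * ‖w x‖ ^ 2 := fun x => by
    rw [real_inner_smul_left, real_inner_self_eq_norm_sq]
  simp only [e1] at hlim
  refine hlim.congr fun j => ?_
  have hc := Real.exp_pos (scale j)
  have hInt1 : Integrable (fun x => (Real.exp (γ * scale j) * ζ x) *
      inner ℝ (w (Real.exp (scale j) • x)) (w x)) ν := by
    have h1 : MemLp (fun x => (Real.exp (γ * scale j) * ζ x) • w (Real.exp (scale j) • x)) 2 ν :=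
      memLp_bdd_smul (K := Real.exp (γ * scale j) * K)
        (hζ.continuous.const_mul _).aestronglyMeasurable
        (ae_of_all _ fun x => by
          rw [abs_mul, Real.abs_exp]; gcongr; exact (hK x).1) (hν.memLp_comp_smul hc hw)
    refine (integrable_inner h1 hw).congr (ae_of_all _ fun x => ?_)
    simp only [real_inner_smul_left]
  have hInt2 : Integrable (fun x => (Real.exp ((d - γ) * scale j) * ζ (Real.exp (scale j) • x)) *
      inner ℝ (w (Real.exp (scale j) • x)) (w x)) ν := by
    have h1 : MemLp (fun x => (Real.exp ((d - γ) * scale j) * ζ (Real.exp (scale j) • x)) •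
        w (Real.exp (scale j) • x)) 2 ν :=
      memLp_bdd_smul (K := Real.exp ((d - γ) * scale j) * K)
        ((hζ.continuous.comp (continuous_const_smul _)).const_mul _).aestronglyMeasurable
        (ae_of_all _ fun x => by
          rw [abs_mul, Real.abs_exp]; gcongr; exact (hK _).1) (hν.memLp_comp_smul hc hw)
    refine (integrable_inner h1 hw).congr (ae_of_all _ fun x => ?_)
    simp only [real_inner_smul_left]
  -- The change of variables that, by symmetry of the inner product, transfers the dilation back to
  -- the first factor.
  have hsub : ∫ x, (Real.exp (γ * -scale j) * ζ x) * inner ℝ (w (Real.exp (-scale j) • x)) (w x) ∂ν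
      = ∫ x, (Real.exp ((d - γ) * scale j) * ζ (Real.exp (scale j) • x)) *
      inner ℝ (w (Real.exp (scale j) • x)) (w x) ∂ν := by
    have h1 := hν.integral_comp_smul hc (fun x => (Real.exp (γ * -scale j) * ζ x) *
      inner ℝ (w (Real.exp (-scale j) • x)) (w x))
    have h2 : ∀ x : E, Real.exp (-scale j) • Real.exp (scale j) • x = x := fun x => by
      rw [smul_smul, ← Real.exp_add]; simp
    simp only [h2, smul_eq_mul] at h1
    rw [← Real.exp_mul] at h1
    have h3 : Real.exp (scale j * d) * Real.exp (scale j * -d) = 1 := by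
      rw [← Real.exp_add]; simp
    rw [← one_mul (∫ x, (Real.exp (γ * -scale j) * ζ x) *
      inner ℝ (w (Real.exp (-scale j) • x)) (w x) ∂ν), ← h3, mul_assoc, ← h1,
      ← integral_const_mul]
    refine integral_congr_ae (ae_of_all _ fun x => ?_)
    simp only
    rw [real_inner_comm, ← mul_assoc, ← mul_assoc, ← Real.exp_add]
    ring_nf
  rw [hsub, ← integral_sub hInt1 hInt2, ← integral_div]
  refine integral_congr_ae (ae_of_all _ fun x => ?_)
  simp only [hq, hN, real_inner_smul_left]
  ring

end Pairings

/-! ### Energy, mass and virial identities for weak solutions -/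

section Virial

variable {n : ℕ} {a : ℝ} {u F : EuclideanSpace ℝ (Fin (n + 1)) → ℝ}
  {G : EuclideanSpace ℝ (Fin (n + 1)) → EuclideanSpace ℝ (Fin (n + 1))}
  {u₀ V Z : EuclideanSpace ℝ (Fin n) → ℝ}

/-- A weak solution of `∇ · y^a ∇u = y^a F` with conormal derivative `V u₀`, together with an
approximation by smooth functions. `Z` is the radial derivative of `V`. -/
structure WeakSolution (a : ℝ) (u : EuclideanSpace ℝ (Fin (n + 1)) → ℝ)
    (G : EuclideanSpace ℝ (Fin (n + 1)) → EuclideanSpace ℝ (Fin (n + 1)))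
    (u₀ : EuclideanSpace ℝ (Fin n) → ℝ) (F : EuclideanSpace ℝ (Fin (n + 1)) → ℝ)
    (V Z : EuclideanSpace ℝ (Fin n) → ℝ) : Prop where
  neg_one_lt : -1 < a
  lt_one : a < 1
  approx : ∃ U : ℕ → EuclideanSpace ℝ (Fin (n + 1)) → ℝ, (∀ k, ContDiff ℝ (⊤ : ℕ∞) (U k)) ∧
    TendstoL2 (wVol n a) U atTop u ∧ TendstoL2 (wVol n a) (fun k => gradient (U k)) atTop G ∧
    TendstoL2 volume (fun k x' => U k (bdry x')) atTop u₀
  memLp_source : MemLp F 2 (wVol n a)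
  continuous : Continuous V
  hasDerivAt : ∀ x, HasDerivAt (fun h : ℝ => V (Real.exp h • x)) (Z x) 0
  measurable : Measurable Z
  bounded : ∀ R : ℝ, ∃ M : ℝ, ∀ x, ‖x‖ ≤ R → |Z x| ≤ M
  weak : ∀ ψ : EuclideanSpace ℝ (Fin (n + 1)) → ℝ, IsTestFunction ψ →
    ∫ x, inner ℝ (gradient ψ x) (G x) ∂(wVol n a)
      = - ∫ x, F x * ψ x ∂(wVol n a) - ∫ x', V x' * u₀ x' * ψ (bdry x')

theorem WeakSolution.memLp (h : WeakSolution a u G u₀ F V Z) : MemLp u 2 (wVol n a) := by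
  obtain ⟨U, -, h1, -, -⟩ := h.approx
  exact h1.memLp_lim

theorem WeakSolution.memLp_grad (h : WeakSolution a u G u₀ F V Z) : MemLp G 2 (wVol n a) := by
  obtain ⟨U, -, -, h1, -⟩ := h.approx
  exact h1.memLp_lim

theorem WeakSolution.memLp_trace (h : WeakSolution a u G u₀ F V Z) : MemLp u₀ 2 volume := by
  obtain ⟨U, -, -, -, h1⟩ := h.approx
  exact h1.memLp_lim

/-- The radial derivative `x · ∇ρ`. -/
noncomputable def eulerDeriv (ρ : EuclideanSpace ℝ (Fin (n + 1)) → ℝ)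
    (x : EuclideanSpace ℝ (Fin (n + 1))) : ℝ := inner ℝ (gradient ρ x) x

theorem IsTestFunction.contDiff_one {ρ : EuclideanSpace ℝ (Fin (n + 1)) → ℝ}
    (hρ : IsTestFunction ρ) : ContDiff ℝ 1 ρ := hρ.smooth.of_le (by exact_mod_cast le_top)

theorem IsTestFunction.gradient_bounds {ρ : EuclideanSpace ℝ (Fin (n + 1)) → ℝ}
    (hρ : IsTestFunction ρ) : ∃ K R : ℝ, (∀ x, ‖gradient ρ x‖ ≤ K) ∧
      ∀ x, R < ‖x‖ → gradient ρ x = 0 := by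
  have hc := measurable_gradient hρ.contDiff_one
  have hs : HasCompactSupport (gradient ρ) := by
    refine (hρ.compact.fderiv ℝ).comp_left (g := (InnerProductSpace.toDual ℝ _).symm) ?_
    simp
  obtain ⟨K, hK⟩ := hs.exists_bound_of_continuous hc
  obtain ⟨R, hR⟩ := hs.isCompact.isBounded.subset_closedBall 0
  refine ⟨K, R, hK, fun x hx => image_eq_zero_of_notMem_tsupport fun h => ?_⟩
  have := hR h
  rw [mem_closedBall_zero_iff] at this
  linarith

theorem hasDerivAt_comp_exp_smul {ρ : EuclideanSpace ℝ (Fin (n + 1)) → ℝ} (hρ : ContDiff ℝ 1 ρ)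
    (x : EuclideanSpace ℝ (Fin (n + 1))) (t : ℝ) :
    HasDerivAt (fun h : ℝ => ρ (Real.exp h • x))
      (inner ℝ (Real.exp t • x) (gradient ρ (Real.exp t • x))) t := by
  have h1 : HasDerivAt (fun h : ℝ => Real.exp h • x) (Real.exp t • x) t :=
    (Real.hasDerivAt_exp t).smul_const x
  have h2 := ((hρ.differentiable (by simp) (Real.exp t • x)).hasFDerivAt).comp_hasDerivAt t h1
  rw [fderiv_eq_inner_gradient, real_inner_comm] at h2
  exact h2

theorem IsTestFunction.radiallyC1 {ρ : EuclideanSpace ℝ (Fin (n + 1)) → ℝ}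
    (hρ : IsTestFunction ρ) : RadiallyC1 ρ (eulerDeriv ρ) where
  continuous := hρ.smooth.continuous
  measurable := ((measurable_gradient hρ.contDiff_one).inner continuous_id).measurable
  bounded := by
    obtain ⟨K, R, hK, hR⟩ := isTestFunction_bounds hρ.smooth.continuous hρ.compact
    obtain ⟨K', R', hK', hR'⟩ := hρ.gradient_bounds
    refine ⟨max K (K' * |R'|), fun x => ⟨(hK x).trans (le_max_left _ _), ?_⟩⟩
    refine le_trans ?_ (le_max_right _ _)
    have hK0 : 0 ≤ K' := (norm_nonneg _).trans (hK' 0)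
    by_cases hx : R' < ‖x‖
    · rw [eulerDeriv, hR' x hx, inner_zero_left, abs_zero]
      positivity
    · refine (abs_real_inner_le_norm _ _).trans ?_
      gcongr
      · exact hK' x
      · exact (not_lt.1 hx).trans (le_abs_self _)
  hasDerivAt x := by
    have := hasDerivAt_comp_exp_smul hρ.contDiff_one x 0
    simpa [eulerDeriv, real_inner_comm] using this

/-- The potential enters the virial argument only through this product, and only along dilations;
this is why continuity and a locally bounded radial derivative of `V` suffice. The compact support
of `ρ` turns the local bounds into global ones. -/
theorem WeakSolution.radiallyC1_mul (h : WeakSolution a u G u₀ F V Z)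
    {ρ : EuclideanSpace ℝ (Fin (n + 1)) → ℝ} (hρ : IsTestFunction ρ) :
    RadiallyC1 (fun x' => V x' * ρ (bdry x'))
      (fun x' => Z x' * ρ (bdry x') + V x' * eulerDeriv ρ (bdry x')) where
  continuous := h.continuous.mul (hρ.smooth.continuous.comp continuous_bdry)
  measurable := by
    have h1 := h.measurable
    have h2 := h.continuous.measurable
    have h3 : Measurable fun x' : EuclideanSpace ℝ (Fin n) => ρ (bdry x') :=
      (hρ.smooth.continuous.comp continuous_bdry).measurable
    have h4 : Measurable fun x' : EuclideanSpace ℝ (Fin n) => eulerDeriv ρ (bdry x') :=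
      hρ.radiallyC1.measurable.comp continuous_bdry.measurable
    exact (h1.mul h3).add (h2.mul h4)
  bounded := by
    obtain ⟨K, hK⟩ := hρ.radiallyC1.bounded
    obtain ⟨-, R, -, hR⟩ := isTestFunction_bounds hρ.smooth.continuous hρ.compact
    obtain ⟨-, R', -, hR'⟩ := hρ.gradient_bounds
    obtain ⟨M, hM⟩ := h.bounded (max R R')
    obtain ⟨M', hM'⟩ := (isCompact_closedBall (0 : EuclideanSpace ℝ (Fin n))
      (max R R')).exists_bound_of_continuousOn h.continuous.continuousOn
    have hK0 : 0 ≤ K := (abs_nonneg _).trans (hK 0).1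
    refine ⟨max (|M'| * K) (|M| * K + |M'| * K), fun x' => ?_⟩
    by_cases hx : ‖x'‖ ≤ max R R'
    · have h1 := (hM x' hx).trans (le_abs_self M)
      have h2 := (hM' x' (by simpa using hx)).trans (le_abs_self M')
      rw [Real.norm_eq_abs] at h2
      refine ⟨le_trans ?_ (le_max_left _ _), le_trans ?_ (le_max_right _ _)⟩
      · rw [abs_mul]
        gcongr
        exact (hK _).1
      · refine (abs_add_le _ _).trans ?_
        rw [abs_mul, abs_mul]
        gcongr
        · exact (hK _).1
        · exact (hK _).2
    · rw [not_le, max_lt_iff] at hx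
      have h1 : ρ (bdry x') = 0 := hR _ (by rw [norm_bdry]; exact hx.1)
      have h2 : eulerDeriv ρ (bdry x') = 0 := by
        rw [eulerDeriv, hR' _ (by rw [norm_bdry]; exact hx.2), inner_zero_left]
      simp only [h1, h2, mul_zero, add_zero, abs_zero]
      constructor <;> positivity
  hasDerivAt x' := by
    have h1 := (h.hasDerivAt x').mul (hρ.radiallyC1.hasDerivAt (bdry x'))
    simp only [Real.exp_zero, one_smul] at h1
    refine h1.congr_of_eventuallyEq (Eventually.of_forall fun r => ?_)
    simp [bdry_smul]

theorem gradient_mul_comp_smul {ρ U : EuclideanSpace ℝ (Fin (n + 1)) → ℝ}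
    (hρ : ContDiff ℝ 1 ρ) (hU : ContDiff ℝ 1 U) (c : ℝ) (x : EuclideanSpace ℝ (Fin (n + 1))) :
    gradient (fun x => ρ x * U (c • x)) x
      = (c * ρ x) • gradient U (c • x) + U (c • x) • gradient ρ x := by
  refine ext_inner_right ℝ fun e => ?_
  rw [← fderiv_eq_inner_gradient, inner_add_left, real_inner_smul_left, real_inner_smul_left,
    ← fderiv_eq_inner_gradient, ← fderiv_eq_inner_gradient]
  have h1 : HasFDerivAt (fun x : EuclideanSpace ℝ (Fin (n + 1)) => c • x)
      (c • ContinuousLinearMap.id ℝ _) x := (hasFDerivAt_id x).const_smul c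
  have h2 := ((hU.differentiable (by simp) (c • x)).hasFDerivAt).comp x h1
  have h3 := ((hρ.differentiable (by simp) x).hasFDerivAt).mul h2
  have h4 : fderiv ℝ (fun x => ρ x * U (c • x)) x = _ := h3.fderiv
  rw [h4]
  simp only [Function.comp_apply, _root_.add_apply, _root_.smul_apply, smul_eq_mul,
    ContinuousLinearMap.comp_apply, ContinuousLinearMap.id_apply, map_smul]
  ring

/-- The weak equation tested with `ρ(x) u(e^h x)`. -/
theorem WeakSolution.test_dilation (hw : WeakSolution a u G u₀ F V Z)
    {ρ : EuclideanSpace ℝ (Fin (n + 1)) → ℝ} (hρ : IsTestFunction ρ) (h : ℝ) :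
    ∫ x, (Real.exp (1 * h) * ρ x) * inner ℝ (G (Real.exp h • x)) (G x) ∂(wVol n a)
      + ∫ x, inner ℝ (gradient ρ x) (G x) * u (Real.exp h • x) ∂(wVol n a)
    = - ∫ x, (F x * ρ x) * u (Real.exp h • x) ∂(wVol n a)
      - ∫ x', (Real.exp (0 * h) * (V x' * ρ (bdry x'))) *
          inner ℝ (u₀ (Real.exp h • x')) (u₀ x') := by
  obtain ⟨U, hU, hTu, hTG, hT0⟩ := hw.approx
  have hc := Real.exp_pos h
  have hhom := isHomogeneous_wVol (n := n) a
  obtain ⟨K, R, hK, hR⟩ := isTestFunction_bounds hρ.smooth.continuous hρ.compact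
  obtain ⟨K', R', hK', hR'⟩ := hρ.gradient_bounds
  have hρm := hρ.smooth.continuous.aestronglyMeasurable (μ := wVol n a)
  have hgm := (measurable_gradient hρ.contDiff_one).aestronglyMeasurable (μ := wVol n a)
  have hUc : ∀ k, ContDiff ℝ 1 (U k) := fun k => (hU k).of_le (by exact_mod_cast le_top)
  -- With the smooth approximations in place of `u` the test function is admissible; every term is
  -- continuous under their `L²` convergence, including the trace.
  have htest : ∀ k, IsTestFunction fun x => ρ x * U k (Real.exp h • x) := fun k =>
    ⟨hρ.smooth.mul ((hU k).comp (contDiff_const_smul _)), hρ.compact.mul_right⟩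
  have hTud := hTu.comp_smul hhom hc
  have hTGd := hTG.comp_smul hhom hc
  have hT0d := hT0.comp_smul (isHomogeneous_volume n) hc
  have t1 := (hTGd.bdd_smul (ζ := fun x => Real.exp h * ρ x) (K := Real.exp h * K)
    (hρm.const_mul _) (ae_of_all _ fun x => by
      rw [abs_mul, Real.abs_exp]; gcongr; exact hK x))
  have hmul : ∀ q : EuclideanSpace ℝ (Fin (n + 1)) → ℝ, MemLp q 2 (wVol n a) →
      MemLp (fun x => q x • gradient ρ x) 2 (wVol n a) := fun q hq => by
    refine MemLp.of_le_mul (c := K') hq (hq.1.smul hgm) (ae_of_all _ fun x => ?_)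
    rw [norm_smul, mul_comm]
    gcongr
    exact hK' x
  have t2 : TendstoL2 (wVol n a) (fun k x => U k (Real.exp h • x) • gradient ρ x) atTop
      (fun x => u (Real.exp h • x) • gradient ρ x) := by
    refine hTud.mono_ae (fun k => hmul _ (hTud.memLp k)) (hmul _ hTud.memLp_lim) K' fun k =>
      ae_of_all _ fun x => ?_
    rw [← sub_smul, norm_smul, mul_comm]
    gcongr
    exact hK' x
  have t3 := (t1.add t2).tendsto_integral_inner (tendstoL2_const hw.memLp_grad atTop)
  have t4 := (tendstoL2_const (hw.memLp_source) atTop).tendsto_integral_mul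
    (hTud.bdd_smul hρm (ae_of_all _ hK))
  have t5 := (tendstoL2_const hw.memLp_trace atTop).tendsto_integral_mul
    (hT0d.bdd_smul (ζ := fun x' => V x' * ρ (bdry x')) (K := (hw.radiallyC1_mul hρ).bounded.choose)
      (hw.radiallyC1_mul hρ).continuous.aestronglyMeasurable
      (ae_of_all _ fun x => ((hw.radiallyC1_mul hρ).bounded.choose_spec x).1))
  have heq : ∀ k, ∫ x, inner ℝ ((Real.exp h * ρ x) • gradient (U k) (Real.exp h • x)
        + U k (Real.exp h • x) • gradient ρ x) (G x) ∂(wVol n a)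
      = - ∫ x, F x * ρ x • U k (Real.exp h • x) ∂(wVol n a)
        - ∫ x', u₀ x' * (V x' * ρ (bdry x')) • U k (bdry (Real.exp h • x')) := fun k => by
    have h1 := hw.weak _ (htest k)
    simp only [gradient_mul_comp_smul hρ.contDiff_one (hUc k)] at h1
    rw [h1]
    congr 1
    refine integral_congr_ae (ae_of_all _ fun x' => ?_)
    simp only [smul_eq_mul, bdry_smul]
    ring
  simp only [heq] at t3
  have h5 := tendsto_nhds_unique t3 (t4.neg.sub t5)
  have i1 : Integrable (fun x => (Real.exp (1 * h) * ρ x) *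
      inner ℝ (G (Real.exp h • x)) (G x)) (wVol n a) := by
    refine (integrable_inner t1.memLp_lim hw.memLp_grad).congr (ae_of_all _ fun x => ?_)
    simp only [real_inner_smul_left, one_mul]
  have i2 : Integrable (fun x => inner ℝ (gradient ρ x) (G x) * u (Real.exp h • x)) (wVol n a) := by
    refine (integrable_inner t2.memLp_lim hw.memLp_grad).congr (ae_of_all _ fun x => ?_)
    simp only [real_inner_smul_left, mul_comm]
  rw [← integral_add i1 i2]
  refine Eq.trans (integral_congr_ae (ae_of_all _ fun x => ?_)) (h5.trans ?_)
  · simp only [inner_add_left, real_inner_smul_left, one_mul]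
    ring
  · congr 1
    · congr 1
      refine integral_congr_ae (ae_of_all _ fun x => ?_)
      simp only [smul_eq_mul]
      ring
    · refine integral_congr_ae (ae_of_all _ fun x => ?_)
      simp only [smul_eq_mul, zero_mul, Real.exp_zero, one_mul, RCLike.inner_apply, conj_trivial]
      ring

/-- The derivative of `u` along dilations, tested with a function of bounded support. -/
theorem WeakSolution.hasDerivAt_integral (hw : WeakSolution a u G u₀ F V Z)
    {g : EuclideanSpace ℝ (Fin (n + 1)) → ℝ} (hg : MemLp g 2 (wVol n a)) {R : ℝ}
    (hR : ∀ x, R < ‖x‖ → g x = 0) :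
    HasDerivAt (fun h : ℝ => ∫ x, g x * u (Real.exp h • x) ∂(wVol n a))
      (∫ x, g x * inner ℝ x (G x) ∂(wVol n a)) 0 := by
  obtain ⟨U, hU, hTu, hTG, -⟩ := hw.approx
  have hhom := isHomogeneous_wVol (n := n) a
  set d : ℝ := (n : ℝ) + 1 + a with hd
  have hfin := isFiniteMeasureOnCompacts_wVol (n := n) hw.neg_one_lt
  have hUc : ∀ k, ContDiff ℝ 1 (U k) := fun k => (hU k).of_le (by exact_mod_cast le_top)
  have hgx : MemLp (fun x => g x • x) 2 (wVol n a) := by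
    refine MemLp.of_le_mul (c := |R|) hg (hg.1.smul continuous_id.aestronglyMeasurable)
      (ae_of_all _ fun x => ?_)
    rw [norm_smul, mul_comm]
    by_cases hx : R < ‖x‖
    · simp [hR x hx]
    · gcongr
      exact (not_lt.1 hx).trans (le_abs_self R)
  have hgint : Integrable g (wVol n a) := by
    have h1 : MemLp ((Metric.closedBall (0 : EuclideanSpace ℝ (Fin (n + 1))) R).indicator
        fun _ => (1 : ℝ)) 2 (wVol n a) :=
      memLp_indicator_const 2 measurableSet_closedBall 1
        (Or.inr (isCompact_closedBall _ _).measure_lt_top.ne)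
    refine (integrable_mul h1 hg).congr (ae_of_all _ fun x => ?_)
    by_cases hx : x ∈ Metric.closedBall (0 : EuclideanSpace ℝ (Fin (n + 1))) R
    · simp [indicator_of_mem hx]
    · rw [mem_closedBall_zero_iff, not_le] at hx
      simp [hR x hx]
  have hder : ∀ k, ∀ t ∈ Metric.ball (0 : ℝ) 1,
      HasDerivAt (fun h : ℝ => ∫ x, g x * U k (Real.exp h • x) ∂(wVol n a))
        (∫ x, g x * inner ℝ (Real.exp t • x) (gradient (U k) (Real.exp t • x)) ∂(wVol n a)) t := by
    intro k t ht
    obtain ⟨M, hM⟩ := (isCompact_closedBall (0 : EuclideanSpace ℝ (Fin (n + 1)))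
      (Real.exp 1 * |R|)).exists_bound_of_continuousOn
      (f := fun z => inner ℝ z (gradient (U k) z))
      (continuous_id.inner (measurable_gradient (hUc k))).continuousOn
    obtain ⟨M', hM'⟩ := (isCompact_closedBall (0 : EuclideanSpace ℝ (Fin (n + 1)))
      (Real.exp 1 * |R|)).exists_bound_of_continuousOn (hUc k).continuous.continuousOn
    have hball : ∀ s ∈ Metric.ball (0 : ℝ) 1, ∀ x, ¬ R < ‖x‖ →
        Real.exp s • x ∈ Metric.closedBall (0 : EuclideanSpace ℝ (Fin (n + 1)))
          (Real.exp 1 * |R|) := by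
      intro s hs x hx
      rw [mem_ball_zero_iff, Real.norm_eq_abs] at hs
      rw [mem_closedBall_zero_iff, norm_smul, Real.norm_eq_abs, Real.abs_exp]
      gcongr
      · exact (abs_lt.1 hs).2.le
      · exact (not_lt.1 hx).trans (le_abs_self R)
    have hmeas : ∀ s : ℝ, AEStronglyMeasurable (fun x => g x * U k (Real.exp s • x))
        (wVol n a) := fun s =>
      hg.1.mul ((hUc k).continuous.comp (continuous_const_smul _)).aestronglyMeasurable
    refine (hasDerivAt_integral_of_dominated_loc_of_deriv_le (bound := fun x => M * ‖g x‖)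
      (F' := fun s x => g x * inner ℝ (Real.exp s • x) (gradient (U k) (Real.exp s • x)))
      (Metric.isOpen_ball.mem_nhds ht) (Eventually.of_forall hmeas) ?_ ?_ ?_
      (hgint.norm.const_mul M) ?_).2
    · refine (hgint.norm.const_mul M').mono' (hmeas t) (ae_of_all _ fun x => ?_)
      by_cases hx : R < ‖x‖
      · simp [hR x hx]
      · rw [norm_mul, mul_comm]
        gcongr
        exact hM' _ (hball t ht x hx)
    · refine hg.1.mul (Continuous.aestronglyMeasurable ?_)
      exact (continuous_const_smul _).inner
        ((measurable_gradient (hUc k)).comp (continuous_const_smul _))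
    · refine ae_of_all _ fun x s hs => ?_
      by_cases hx : R < ‖x‖
      · simp [hR x hx]
      · rw [norm_mul, mul_comm]
        gcongr
        exact hM _ (hball s hs x hx)
    · exact ae_of_all _ fun x s _ => (hasDerivAt_comp_exp_smul (hUc k) x s).const_mul (g x)
  have hform : ∀ (H : EuclideanSpace ℝ (Fin (n + 1)) → EuclideanSpace ℝ (Fin (n + 1))) (t : ℝ),
      ∫ x, g x * inner ℝ (Real.exp t • x) (H (Real.exp t • x)) ∂(wVol n a)
      = Real.exp t * ∫ x, inner ℝ (g x • x) (H (Real.exp t • x)) ∂(wVol n a) := by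
    intro H t
    rw [← integral_const_mul]
    refine integral_congr_ae (ae_of_all _ fun x => ?_)
    simp only [real_inner_smul_left]
    ring
  -- Dilations by `e^t` with `|t| < 1` have uniformly bounded norms, so the derivatives of the
  -- smooth approximations converge uniformly in `t` and the limit may be differentiated.
  have hunif : TendstoUniformlyOn
      (fun k t => ∫ x, g x * inner ℝ (Real.exp t • x) (gradient (U k) (Real.exp t • x)) ∂(wVol n a))
      (fun t => ∫ x, g x * inner ℝ (Real.exp t • x) (G (Real.exp t • x)) ∂(wVol n a))
      atTop (Metric.ball (0 : ℝ) 1) := by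
    set C : ℝ := Real.exp 1 * ((eLpNorm (fun x => g x • x) 2 (wVol n a)).toReal *
      (ENNReal.ofReal (Real.exp |d|) ^ (1 / 2 : ℝ)).toReal) with hC
    have hlim : Tendsto (fun k => C * (eLpNorm (gradient (U k) - G) 2 (wVol n a)).toReal) atTop
        (𝓝 0) := by
      have := (ENNReal.tendsto_toReal ENNReal.zero_ne_top).comp hTG.tendsto
      simpa using this.const_mul C
    rw [Metric.tendstoUniformlyOn_iff]
    intro ε hε
    filter_upwards [hlim.eventually (gt_mem_nhds hε)] with k hk t ht
    refine lt_of_le_of_lt ?_ hk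
    rw [mem_ball_zero_iff, Real.norm_eq_abs] at ht
    have m1 := hhom.memLp_comp_smul (Real.exp_pos t) hTG.memLp_lim
    have m2 := hhom.memLp_comp_smul (Real.exp_pos t) (hTG.memLp k)
    rw [dist_comm, Real.dist_eq, hform, hform, ← mul_sub,
      ← integral_sub (integrable_inner hgx m2) (integrable_inner hgx m1), abs_mul, Real.abs_exp]
    simp only [← inner_sub_right]
    have h1 := abs_integral_inner_le hgx (m2.sub m1)
    have h2 : eLpNorm (fun x => gradient (U k) (Real.exp t • x) - G (Real.exp t • x)) 2 (wVol n a)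
        ≤ ENNReal.ofReal (Real.exp |d|) ^ (1 / 2 : ℝ) *
          eLpNorm (gradient (U k) - G) 2 (wVol n a) := by
      refine (hhom.eLpNorm_comp_smul (Real.exp_pos t) (gradient (U k) - G)).le.trans ?_
      gcongr
      rw [← Real.exp_mul]
      gcongr
      calc t * -d ≤ |t * -d| := le_abs_self _
        _ = |t| * |d| := by rw [abs_mul, abs_neg]
        _ ≤ 1 * |d| := by gcongr
        _ = |d| := one_mul _
    have hne : ENNReal.ofReal (Real.exp |d|) ^ (1 / 2 : ℝ) *
          eLpNorm (gradient (U k) - G) 2 (wVol n a) ≠ ∞ :=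
      ENNReal.mul_ne_top (ENNReal.rpow_ne_top_of_nonneg (by norm_num) ENNReal.ofReal_ne_top)
        ((hTG.memLp k).sub hTG.memLp_lim).2.ne
    have h3 := ENNReal.toReal_mono hne h2
    rw [ENNReal.toReal_mul] at h3
    calc _ ≤ Real.exp 1 * ((eLpNorm (fun x => g x • x) 2 (wVol n a)).toReal *
          ((ENNReal.ofReal (Real.exp |d|) ^ (1 / 2 : ℝ)).toReal *
            (eLpNorm (gradient (U k) - G) 2 (wVol n a)).toReal)) := by
          gcongr
          · exact (abs_lt.1 ht).2.le
          · refine h1.trans ?_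
            gcongr
            exact h3
      _ = _ := by rw [hC]; ring
  have hpt : ∀ t ∈ Metric.ball (0 : ℝ) 1, Tendsto
      (fun k => ∫ x, g x * U k (Real.exp t • x) ∂(wVol n a)) atTop
      (𝓝 (∫ x, g x * u (Real.exp t • x) ∂(wVol n a))) := fun t _ =>
    (tendstoL2_const hg atTop).tendsto_integral_mul (hTu.comp_smul hhom (Real.exp_pos t))
  have h := hasDerivAt_of_tendstoUniformlyOn Metric.isOpen_ball hunif
    (Eventually.of_forall hder) hpt (Metric.mem_ball_self one_pos)
  simpa using h

theorem WeakSolution.memLp_inner_gradient (hw : WeakSolution a u G u₀ F V Z)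
    {ρ : EuclideanSpace ℝ (Fin (n + 1)) → ℝ} (hρ : IsTestFunction ρ) :
    MemLp (fun x => inner ℝ (gradient ρ x) (G x)) 2 (wVol n a) := by
  obtain ⟨K', R', hK', hR'⟩ := hρ.gradient_bounds
  refine MemLp.of_le_mul (c := K') hw.memLp_grad
    ((measurable_gradient hρ.contDiff_one).aestronglyMeasurable.inner hw.memLp_grad.1)
    (ae_of_all _ fun x => ?_)
  refine (norm_inner_le_norm _ _).trans ?_
  gcongr
  exact hK' x

theorem WeakSolution.energy_identity (hw : WeakSolution a u G u₀ F V Z)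
    {ρ : EuclideanSpace ℝ (Fin (n + 1)) → ℝ} (hρ : IsTestFunction ρ) :
    ∫ x, ρ x * ‖G x‖ ^ 2 ∂(wVol n a) + ∫ x, inner ℝ (gradient ρ x) (G x) * u x ∂(wVol n a)
      = - ∫ x, F x * ρ x * u x ∂(wVol n a) - ∫ x', V x' * ρ (bdry x') * u₀ x' ^ 2 := by
  have h := hw.test_dilation hρ 0
  simp only [mul_zero, Real.exp_zero, one_smul, one_mul, real_inner_self_eq_norm_sq] at h
  simpa using h

/-- The symmetric difference quotient of `∫ ζ u(x) u(e^h x)` is computed twice, by differentiating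
`u` and by moving the dilation onto `ζ`. -/
theorem WeakSolution.mass_identity (hw : WeakSolution a u G u₀ F V Z)
    {ζ : EuclideanSpace ℝ (Fin (n + 1)) → ℝ} (hζ : IsTestFunction ζ) :
    ∫ x, ζ x * u x * inner ℝ x (G x) ∂(wVol n a)
      = ∫ x, (-((n : ℝ) + 1 + a) * ζ x - eulerDeriv ζ x) / 2 * u x ^ 2 ∂(wVol n a) := by
  have hfin := isFiniteMeasureOnCompacts_wVol (n := n) hw.neg_one_lt
  obtain ⟨K, R, hK, hR⟩ := isTestFunction_bounds hζ.smooth.continuous hζ.compact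
  have hg : MemLp (fun x => ζ x * u x) 2 (wVol n a) :=
    memLp_bdd_smul hζ.smooth.continuous.aestronglyMeasurable (ae_of_all _ hK) hw.memLp
  have h1 := tendsto_central_difference
    (hw.hasDerivAt_integral hg (R := R) fun x hx => by simp [hR x hx])
  have h2 := tendsto_central_difference_quadratic (isHomogeneous_wVol (n := n) a) hw.memLp
    hζ.radiallyC1 0
  have h3 := tendsto_nhds_unique h1 (h2.congr fun j => ?_)
  · rw [h3]
    refine integral_congr_ae (ae_of_all _ fun x => ?_)
    simp
  · simp only [zero_mul, Real.exp_zero, one_mul, RCLike.inner_apply, conj_trivial, mul_assoc]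

/-- This is the identity that the multiplier `ρ x · ∇u` would give, obtained as the symmetric
difference quotient of `WeakSolution.test_dilation` at `h = 0`. The two quadratic pairings, of `G`
and of the trace, are handled by `tendsto_central_difference_quadratic`; the terms linear in the
dilated `u` by `WeakSolution.hasDerivAt_integral`. -/
theorem WeakSolution.virial_identity (hw : WeakSolution a u G u₀ F V Z)
    {ρ : EuclideanSpace ℝ (Fin (n + 1)) → ℝ} (hρ : IsTestFunction ρ) :
    ∫ x, ((2 - ((n : ℝ) + 1 + a)) * ρ x - eulerDeriv ρ x) / 2 * ‖G x‖ ^ 2 ∂(wVol n a)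
      + ∫ x, inner ℝ (gradient ρ x) (G x) * inner ℝ x (G x) ∂(wVol n a)
    = - ∫ x, F x * ρ x * inner ℝ x (G x) ∂(wVol n a)
      - ∫ x', (-(n : ℝ) * (V x' * ρ (bdry x'))
        - (Z x' * ρ (bdry x') + V x' * eulerDeriv ρ (bdry x'))) / 2 * u₀ x' ^ 2 := by
  have hfin := isFiniteMeasureOnCompacts_wVol (n := n) hw.neg_one_lt
  obtain ⟨K, R, hK, hR⟩ := isTestFunction_bounds hρ.smooth.continuous hρ.compact
  obtain ⟨K', R', hK', hR'⟩ := hρ.gradient_bounds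
  have hgF : MemLp (fun x => F x * ρ x) 2 (wVol n a) := by
    simpa [mul_comm] using memLp_bdd_smul hρ.smooth.continuous.aestronglyMeasurable
      (ae_of_all _ hK) hw.memLp_source
  have hA := tendsto_central_difference_quadratic (isHomogeneous_wVol (n := n) a) hw.memLp_grad
    hρ.radiallyC1 1
  have hB := tendsto_central_difference
    (hw.hasDerivAt_integral (hw.memLp_inner_gradient hρ) (R := R') fun x hx => by simp [hR' x hx])
  have hC := tendsto_central_difference
    (hw.hasDerivAt_integral hgF (R := R) fun x hx => by simp [hR x hx])
  have hD := tendsto_central_difference_quadratic (isHomogeneous_volume n) hw.memLp_trace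
    (hw.radiallyC1_mul hρ) 0
  have h := tendsto_nhds_unique (hA.add hB) ((hC.neg.sub hD).congr fun j => ?_)
  · simp only [mul_one, mul_zero, zero_sub, Real.norm_eq_abs, sq_abs] at h
    exact h
  · have e1 := hw.test_dilation hρ (scale j)
    have e2 := hw.test_dilation hρ (-scale j)
    rw [← neg_div, ← sub_div, ← add_div]
    congr 1
    linarith

end Virial

/-! ### Radial test functions and cutoffs -/

section Radial

variable {n : ℕ}

/-- The norm is smooth away from the origin, and near the origin the composite is identically zero.
-/
theorem isTestFunction_radial {β : ℝ → ℝ} (hβ : ContDiffOn ℝ (⊤ : ℕ∞) β (Ioi 0))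
    (h0 : ∀ r, r < 1 / 2 → β r = 0) {M : ℝ} (hM : ∀ r, M < r → β r = 0) :
    IsTestFunction fun x : EuclideanSpace ℝ (Fin (n + 1)) => β ‖x‖ where
  smooth := by
    rw [contDiff_iff_contDiffAt]
    intro x
    by_cases hx : ‖x‖ < 1 / 2
    · refine (contDiffAt_const (c := (0 : ℝ))).congr_of_eventuallyEq ?_
      filter_upwards [(isOpen_lt continuous_norm continuous_const).mem_nhds hx] with z hz
      exact h0 _ hz
    · have hpos : 0 < ‖x‖ := by linarith
      exact ((hβ ‖x‖ hpos).contDiffAt (Ioi_mem_nhds hpos)).comp x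
        (contDiffAt_norm ℝ (norm_pos_iff.1 hpos))
  compact := by
    refine HasCompactSupport.intro (isCompact_closedBall 0 M) fun x hx => hM _ ?_
    simpa using hx

/-- Here `β'` stands for the Euler derivative, `r` times the ordinary one. With this normalization
the derivatives of `r^α` are again multiples of `r^α`. -/
theorem gradient_radial {β : ℝ → ℝ} {β' : ℝ} {x : EuclideanSpace ℝ (Fin (n + 1))} (hx : 0 < ‖x‖)
    (hd : HasDerivAt β (β' / ‖x‖) ‖x‖) :
    gradient (fun x : EuclideanSpace ℝ (Fin (n + 1)) => β ‖x‖) x = (β' / ‖x‖ ^ 2) • x := by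
  have h1 : HasFDerivAt (fun z : EuclideanSpace ℝ (Fin (n + 1)) => ‖z‖ ^ 2) (2 • innerSL ℝ x) x :=
    (hasStrictFDerivAt_norm_sq x).hasFDerivAt
  have h2 := h1.sqrt (by positivity)
  simp only [Real.sqrt_sq (norm_nonneg _)] at h2
  have h3 := hd.comp_hasFDerivAt x h2
  refine ext_inner_right ℝ fun e => ?_
  have h4 : fderiv ℝ (fun x : EuclideanSpace ℝ (Fin (n + 1)) => β ‖x‖) x = _ := h3.fderiv
  rw [← fderiv_eq_inner_gradient, h4]
  simp only [_root_.smul_apply, innerSL_apply_apply, smul_eq_mul, nsmul_eq_mul,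
    real_inner_smul_left]
  field_simp
  push_cast
  ring

theorem eulerDeriv_radial {β : ℝ → ℝ} {β' : ℝ} {x : EuclideanSpace ℝ (Fin (n + 1))}
    (hx : 0 < ‖x‖) (hd : HasDerivAt β (β' / ‖x‖) ‖x‖) :
    eulerDeriv (fun x : EuclideanSpace ℝ (Fin (n + 1)) => β ‖x‖) x = β' := by
  rw [eulerDeriv, gradient_radial hx hd, real_inner_smul_left, real_inner_self_eq_norm_sq]
  field_simp

/-- A smooth function equal to `1` on `(-∞, 1]` and to `0` on `[2, ∞)`. -/
noncomputable def cutoffProfile (q : ℝ) : ℝ := Real.smoothTransition (2 - q)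

/-- The Euler derivative of `cutoffProfile`. -/
noncomputable def cutoffProfile₁ (q : ℝ) : ℝ := q * deriv cutoffProfile q

/-- The second Euler derivative of `cutoffProfile`. -/
noncomputable def cutoffProfile₂ (q : ℝ) : ℝ := q * deriv cutoffProfile₁ q

theorem contDiff_cutoffProfile : ContDiff ℝ (⊤ : ℕ∞) cutoffProfile :=
  Real.smoothTransition.contDiff.comp (contDiff_const.sub contDiff_id)

theorem contDiff_cutoffProfile₁ : ContDiff ℝ (⊤ : ℕ∞) cutoffProfile₁ :=
  contDiff_id.mul (contDiff_infty_iff_deriv.1 contDiff_cutoffProfile).2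

theorem contDiff_cutoffProfile₂ : ContDiff ℝ (⊤ : ℕ∞) cutoffProfile₂ :=
  contDiff_id.mul (contDiff_infty_iff_deriv.1 contDiff_cutoffProfile₁).2

theorem cutoffProfile_of_le {q : ℝ} (hq : q ≤ 1) : cutoffProfile q = 1 :=
  Real.smoothTransition.one_of_one_le (by linarith)

theorem cutoffProfile_of_ge {q : ℝ} (hq : 2 ≤ q) : cutoffProfile q = 0 :=
  Real.smoothTransition.zero_of_nonpos (by linarith)

theorem cutoffProfile₁_of_lt {q : ℝ} (hq : q < 1) : cutoffProfile₁ q = 0 := by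
  have : cutoffProfile =ᶠ[𝓝 q] fun _ => 1 := by
    filter_upwards [gt_mem_nhds hq] with z hz using cutoffProfile_of_le (le_of_lt hz)
  rw [cutoffProfile₁, this.deriv_eq]
  simp

theorem cutoffProfile₁_of_gt {q : ℝ} (hq : 2 < q) : cutoffProfile₁ q = 0 := by
  have : cutoffProfile =ᶠ[𝓝 q] fun _ => 0 := by
    filter_upwards [lt_mem_nhds hq] with z hz using cutoffProfile_of_ge (le_of_lt hz)
  rw [cutoffProfile₁, this.deriv_eq]
  simp

theorem cutoffProfile₂_of_lt {q : ℝ} (hq : q < 1) : cutoffProfile₂ q = 0 := by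
  have : cutoffProfile₁ =ᶠ[𝓝 q] fun _ => 0 := by
    filter_upwards [gt_mem_nhds hq] with z hz using cutoffProfile₁_of_lt hz
  rw [cutoffProfile₂, this.deriv_eq]
  simp

theorem cutoffProfile₂_of_gt {q : ℝ} (hq : 2 < q) : cutoffProfile₂ q = 0 := by
  have : cutoffProfile₁ =ᶠ[𝓝 q] fun _ => 0 := by
    filter_upwards [lt_mem_nhds hq] with z hz using cutoffProfile₁_of_gt hz
  rw [cutoffProfile₂, this.deriv_eq]
  simp

theorem exists_cutoffProfile_bound : ∃ K : ℝ, 1 ≤ K ∧ ∀ q, |cutoffProfile q| ≤ K ∧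
    |cutoffProfile₁ q| ≤ K ∧ |cutoffProfile₂ q| ≤ K := by
  have h : ∀ f : ℝ → ℝ, Continuous f → (∀ q < 1, f q = 0) → (∀ q, 2 < q → f q = 0) →
      ∃ K, ∀ q, |f q| ≤ K := by
    intro f hf h1 h2
    refine HasCompactSupport.exists_bound_of_continuous (f := f)
      (HasCompactSupport.intro (isCompact_Icc (a := 1) (b := 2)) fun q hq => ?_) hf
    by_cases h3 : q < 1
    · exact h1 q h3
    · exact h2 q (not_le.1 fun h4 => hq ⟨not_lt.1 h3, h4⟩)
  obtain ⟨K₁, h₁⟩ := h _ contDiff_cutoffProfile₁.continuous (fun _ => cutoffProfile₁_of_lt)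
    fun _ => cutoffProfile₁_of_gt
  obtain ⟨K₂, h₂⟩ := h _ contDiff_cutoffProfile₂.continuous (fun _ => cutoffProfile₂_of_lt)
    fun _ => cutoffProfile₂_of_gt
  refine ⟨max 1 (max K₁ K₂), le_max_left _ _, fun q => ⟨le_trans ?_ (le_max_left _ _),
    (h₁ q).trans ((le_max_left _ _).trans (le_max_right _ _)),
    (h₂ q).trans ((le_max_right _ _).trans (le_max_right _ _))⟩⟩
  rw [cutoffProfile, abs_of_nonneg (Real.smoothTransition.nonneg _)]
  exact Real.smoothTransition.le_one _

/-- Cutoffs away from the origin and from infinity. -/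
noncomputable def cutoff (j : ℕ) (r : ℝ) : ℝ :=
  Real.smoothTransition (4 * r - 2) * cutoffProfile (scale j * r)

/-- The Euler derivative of the cutoffs, outside the unit ball. -/
noncomputable def cutoff₁ (j : ℕ) (r : ℝ) : ℝ := cutoffProfile₁ (scale j * r)

/-- The second Euler derivative of the cutoffs, outside the unit ball. -/
noncomputable def cutoff₂ (j : ℕ) (r : ℝ) : ℝ := cutoffProfile₂ (scale j * r)

theorem contDiff_cutoff (j : ℕ) : ContDiff ℝ (⊤ : ℕ∞) (cutoff j) :=
  (Real.smoothTransition.contDiff.comp ((contDiff_const.mul contDiff_id).sub contDiff_const)).mul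
    (contDiff_cutoffProfile.comp (contDiff_const.mul contDiff_id))

theorem contDiff_cutoff₁ (j : ℕ) : ContDiff ℝ (⊤ : ℕ∞) (cutoff₁ j) :=
  contDiff_cutoffProfile₁.comp (contDiff_const.mul contDiff_id)

theorem contDiff_cutoff₂ (j : ℕ) : ContDiff ℝ (⊤ : ℕ∞) (cutoff₂ j) :=
  contDiff_cutoffProfile₂.comp (contDiff_const.mul contDiff_id)

theorem hasDerivAt_cutoff (j : ℕ) {r : ℝ} (hr : 1 ≤ r) :
    HasDerivAt (cutoff j) (cutoff₁ j r / r) r := by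
  have h1 : HasDerivAt (fun r => cutoffProfile (scale j * r))
      (deriv cutoffProfile (scale j * r) * (scale j * 1)) r :=
    HasDerivAt.comp (h := fun r => scale j * r) r
      (contDiff_cutoffProfile.differentiable (by simp) _).hasDerivAt
      ((hasDerivAt_id r).const_mul (scale j))
  -- The inner transition is already equal to `1` from radius `3/4` on, so only the outer factor
  -- contributes outside the unit ball.
  have h2 : cutoff j =ᶠ[𝓝 r] fun r => cutoffProfile (scale j * r) := by
    filter_upwards [lt_mem_nhds (show 3 / 4 < r by linarith)] with z hz
    rw [cutoff, Real.smoothTransition.one_of_one_le (by linarith), one_mul]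
  refine (h1.congr_of_eventuallyEq h2).congr_deriv ?_
  rw [cutoff₁, cutoffProfile₁]
  field_simp

theorem hasDerivAt_cutoff₁ (j : ℕ) {r : ℝ} (hr : 1 ≤ r) :
    HasDerivAt (cutoff₁ j) (cutoff₂ j r / r) r := by
  have h1 : HasDerivAt (fun r => cutoffProfile₁ (scale j * r))
      (deriv cutoffProfile₁ (scale j * r) * (scale j * 1)) r :=
    HasDerivAt.comp (h := fun r => scale j * r) r
      (contDiff_cutoffProfile₁.differentiable (by simp) _).hasDerivAt
      ((hasDerivAt_id r).const_mul (scale j))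
  refine h1.congr_deriv ?_
  rw [cutoff₂, cutoffProfile₂]
  field_simp

theorem cutoff_of_lt (j : ℕ) {r : ℝ} (hr : r < 1 / 2) : cutoff j r = 0 := by
  rw [cutoff, Real.smoothTransition.zero_of_nonpos (by linarith), zero_mul]

theorem cutoff₁_of_lt (j : ℕ) {r : ℝ} (hr : r < 1 / 2) : cutoff₁ j r = 0 := by
  refine cutoffProfile₁_of_lt ?_
  have h1 := scale_pos j
  have h2 := scale_le_one j
  nlinarith

theorem two_lt_scale_mul {j : ℕ} {r : ℝ} (hr : 2 / scale j < r) : 2 < scale j * r := by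
  rwa [div_lt_iff₀' (scale_pos j)] at hr

theorem cutoff_of_gt {j : ℕ} {r : ℝ} (hr : 2 / scale j < r) : cutoff j r = 0 := by
  rw [cutoff, cutoffProfile_of_ge (two_lt_scale_mul hr).le, mul_zero]

theorem cutoff₁_of_gt {j : ℕ} {r : ℝ} (hr : 2 / scale j < r) : cutoff₁ j r = 0 :=
  cutoffProfile₁_of_gt (two_lt_scale_mul hr)

/-- The bound is uniform in `j` because Euler derivatives are invariant under rescaling, so all
cutoffs inherit the constant of one profile. -/
theorem exists_cutoff_bound : ∃ K : ℝ, ∀ j r, |cutoff j r| ≤ K ∧ |cutoff₁ j r| ≤ K ∧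
    |cutoff₂ j r| ≤ K := by
  obtain ⟨K, hK1, hK⟩ := exists_cutoffProfile_bound
  refine ⟨K, fun j r => ⟨?_, (hK _).2⟩⟩
  rw [cutoff, abs_mul]
  calc _ ≤ 1 * K := by
        gcongr
        · rw [abs_of_nonneg (Real.smoothTransition.nonneg _)]
          exact Real.smoothTransition.le_one _
        · exact (hK _).1
    _ = K := one_mul K

theorem eventually_scale_mul_lt (r : ℝ) : ∀ᶠ j in atTop, scale j * r < 1 := by
  have := tendsto_scale.mul_const r
  rw [zero_mul] at this
  exact this.eventually (gt_mem_nhds one_pos)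

theorem tendsto_cutoff {r : ℝ} (hr : 1 ≤ r) : Tendsto (fun j => cutoff j r) atTop (𝓝 1) := by
  refine tendsto_const_nhds.congr' ?_
  filter_upwards [eventually_scale_mul_lt r] with j hj
  rw [cutoff, cutoffProfile_of_le hj.le, Real.smoothTransition.one_of_one_le (by linarith), one_mul]

theorem tendsto_cutoff₁ (r : ℝ) : Tendsto (fun j => cutoff₁ j r) atTop (𝓝 0) := by
  refine tendsto_const_nhds.congr' ?_
  filter_upwards [eventually_scale_mul_lt r] with j hj
  rw [cutoff₁, cutoffProfile₁_of_lt hj]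

theorem tendsto_cutoff₂ (r : ℝ) : Tendsto (fun j => cutoff₂ j r) atTop (𝓝 0) := by
  refine tendsto_const_nhds.congr' ?_
  filter_upwards [eventually_scale_mul_lt r] with j hj
  rw [cutoff₂, cutoffProfile₂_of_lt hj]

end Radial

/-! ### The Carleman multipliers and the algebraic identity -/

section Profiles

/-- The weight of the multiplier for the radial derivative. -/
noncomputable def profile₁ (α τ : ℝ) (j : ℕ) (r : ℝ) : ℝ :=
  Real.exp (2 * τ * r ^ α) * (cutoff j r * (α * r ^ α))

/-- The weight of the multiplier for the function itself. -/
noncomputable def profile₂ (α τ κ : ℝ) (j : ℕ) (r : ℝ) : ℝ :=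
  Real.exp (2 * τ * r ^ α) *
    (cutoff j r * (α * r ^ α * (κ + τ * (α * r ^ α)) + α ^ 2 * r ^ α))

/-- The weight in the integration by parts of mixed terms. -/
noncomputable def profile₃ (α τ κ : ℝ) (j : ℕ) (r : ℝ) : ℝ :=
  Real.exp (2 * τ * r ^ α) *
    (cutoff j r * (-2 * τ * α ^ 2 * (r ^ α) ^ 2 * (κ + τ * (α * r ^ α)) - 2 * κ * α ^ 2 * r ^ α
      + τ * α ^ 3 * (r ^ α) ^ 2 + α ^ 3 * r ^ α) + cutoff₁ j r * (α ^ 2 * r ^ α)) / r ^ 2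

variable {α τ κ : ℝ} {j : ℕ}

theorem contDiffOn_rpow (α : ℝ) : ContDiffOn ℝ (⊤ : ℕ∞) (fun r : ℝ => r ^ α) (Ioi 0) :=
  fun _ hr => (Real.contDiffAt_rpow_const_of_ne (ne_of_gt hr)).contDiffWithinAt

theorem contDiffOn_exp_rpow (α τ : ℝ) :
    ContDiffOn ℝ (⊤ : ℕ∞) (fun r : ℝ => Real.exp (2 * τ * r ^ α)) (Ioi 0) :=
  (contDiffOn_const.mul (contDiffOn_rpow α)).exp

theorem isTestFunction_profile₁ (n : ℕ) (α τ : ℝ) (j : ℕ) :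
    IsTestFunction fun x : EuclideanSpace ℝ (Fin (n + 1)) => profile₁ α τ j ‖x‖ := by
  refine isTestFunction_radial (M := 2 / scale j) ?_ (fun r hr => ?_) fun r hr => ?_
  · exact (contDiffOn_exp_rpow α τ).mul ((contDiff_cutoff j).contDiffOn.mul
      (contDiffOn_const.mul (contDiffOn_rpow α)))
  · simp [profile₁, cutoff_of_lt j hr]
  · simp [profile₁, cutoff_of_gt hr]

theorem isTestFunction_profile₂ (n : ℕ) (α τ κ : ℝ) (j : ℕ) :
    IsTestFunction fun x : EuclideanSpace ℝ (Fin (n + 1)) => profile₂ α τ κ j ‖x‖ := by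
  refine isTestFunction_radial (M := 2 / scale j) ?_ (fun r hr => ?_) fun r hr => ?_
  · have hp := contDiffOn_rpow α
    exact (contDiffOn_exp_rpow α τ).mul ((contDiff_cutoff j).contDiffOn.mul
      (((contDiffOn_const.mul hp).mul (contDiffOn_const.add
        (contDiffOn_const.mul (contDiffOn_const.mul hp)))).add (contDiffOn_const.mul hp)))
  · simp [profile₂, cutoff_of_lt j hr]
  · simp [profile₂, cutoff_of_gt hr]

theorem isTestFunction_profile₃ (n : ℕ) (α τ κ : ℝ) (j : ℕ) :
    IsTestFunction fun x : EuclideanSpace ℝ (Fin (n + 1)) => profile₃ α τ κ j ‖x‖ := by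
  refine isTestFunction_radial (M := 2 / scale j) ?_ (fun r hr => ?_) fun r hr => ?_
  · have hp := contDiffOn_rpow α
    have hA : ContDiffOn ℝ (⊤ : ℕ∞) (fun r : ℝ => -2 * τ * α ^ 2 * (r ^ α) ^ 2 *
        (κ + τ * (α * r ^ α)) - 2 * κ * α ^ 2 * r ^ α
        + τ * α ^ 3 * (r ^ α) ^ 2 + α ^ 3 * r ^ α) (Ioi 0) :=
      (((((contDiffOn_const.mul (hp.pow 2)).mul (contDiffOn_const.add
        (contDiffOn_const.mul (contDiffOn_const.mul hp)))).sub (contDiffOn_const.mul hp)).add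
        (contDiffOn_const.mul (hp.pow 2))).add (contDiffOn_const.mul hp))
    exact ((contDiffOn_exp_rpow α τ).mul (((contDiff_cutoff j).contDiffOn.mul hA).add
      ((contDiff_cutoff₁ j).contDiffOn.mul (contDiffOn_const.mul hp)))).div
      (contDiff_id.pow 2).contDiffOn fun r hr => pow_ne_zero 2 (ne_of_gt hr)
  · simp [profile₃, cutoff_of_lt j hr, cutoff₁_of_lt j hr]
  · simp [profile₃, cutoff_of_gt hr, cutoff₁_of_gt hr]

theorem hasDerivAt_rpow_euler (α : ℝ) {r : ℝ} (hr : 0 < r) :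
    HasDerivAt (fun r : ℝ => r ^ α) (α * r ^ α / r) r := by
  refine (Real.hasDerivAt_rpow_const (Or.inl hr.ne')).congr_deriv ?_
  rw [Real.rpow_sub_one hr.ne']
  ring

theorem hasDerivAt_exp_rpow_euler (α τ : ℝ) {r : ℝ} (hr : 0 < r) :
    HasDerivAt (fun r : ℝ => Real.exp (2 * τ * r ^ α))
      (Real.exp (2 * τ * r ^ α) * (2 * τ * (α * r ^ α / r))) r :=
  ((hasDerivAt_rpow_euler α hr).const_mul (2 * τ)).exp

/-- The Euler derivative of `profile₁`. -/
noncomputable def profile₁' (α τ : ℝ) (j : ℕ) (r : ℝ) : ℝ :=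
  Real.exp (2 * τ * r ^ α) * (2 * τ * α * r ^ α * (cutoff j r * (α * r ^ α))
    + cutoff₁ j r * (α * r ^ α) + cutoff j r * (α ^ 2 * r ^ α))

/-- The Euler derivative of `profile₂`. -/
noncomputable def profile₂' (α τ κ : ℝ) (j : ℕ) (r : ℝ) : ℝ :=
  Real.exp (2 * τ * r ^ α) *
    ((2 * τ * α * r ^ α * cutoff j r + cutoff₁ j r) *
      (α * r ^ α * (κ + τ * (α * r ^ α)) + α ^ 2 * r ^ α)
    + cutoff j r * (α ^ 2 * r ^ α * κ + 2 * τ * α ^ 3 * (r ^ α) ^ 2 + α ^ 3 * r ^ α))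

/-- The Euler derivative of `profile₃`. -/
noncomputable def profile₃' (α τ κ : ℝ) (j : ℕ) (r : ℝ) : ℝ :=
  Real.exp (2 * τ * r ^ α) / r ^ 2 *
    ((2 * τ * α * r ^ α - 2) *
      (cutoff j r * (-2 * τ * α ^ 2 * (r ^ α) ^ 2 * (κ + τ * (α * r ^ α)) - 2 * κ * α ^ 2 * r ^ α
      + τ * α ^ 3 * (r ^ α) ^ 2 + α ^ 3 * r ^ α) + cutoff₁ j r * (α ^ 2 * r ^ α))
    + cutoff₁ j r * (-2 * τ * α ^ 2 * (r ^ α) ^ 2 * (κ + τ * (α * r ^ α)) - 2 * κ * α ^ 2 * r ^ α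
      + τ * α ^ 3 * (r ^ α) ^ 2 + α ^ 3 * r ^ α)
    + cutoff j r * (-4 * τ * α ^ 3 * κ * (r ^ α) ^ 2 - 6 * τ ^ 2 * α ^ 4 * (r ^ α) ^ 3
      - 2 * κ * α ^ 3 * r ^ α + 2 * τ * α ^ 4 * (r ^ α) ^ 2 + α ^ 4 * r ^ α)
    + cutoff₂ j r * (α ^ 2 * r ^ α) + cutoff₁ j r * (α ^ 3 * r ^ α))

theorem hasDerivAt_profile₁ {r : ℝ} (hr : 1 ≤ r) :
    HasDerivAt (profile₁ α τ j) (profile₁' α τ j r / r) r := by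
  have hr0 : 0 < r := by linarith
  refine ((hasDerivAt_exp_rpow_euler α τ hr0).mul ((hasDerivAt_cutoff j hr).mul
    ((hasDerivAt_rpow_euler α hr0).const_mul α))).congr_deriv ?_
  simp only [profile₁', Pi.mul_apply]
  field_simp
  ring

theorem hasDerivAt_profile₂ {r : ℝ} (hr : 1 ≤ r) :
    HasDerivAt (profile₂ α τ κ j) (profile₂' α τ κ j r / r) r := by
  have hr0 : 0 < r := by linarith
  have hp := hasDerivAt_rpow_euler α hr0
  refine ((hasDerivAt_exp_rpow_euler α τ hr0).mul ((hasDerivAt_cutoff j hr).mul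
    (((hp.const_mul α).mul (((hp.const_mul α).const_mul τ).const_add κ)).add
      (hp.const_mul (α ^ 2))))).congr_deriv ?_
  simp only [profile₂', Pi.mul_apply, Pi.add_apply]
  field_simp
  ring

theorem hasDerivAt_profile₃ {r : ℝ} (hr : 1 ≤ r) :
    HasDerivAt (profile₃ α τ κ j) (profile₃' α τ κ j r / r) r := by
  have hr0 : 0 < r := by linarith
  have hp := hasDerivAt_rpow_euler α hr0
  have hA := (((((hp.pow 2).const_mul (-2 * τ * α ^ 2)).mul
    (((hp.const_mul α).const_mul τ).const_add κ)).sub (hp.const_mul (2 * κ * α ^ 2))).add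
    ((hp.pow 2).const_mul (τ * α ^ 3))).add (hp.const_mul (α ^ 3))
  refine (((hasDerivAt_exp_rpow_euler α τ hr0).mul (((hasDerivAt_cutoff j hr).mul hA).add
    ((hasDerivAt_cutoff₁ j hr).mul (hp.const_mul (α ^ 2))))).div ((hasDerivAt_id r).pow 2)
    (pow_ne_zero 2 hr0.ne')).congr_deriv ?_
  simp only [profile₃', Pi.mul_apply, Pi.add_apply, Pi.sub_apply, Pi.pow_apply, id_eq]
  field_simp
  ring

/-- The principal density of the Carleman identity, in terms of `r = |x|`, `u`, `D = x · ∇u` and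
`g = |∇u|²`. -/
noncomputable def bulk (α τ κ r u D g : ℝ) : ℝ :=
  Real.exp (2 * τ * r ^ α) / r ^ 2 *
    ((3 / 2 * α ^ 2 * r ^ α + 2 * τ * α ^ 2 * (r ^ α) ^ 2) * (D + (κ + τ * (α * r ^ α)) * u) ^ 2
    + α ^ 2 * r ^ α / 2 * (r ^ 2 * g - D ^ 2)
    + (κ ^ 2 * α ^ 2 * r ^ α / 2 + τ ^ 2 * α ^ 4 * (r ^ α) ^ 3 / 2 - 2 * τ * α ^ 4 * (r ^ α) ^ 2
      - α ^ 4 * r ^ α / 2) * u ^ 2)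

/-- The density multiplying the first Euler derivative of the cutoff. -/
noncomputable def bulk₁ (α τ κ r u D g : ℝ) : ℝ :=
  Real.exp (2 * τ * r ^ α) / r ^ 2 *
    (α * r ^ α / 2 * (D + (κ + τ * (α * r ^ α)) * u) ^ 2 - α * r ^ α / 2 * (r ^ 2 * g - D ^ 2)
    + (-(κ ^ 2 * α * r ^ α / 2) + τ ^ 2 * α ^ 3 * (r ^ α) ^ 3 / 2
      - 3 / 2 * τ * α ^ 3 * (r ^ α) ^ 2 - α ^ 3 * r ^ α) * u ^ 2)

/-- The density multiplying the second Euler derivative of the cutoff. -/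
noncomputable def bulk₂ (α τ r u : ℝ) : ℝ :=
  Real.exp (2 * τ * r ^ α) / r ^ 2 * (-(α ^ 2 * r ^ α / 2) * u ^ 2)

/-- The left side collects the integrands of the virial identity with `profile₁`, of the energy
identity with `profile₂`, and of the mass identity with `profile₃`, which integrates to zero. The
last weight is `profile₂' / r ^ 2` minus the coefficient of `u D` that is needed to complete the
squares of `D + (κ + ταp) u`. For fixed `r`, `r ^ α` and the exponential behave as independent
variables, so the identity is polynomial. -/
theorem bulk_identity {r : ℝ} (hr : 0 < r) (u D g : ℝ) :
    ((2 - (2 * κ + 2)) * profile₁ α τ j r - profile₁' α τ j r) / 2 * g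
      + profile₁' α τ j r / r ^ 2 * D * D + profile₂ α τ κ j r * g
      + profile₂' α τ κ j r / r ^ 2 * D * u - profile₃ α τ κ j r * u * D
      + (-(2 * κ + 2) * profile₃ α τ κ j r - profile₃' α τ κ j r) / 2 * u ^ 2
    = cutoff j r * bulk α τ κ r u D g + cutoff₁ j r * bulk₁ α τ κ r u D g
      + cutoff₂ j r * bulk₂ α τ r u := by
  simp only [profile₁, profile₁', profile₂, profile₂', profile₃, profile₃', bulk, bulk₁, bulk₂]
  generalize r ^ α = p
  generalize Real.exp (2 * τ * p) = w
  field_simp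
  ring

end Profiles

/-! ### The Carleman identity with cutoffs -/

section Identity

variable {n : ℕ} {a : ℝ} {u F : EuclideanSpace ℝ (Fin (n + 1)) → ℝ}
  {G : EuclideanSpace ℝ (Fin (n + 1)) → EuclideanSpace ℝ (Fin (n + 1))}
  {u₀ V Z : EuclideanSpace ℝ (Fin n) → ℝ} {α τ κ : ℝ}

theorem integral_add_six {Ω : Type*} [MeasurableSpace Ω] {μ : Measure Ω}
    {f₁ f₂ f₃ f₄ f₅ f₆ : Ω → ℝ} (h₁ : Integrable f₁ μ) (h₂ : Integrable f₂ μ)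
    (h₃ : Integrable f₃ μ) (h₄ : Integrable f₄ μ) (h₅ : Integrable f₅ μ) (h₆ : Integrable f₆ μ) :
    ∫ x, (f₁ x + f₂ x + f₃ x + f₄ x - f₅ x + f₆ x) ∂μ
    = ∫ x, f₁ x ∂μ + ∫ x, f₂ x ∂μ + ∫ x, f₃ x ∂μ + ∫ x, f₄ x ∂μ - ∫ x, f₅ x ∂μ
      + ∫ x, f₆ x ∂μ := by
  have k₂ : Integrable (fun x => f₁ x + f₂ x) μ := h₁.add h₂
  have k₃ : Integrable (fun x => f₁ x + f₂ x + f₃ x) μ := k₂.add h₃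
  have k₄ : Integrable (fun x => f₁ x + f₂ x + f₃ x + f₄ x) μ := k₃.add h₄
  have k₅ : Integrable (fun x => f₁ x + f₂ x + f₃ x + f₄ x - f₅ x) μ := k₄.sub h₅
  rw [integral_add k₅ h₆, integral_sub k₄ h₅, integral_add k₃ h₄, integral_add k₂ h₃,
    integral_add h₁ h₂]

theorem integrable_bdd_mul_norm_sq {Ω H : Type*} [MeasurableSpace Ω] {μ : Measure Ω}
    [NormedAddCommGroup H] {w : Ω → H} (hw : MemLp w 2 μ) {c : Ω → ℝ} {K : ℝ}
    (hc : AEStronglyMeasurable c μ) (hK : ∀ x, |c x| ≤ K) :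
    Integrable (fun x => c x * ‖w x‖ ^ 2) μ := by
  refine Integrable.bdd_mul ?_ hc (ae_of_all _ hK)
  exact hw.integrable_norm_pow (by norm_num)

theorem WeakSolution.integrable_mul_inner (hw : WeakSolution a u G u₀ F V Z)
    {g : EuclideanSpace ℝ (Fin (n + 1)) → ℝ} (hg : MemLp g 2 (wVol n a)) {R : ℝ}
    (hR : ∀ x, R < ‖x‖ → g x = 0) : Integrable (fun x => g x * inner ℝ x (G x)) (wVol n a) := by
  have hgx : MemLp (fun x => g x • x) 2 (wVol n a) := by
    refine MemLp.of_le_mul (c := |R|) hg (hg.1.smul continuous_id.aestronglyMeasurable)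
      (ae_of_all _ fun x => ?_)
    rw [norm_smul, mul_comm]
    by_cases hx : R < ‖x‖
    · simp [hR x hx]
    · gcongr
      exact (not_lt.1 hx).trans (le_abs_self R)
  refine (integrable_inner hgx hw.memLp_grad).congr (ae_of_all _ fun x => ?_)
  simp only [real_inner_smul_left]

/-- Vanishing of a weak solution in the unit ball. -/
structure VanishesInBall (a : ℝ) (u : EuclideanSpace ℝ (Fin (n + 1)) → ℝ)
    (G : EuclideanSpace ℝ (Fin (n + 1)) → EuclideanSpace ℝ (Fin (n + 1)))
    (u₀ : EuclideanSpace ℝ (Fin n) → ℝ) : Prop where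
  trace : ∀ᵐ x', ‖x'‖ < 1 → u₀ x' = 0
  fn : ∀ᵐ x ∂(wVol n a), ‖x‖ < 1 → u x = 0
  grad : ∀ᵐ x ∂(wVol n a), ‖x‖ < 1 → G x = 0

/-- The density of the source term in the Carleman identity. -/
noncomputable def source (α τ κ r u D F : ℝ) : ℝ :=
  -(Real.exp (2 * τ * r ^ α) * F *
    (α * r ^ α * (D + (κ + τ * (α * r ^ α)) * u) + α ^ 2 * r ^ α * u))

/-- The principal density of the boundary term in the Carleman identity. -/
noncomputable def bdryDensity (a α τ r u V Z : ℝ) : ℝ :=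
  Real.exp (2 * τ * r ^ α) * (α * r ^ α * ((1 - a) / 2 * V + Z / 2 - α / 2 * V)) * u ^ 2

/-- The density of the boundary term multiplying the Euler derivative of the cutoff. -/
noncomputable def bdryDensity₁ (α τ r u V : ℝ) : ℝ :=
  Real.exp (2 * τ * r ^ α) * (α * r ^ α / 2 * V) * u ^ 2

/-- The sum of the virial and energy identities, with the mass identity added as a null term. On the
boundary, half the Euler derivative of `profile₁` and the weight `profile₂` both contain `τ (αp)²`,
with opposite signs, and what remains is of order `p`. Inside the unit ball both sides vanish, so
the inner transition of the cutoff leaves no trace. -/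
theorem WeakSolution.cutoff_identity (hw : WeakSolution a u G u₀ F V Z)
    (hv : VanishesInBall a u G u₀) (hκ : 2 * κ + 2 = (n : ℝ) + 1 + a) (α τ : ℝ) (j : ℕ) :
    ∫ x, (cutoff j ‖x‖ * bulk α τ κ ‖x‖ (u x) (inner ℝ x (G x)) (‖G x‖ ^ 2)
      + cutoff₁ j ‖x‖ * bulk₁ α τ κ ‖x‖ (u x) (inner ℝ x (G x)) (‖G x‖ ^ 2)
      + cutoff₂ j ‖x‖ * bulk₂ α τ ‖x‖ (u x)) ∂(wVol n a)
    = ∫ x, cutoff j ‖x‖ * source α τ κ ‖x‖ (u x) (inner ℝ x (G x)) (F x) ∂(wVol n a)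
      + ∫ x', (cutoff j ‖x'‖ * bdryDensity a α τ ‖x'‖ (u₀ x') (V x') (Z x')
        + cutoff₁ j ‖x'‖ * bdryDensity₁ α τ ‖x'‖ (u₀ x') (V x')) := by
  set ρ₁ : EuclideanSpace ℝ (Fin (n + 1)) → ℝ := fun x => profile₁ α τ j ‖x‖ with hρ₁
  set ρ₂ : EuclideanSpace ℝ (Fin (n + 1)) → ℝ := fun x => profile₂ α τ κ j ‖x‖ with hρ₂
  set ζ : EuclideanSpace ℝ (Fin (n + 1)) → ℝ := fun x => profile₃ α τ κ j ‖x‖ with hζ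
  have t1 : IsTestFunction ρ₁ := isTestFunction_profile₁ n α τ j
  have t2 : IsTestFunction ρ₂ := isTestFunction_profile₂ n α τ κ j
  have t3 : IsTestFunction ζ := isTestFunction_profile₃ n α τ κ j
  have e1 := hw.virial_identity t1
  have e2 := hw.energy_identity t2
  have e3 := hw.mass_identity t3
  rw [← hκ] at e1 e3
  have bnd : ∀ {ρ : EuclideanSpace ℝ (Fin (n + 1)) → ℝ}, IsTestFunction ρ → ∀ A : ℝ,
      ∃ K, ∀ x, |(A * ρ x - eulerDeriv ρ x) / 2| ≤ K := by
    intro ρ hρ A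
    obtain ⟨K, hK⟩ := hρ.radiallyC1.bounded
    refine ⟨(|A| * K + K) / 2, fun x => ?_⟩
    rw [abs_div, abs_two]
    gcongr
    refine (abs_sub _ _).trans (add_le_add ?_ (hK x).2)
    rw [abs_mul]
    gcongr
    exact (hK x).1
  have meas : ∀ {ρ : EuclideanSpace ℝ (Fin (n + 1)) → ℝ}, IsTestFunction ρ → ∀ A : ℝ,
      AEStronglyMeasurable (fun x => (A * ρ x - eulerDeriv ρ x) / 2) (wVol n a) := by
    intro ρ hρ A
    have h1 := hρ.radiallyC1.measurable
    have h2 := hρ.smooth.continuous.measurable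
    exact (show Measurable _ by fun_prop).aestronglyMeasurable
  have i1 : Integrable (fun x => ((2 - (2 * κ + 2)) * ρ₁ x - eulerDeriv ρ₁ x) / 2 * ‖G x‖ ^ 2)
      (wVol n a) :=
    integrable_bdd_mul_norm_sq hw.memLp_grad (meas t1 _) (bnd t1 _).choose_spec
  have i2 : Integrable (fun x => inner ℝ (gradient ρ₁ x) (G x) * inner ℝ x (G x)) (wVol n a) := by
    obtain ⟨K', R', hK', hR'⟩ := t1.gradient_bounds
    exact hw.integrable_mul_inner (hw.memLp_inner_gradient t1) (R := R')
      fun x hx => by simp [hR' x hx]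
  obtain ⟨K₁, R₁, hK₁, hR₁⟩ := isTestFunction_bounds t1.smooth.continuous t1.compact
  obtain ⟨K₂, R₂, hK₂, hR₂⟩ := isTestFunction_bounds t2.smooth.continuous t2.compact
  obtain ⟨K₃, R₃, hK₃, hR₃⟩ := isTestFunction_bounds t3.smooth.continuous t3.compact
  have m1 := t1.smooth.continuous.aestronglyMeasurable (μ := wVol n a)
  have m2 := t2.smooth.continuous.aestronglyMeasurable (μ := wVol n a)
  have m3 := t3.smooth.continuous.aestronglyMeasurable (μ := wVol n a)
  have i3 : Integrable (fun x => ρ₂ x * ‖G x‖ ^ 2) (wVol n a) :=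
    integrable_bdd_mul_norm_sq hw.memLp_grad m2 hK₂
  have i4 : Integrable (fun x => inner ℝ (gradient ρ₂ x) (G x) * u x) (wVol n a) :=
    integrable_mul (hw.memLp_inner_gradient t2) hw.memLp
  have i5 : Integrable (fun x => ζ x * u x * inner ℝ x (G x)) (wVol n a) :=
    hw.integrable_mul_inner (memLp_bdd_smul m3 (ae_of_all _ hK₃) hw.memLp) (R := R₃)
      fun x hx => by simp [hR₃ x hx]
  have i6 : Integrable (fun x => (-(2 * κ + 2) * ζ x - eulerDeriv ζ x) / 2 * u x ^ 2)
      (wVol n a) := by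
    have := integrable_bdd_mul_norm_sq hw.memLp (meas t3 (-(2 * κ + 2))) (bnd t3 _).choose_spec
    simpa using this
  have g1 : MemLp (fun x => F x * ρ₁ x) 2 (wVol n a) := by
    simpa [mul_comm] using memLp_bdd_smul m1 (ae_of_all _ hK₁) hw.memLp_source
  have g2 : MemLp (fun x => F x * ρ₂ x) 2 (wVol n a) := by
    simpa [mul_comm] using memLp_bdd_smul m2 (ae_of_all _ hK₂) hw.memLp_source
  have i7 : Integrable (fun x => F x * ρ₁ x * inner ℝ x (G x)) (wVol n a) :=
    hw.integrable_mul_inner g1 (R := R₁) fun x hx => by simp [hR₁ x hx]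
  have i8 : Integrable (fun x => F x * ρ₂ x * u x) (wVol n a) := integrable_mul g2 hw.memLp
  obtain ⟨L₁, hL₁⟩ := (hw.radiallyC1_mul t1).bounded
  obtain ⟨L₂, hL₂⟩ := (hw.radiallyC1_mul t2).bounded
  have b1 : Integrable (fun x' => (-(n : ℝ) * (V x' * ρ₁ (bdry x'))
      - (Z x' * ρ₁ (bdry x') + V x' * eulerDeriv ρ₁ (bdry x'))) / 2 * u₀ x' ^ 2) volume := by
    have h1 := (hw.radiallyC1_mul t1).continuous.measurable
    have h2 := (hw.radiallyC1_mul t1).measurable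
    have := integrable_bdd_mul_norm_sq hw.memLp_trace
      (c := fun x' => (-(n : ℝ) * (V x' * ρ₁ (bdry x'))
      - (Z x' * ρ₁ (bdry x') + V x' * eulerDeriv ρ₁ (bdry x'))) / 2) (K := (n * L₁ + L₁) / 2)
      (((h1.const_mul _).sub h2).div_const 2).aestronglyMeasurable (fun x' => by
        rw [abs_div, abs_two]
        gcongr
        refine (abs_sub _ _).trans (add_le_add ?_ (hL₁ x').2)
        rw [abs_mul, abs_neg, Nat.abs_cast]
        gcongr
        exact (hL₁ x').1)
    simpa using this
  have b2 : Integrable (fun x' => V x' * ρ₂ (bdry x') * u₀ x' ^ 2) volume := by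
    have := integrable_bdd_mul_norm_sq hw.memLp_trace
      (hw.radiallyC1_mul t2).continuous.aestronglyMeasurable fun x' => (hL₂ x').1
    simpa using this
  have hbulk : ∫ x, (cutoff j ‖x‖ * bulk α τ κ ‖x‖ (u x) (inner ℝ x (G x)) (‖G x‖ ^ 2)
      + cutoff₁ j ‖x‖ * bulk₁ α τ κ ‖x‖ (u x) (inner ℝ x (G x)) (‖G x‖ ^ 2)
      + cutoff₂ j ‖x‖ * bulk₂ α τ ‖x‖ (u x)) ∂(wVol n a)
      = ∫ x, (((2 - (2 * κ + 2)) * ρ₁ x - eulerDeriv ρ₁ x) / 2 * ‖G x‖ ^ 2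
        + inner ℝ (gradient ρ₁ x) (G x) * inner ℝ x (G x) + ρ₂ x * ‖G x‖ ^ 2
        + inner ℝ (gradient ρ₂ x) (G x) * u x - ζ x * u x * inner ℝ x (G x)
        + (-(2 * κ + 2) * ζ x - eulerDeriv ζ x) / 2 * u x ^ 2) ∂(wVol n a) := by
    refine integral_congr_ae ?_
    filter_upwards [hv.fn, hv.grad] with x h1 h2
    by_cases hx : ‖x‖ < 1
    · simp [h1 hx, h2 hx, bulk, bulk₁, bulk₂]
    · rw [not_lt] at hx
      have hx0 : 0 < ‖x‖ := by linarith
      rw [← bulk_identity hx0, hρ₁, hρ₂, hζ, eulerDeriv_radial hx0 (hasDerivAt_profile₁ hx),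
        eulerDeriv_radial hx0 (hasDerivAt_profile₃ hx), gradient_radial hx0
        (hasDerivAt_profile₁ hx), gradient_radial hx0 (hasDerivAt_profile₂ hx)]
      simp only [real_inner_smul_left]
  rw [hbulk, integral_add_six i1 i2 i3 i4 i5 i6, ← e3]
  have hsrc : ∫ x, cutoff j ‖x‖ * source α τ κ ‖x‖ (u x) (inner ℝ x (G x)) (F x) ∂(wVol n a)
      = - ∫ x, F x * ρ₁ x * inner ℝ x (G x) ∂(wVol n a)
        - ∫ x, F x * ρ₂ x * u x ∂(wVol n a) := by
    have k : Integrable (fun x => -(F x * ρ₁ x * inner ℝ x (G x))) (wVol n a) := i7.neg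
    rw [← integral_neg, ← integral_sub k i8]
    refine integral_congr_ae (ae_of_all _ fun x => ?_)
    simp only [hρ₁, hρ₂, profile₁, profile₂, source]
    ring
  have hbd : ∫ x', (cutoff j ‖x'‖ * bdryDensity a α τ ‖x'‖ (u₀ x') (V x') (Z x')
        + cutoff₁ j ‖x'‖ * bdryDensity₁ α τ ‖x'‖ (u₀ x') (V x'))
      = - (∫ x', (-(n : ℝ) * (V x' * ρ₁ (bdry x'))
        - (Z x' * ρ₁ (bdry x') + V x' * eulerDeriv ρ₁ (bdry x'))) / 2 * u₀ x' ^ 2)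
        - ∫ x', V x' * ρ₂ (bdry x') * u₀ x' ^ 2 := by
    have k : Integrable (fun x' => -((-(n : ℝ) * (V x' * ρ₁ (bdry x'))
        - (Z x' * ρ₁ (bdry x') + V x' * eulerDeriv ρ₁ (bdry x'))) / 2 * u₀ x' ^ 2)) := b1.neg
    rw [← integral_neg, ← integral_sub k b2]
    refine integral_congr_ae ?_
    filter_upwards [hv.trace] with x' h1
    by_cases hx : ‖x'‖ < 1
    · simp [h1 hx, bdryDensity, bdryDensity₁]
    · rw [not_lt] at hx
      have hb : ‖bdry x'‖ = ‖x'‖ := norm_bdry x'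
      have hx1 : 1 ≤ ‖bdry x'‖ := by rwa [hb]
      have hx0 : 0 < ‖bdry x'‖ := by linarith
      rw [hρ₁, hρ₂, eulerDeriv_radial hx0 (hasDerivAt_profile₁ hx1)]
      simp only [hb, profile₁, profile₁', profile₂, bdryDensity, bdryDensity₁]
      -- This value makes `n / 2 - κ` equal to the coefficient `(1 - a) / 2` of the boundary
      -- density.
      have hκ' : κ = ((n : ℝ) + a - 1) / 2 := by linarith
      rw [hκ']
      ring
  rw [hsrc, hbd]
  linarith

end Identity

/-! ### Removal of the cutoff -/

section Limit

theorem tendsto_integral_cutoff {E : Type*} [NormedAddCommGroup E] [MeasurableSpace E]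
    [OpensMeasurableSpace E] {μ : Measure E} {J : E → ℝ} (hJ : Integrable J μ)
    (h0 : ∀ᵐ x ∂μ, ‖x‖ < 1 → J x = 0) :
    Tendsto (fun j => ∫ x, cutoff j ‖x‖ * J x ∂μ) atTop (𝓝 (∫ x, J x ∂μ)) := by
  obtain ⟨K, hK⟩ := exists_cutoff_bound
  refine tendsto_integral_filter_of_dominated_convergence (fun x => K * ‖J x‖)
    (Eventually.of_forall fun j => ?_) (Eventually.of_forall fun j => ae_of_all _ fun x => ?_)
    (hJ.norm.const_mul K) ?_
  · exact ((contDiff_cutoff j).continuous.measurable.comp measurable_norm).aestronglyMeasurable.mul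
      hJ.1
  · rw [norm_mul]
    exact mul_le_mul_of_nonneg_right (hK j _).1 (norm_nonneg _)
  · filter_upwards [h0] with x hx
    by_cases h : ‖x‖ < 1
    · simp [hx h]
    · simpa using (tendsto_cutoff (not_lt.1 h)).mul_const (J x)

theorem integrable_cutoff_mul {E : Type*} [NormedAddCommGroup E] [MeasurableSpace E]
    [OpensMeasurableSpace E] {μ : Measure E} {J : E → ℝ} (hJ : Integrable J μ) {c : ℝ → ℝ}
    (hc : Continuous c) {K : ℝ} (hK : ∀ r, |c r| ≤ K) : Integrable (fun x => c ‖x‖ * J x) μ :=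
  hJ.bdd_mul (hc.measurable.comp measurable_norm).aestronglyMeasurable
    (ae_of_all _ fun x => hK ‖x‖)

theorem tendsto_integral_cutoff_zero {E : Type*} [NormedAddCommGroup E] [MeasurableSpace E]
    [OpensMeasurableSpace E] {μ : Measure E} {J : E → ℝ} (hJ : Integrable J μ) {c : ℕ → ℝ → ℝ}
    (hc : ∀ j, Continuous (c j)) {K : ℝ} (hK : ∀ j r, |c j r| ≤ K)
    (hlim : ∀ r, Tendsto (fun j => c j r) atTop (𝓝 0)) :
    Tendsto (fun j => ∫ x, c j ‖x‖ * J x ∂μ) atTop (𝓝 0) := by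
  have := tendsto_integral_bdd_mul (l := atTop) hJ (g := fun j x => c j ‖x‖) (g₀ := fun _ => 0)
    (fun j => ((hc j).measurable.comp measurable_norm).aestronglyMeasurable)
    (fun j => ae_of_all _ fun x => hK j ‖x‖) (ae_of_all _ fun x => hlim ‖x‖)
  simpa using this

variable {n : ℕ} {a : ℝ} {u F : EuclideanSpace ℝ (Fin (n + 1)) → ℝ}
  {G : EuclideanSpace ℝ (Fin (n + 1)) → EuclideanSpace ℝ (Fin (n + 1))}
  {u₀ V Z : EuclideanSpace ℝ (Fin n) → ℝ} {α τ κ : ℝ}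

/-- The integrability with respect to the Carleman weight that justifies the removal of the
cutoff. -/
structure WeightedIntegrable (a α τ : ℝ) (u : EuclideanSpace ℝ (Fin (n + 1)) → ℝ)
    (G : EuclideanSpace ℝ (Fin (n + 1)) → EuclideanSpace ℝ (Fin (n + 1)))
    (u₀ : EuclideanSpace ℝ (Fin n) → ℝ) (F : EuclideanSpace ℝ (Fin (n + 1)) → ℝ)
    (V Z : EuclideanSpace ℝ (Fin n) → ℝ) : Prop where
  fn : Integrable (fun x => Real.exp (2 * τ * ‖x‖ ^ α) * (‖x‖ ^ α) ^ 4 * u x ^ 2) (wVol n a)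
  grad : Integrable (fun x => Real.exp (2 * τ * ‖x‖ ^ α) * (‖x‖ ^ α) ^ 4 * ‖G x‖ ^ 2) (wVol n a)
  source : Integrable (fun x => Real.exp (2 * τ * ‖x‖ ^ α) * ‖x‖ ^ 2 * F x ^ 2) (wVol n a)
  potential : Integrable fun x' => Real.exp (2 * τ * ‖x'‖ ^ α) * ‖x'‖ ^ α * V x' * u₀ x' ^ 2
  radial : Integrable fun x' => Real.exp (2 * τ * ‖x'‖ ^ α) * ‖x'‖ ^ α * Z x' * u₀ x' ^ 2

/-- Outside the unit ball `|x|^α ≥ 1`, so four powers dominate all smaller ones. Four suffice, and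
are needed for `bulk`: the term `p² P²` contains `p⁴ u²`. -/
theorem WeightedIntegrable.monomial (hi : WeightedIntegrable a α τ u G u₀ F V Z) (hα : 0 ≤ α)
    {X : EuclideanSpace ℝ (Fin (n + 1)) → ℝ} (hX : AEStronglyMeasurable X (wVol n a))
    (h0 : ∀ᵐ x ∂(wVol n a), ‖x‖ < 1 → X x = 0)
    (hb : ∀ x, 1 ≤ ‖x‖ → |X x| ≤ ‖x‖ ^ 2 * (u x ^ 2 + ‖G x‖ ^ 2)) {i : ℕ} (h4 : i ≤ 4) :
    Integrable (fun x => Real.exp (2 * τ * ‖x‖ ^ α) / ‖x‖ ^ 2 * ((‖x‖ ^ α) ^ i * X x))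
      (wVol n a) := by
  refine Integrable.mono' (hi.fn.add hi.grad) ?_ ?_
  · refine AEStronglyMeasurable.mul ?_ (AEStronglyMeasurable.mul ?_ hX)
    · exact Measurable.aestronglyMeasurable (by fun_prop)
    · exact Measurable.aestronglyMeasurable (by fun_prop)
  · filter_upwards [h0] with x hx
    simp only [Pi.add_apply]
    by_cases h : ‖x‖ < 1
    · rw [hx h, mul_zero, mul_zero, norm_zero]
      positivity
    · rw [not_lt] at h
      have hp : 1 ≤ ‖x‖ ^ α := Real.one_le_rpow h hα
      have hr : (0 : ℝ) < ‖x‖ ^ 2 := by positivity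
      have h1 : (‖x‖ ^ α) ^ i ≤ (‖x‖ ^ α) ^ 4 := pow_le_pow_right₀ hp h4
      rw [Real.norm_eq_abs, abs_mul, abs_mul, abs_of_pos (div_pos (Real.exp_pos _) hr),
        abs_of_nonneg (by positivity : 0 ≤ (‖x‖ ^ α) ^ i)]
      calc Real.exp (2 * τ * ‖x‖ ^ α) / ‖x‖ ^ 2 * ((‖x‖ ^ α) ^ i * |X x|)
          ≤ Real.exp (2 * τ * ‖x‖ ^ α) / ‖x‖ ^ 2 *
            ((‖x‖ ^ α) ^ 4 * (‖x‖ ^ 2 * (u x ^ 2 + ‖G x‖ ^ 2))) := by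
            gcongr
            exact hb x h
        _ = _ := by field_simp

theorem inner_sq_le (x : EuclideanSpace ℝ (Fin (n + 1))) (y : EuclideanSpace ℝ (Fin (n + 1))) :
    (inner ℝ x y : ℝ) ^ 2 ≤ ‖x‖ ^ 2 * ‖y‖ ^ 2 := by
  rw [← mul_pow, ← sq_abs (inner ℝ x y)]
  gcongr
  exact abs_real_inner_le_norm x y

theorem WeightedIntegrable.monomial_euler_sq (hi : WeightedIntegrable a α τ u G u₀ F V Z)
    (hG : AEStronglyMeasurable G (wVol n a)) (hv : VanishesInBall a u G u₀) (hα : 0 ≤ α)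
    {i : ℕ} (h4 : i ≤ 4) :
    Integrable (fun x => Real.exp (2 * τ * ‖x‖ ^ α) / ‖x‖ ^ 2 *
      ((‖x‖ ^ α) ^ i * (inner ℝ x (G x) : ℝ) ^ 2)) (wVol n a) := by
  refine hi.monomial hα ((continuous_id.aestronglyMeasurable.inner hG).pow 2)
    (hv.grad.mono fun x h1 h2 => by simp [h1 h2]) (fun x hx => ?_) h4
  rw [Pi.pow_apply, abs_of_nonneg (sq_nonneg _), mul_add]
  have h2 : 0 ≤ ‖x‖ ^ 2 * u x ^ 2 := by positivity
  exact (inner_sq_le x (G x)).trans (le_add_of_nonneg_left h2)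

theorem WeightedIntegrable.monomial_mixed (hi : WeightedIntegrable a α τ u G u₀ F V Z)
    (hu : AEStronglyMeasurable u (wVol n a)) (hG : AEStronglyMeasurable G (wVol n a))
    (hv : VanishesInBall a u G u₀) (hα : 0 ≤ α)
    {i : ℕ} (h4 : i ≤ 4) :
    Integrable (fun x => Real.exp (2 * τ * ‖x‖ ^ α) / ‖x‖ ^ 2 *
      ((‖x‖ ^ α) ^ i * (u x * inner ℝ x (G x)))) (wVol n a) := by
  refine hi.monomial hα (hu.mul (continuous_id.aestronglyMeasurable.inner hG))
    (hv.grad.mono fun x h1 h2 => by simp [h1 h2]) (fun x hx => ?_) h4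
  simp only [Pi.mul_apply, id_eq]
  have h1 := inner_sq_le x (G x)
  have h2 : 1 * u x ^ 2 ≤ ‖x‖ ^ 2 * u x ^ 2 := by
    gcongr
    exact one_le_pow₀ hx
  have h3 : 0 ≤ u x ^ 2 := sq_nonneg _
  have h5 : 0 ≤ (inner ℝ x (G x) : ℝ) ^ 2 := sq_nonneg _
  have h6 := two_mul_le_add_sq |u x| |(inner ℝ x (G x) : ℝ)|
  rw [sq_abs, sq_abs] at h6
  rw [abs_mul, mul_add]
  linarith

theorem WeightedIntegrable.monomial_sq (hi : WeightedIntegrable a α τ u G u₀ F V Z)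
    (hu : AEStronglyMeasurable u (wVol n a)) (hv : VanishesInBall a u G u₀) (hα : 0 ≤ α)
    {i : ℕ} (h4 : i ≤ 4) :
    Integrable (fun x => Real.exp (2 * τ * ‖x‖ ^ α) / ‖x‖ ^ 2 *
      ((‖x‖ ^ α) ^ i * u x ^ 2)) (wVol n a) := by
  refine hi.monomial hα (hu.pow 2) (hv.fn.mono fun x h1 h2 => by simp [h1 h2])
    (fun x hx => ?_) h4
  rw [Pi.pow_apply, abs_of_nonneg (sq_nonneg _), mul_add]
  have h2 : 1 * u x ^ 2 ≤ ‖x‖ ^ 2 * u x ^ 2 := by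
    gcongr
    exact one_le_pow₀ hx
  have h3 : 0 ≤ ‖x‖ ^ 2 * ‖G x‖ ^ 2 := by positivity
  linarith

theorem WeightedIntegrable.monomial_grad_sq (hi : WeightedIntegrable a α τ u G u₀ F V Z)
    (hG : AEStronglyMeasurable G (wVol n a)) (hv : VanishesInBall a u G u₀) (hα : 0 ≤ α)
    {i : ℕ} (h4 : i ≤ 4) :
    Integrable (fun x => Real.exp (2 * τ * ‖x‖ ^ α) / ‖x‖ ^ 2 *
      ((‖x‖ ^ α) ^ i * (‖x‖ ^ 2 * ‖G x‖ ^ 2))) (wVol n a) := by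
  have hr : AEStronglyMeasurable (fun x : EuclideanSpace ℝ (Fin (n + 1)) => ‖x‖ ^ 2) (wVol n a) :=
    Measurable.aestronglyMeasurable (by fun_prop)
  have hg : AEStronglyMeasurable (fun x => ‖G x‖ ^ 2) (wVol n a) := hG.norm.pow 2
  have hX : AEStronglyMeasurable (fun x => ‖x‖ ^ 2 * ‖G x‖ ^ 2) (wVol n a) := hr.mul hg
  have h0 : ∀ᵐ x ∂(wVol n a), ‖x‖ < 1 → ‖x‖ ^ 2 * ‖G x‖ ^ 2 = 0 := by
    filter_upwards [hv.grad] with x h1 h2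
    simp [h1 h2]
  refine hi.monomial hα hX h0 (fun x hx => ?_) h4
  have h1 : 0 ≤ ‖x‖ ^ 2 * ‖G x‖ ^ 2 := by positivity
  have h2 : 0 ≤ ‖x‖ ^ 2 * u x ^ 2 := by positivity
  rw [abs_of_nonneg h1, mul_add]
  exact le_add_of_nonneg_left h2

/-- The common form of all the interior densities once expanded in powers of `|x|^α`; each
application below consists in naming the coefficients. -/
theorem WeightedIntegrable.quadratic (hi : WeightedIntegrable a α τ u G u₀ F V Z)
    (hu : AEStronglyMeasurable u (wVol n a)) (hG : AEStronglyMeasurable G (wVol n a))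
    (hv : VanishesInBall a u G u₀) (hα : 0 ≤ α) (a₁ a₂ b₁ b₂ b₃ c₁ c₂ c₃ c₄ d₁ : ℝ) :
    Integrable (fun x => Real.exp (2 * τ * ‖x‖ ^ α) / ‖x‖ ^ 2 *
      ((a₁ * ‖x‖ ^ α + a₂ * (‖x‖ ^ α) ^ 2) * (inner ℝ x (G x)) ^ 2
      + (b₁ * ‖x‖ ^ α + b₂ * (‖x‖ ^ α) ^ 2 + b₃ * (‖x‖ ^ α) ^ 3) * (u x * inner ℝ x (G x))
      + (c₁ * ‖x‖ ^ α + c₂ * (‖x‖ ^ α) ^ 2 + c₃ * (‖x‖ ^ α) ^ 3 + c₄ * (‖x‖ ^ α) ^ 4) * u x ^ 2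
      + d₁ * ‖x‖ ^ α * (‖x‖ ^ 2 * ‖G x‖ ^ 2))) (wVol n a) := by
  have I1 := fun (c : ℝ) {i : ℕ} (h : i ≤ 4) => (hi.monomial_euler_sq hG hv hα h).const_mul c
  have I2 := fun (c : ℝ) {i : ℕ} (h : i ≤ 4) => (hi.monomial_mixed hu hG hv hα h).const_mul c
  have I3 := fun (c : ℝ) {i : ℕ} (h : i ≤ 4) => (hi.monomial_sq hu hv hα h).const_mul c
  have I4 := fun (c : ℝ) {i : ℕ} (h : i ≤ 4) => (hi.monomial_grad_sq hG hv hα h).const_mul c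
  have h1 : 1 ≤ 4 := by norm_num
  have h2 : 2 ≤ 4 := by norm_num
  have h3 : 3 ≤ 4 := by norm_num
  have J1 := (I1 a₁ h1).add (I1 a₂ h2)
  have J2 := ((I2 b₁ h1).add (I2 b₂ h2)).add (I2 b₃ h3)
  have J3 := (((I3 c₁ h1).add (I3 c₂ h2)).add (I3 c₃ h3)).add (I3 c₄ le_rfl)
  have J := ((J1.add J2).add J3).add (I4 d₁ h1)
  refine J.congr (ae_of_all _ fun x => ?_)
  simp only [Pi.add_apply]
  ring

theorem WeightedIntegrable.bulk (hi : WeightedIntegrable a α τ u G u₀ F V Z)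
    (hu : AEStronglyMeasurable u (wVol n a)) (hG : AEStronglyMeasurable G (wVol n a))
    (hv : VanishesInBall a u G u₀) (hα : 0 ≤ α) (κ : ℝ) :
    Integrable (fun x => Carleman.bulk α τ κ ‖x‖ (u x) (inner ℝ x (G x)) (‖G x‖ ^ 2))
      (wVol n a) := by
  refine (hi.quadratic hu hG hv hα (α ^ 2) (2 * τ * α ^ 2) (3 * α ^ 2 * κ)
    (3 * τ * α ^ 3 + 4 * τ * α ^ 2 * κ) (4 * τ ^ 2 * α ^ 3)
    (3 / 2 * α ^ 2 * κ ^ 2 + κ ^ 2 * α ^ 2 / 2 - α ^ 4 / 2)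
    (3 * κ * τ * α ^ 3 + 2 * τ * α ^ 2 * κ ^ 2 - 2 * τ * α ^ 4)
    (3 / 2 * τ ^ 2 * α ^ 4 + 4 * κ * τ ^ 2 * α ^ 3 + τ ^ 2 * α ^ 4 / 2)
    (2 * τ ^ 3 * α ^ 4) (α ^ 2 / 2)).congr (ae_of_all _ fun x => ?_)
  simp only [Carleman.bulk]
  ring

theorem WeightedIntegrable.bulk₁ (hi : WeightedIntegrable a α τ u G u₀ F V Z)
    (hu : AEStronglyMeasurable u (wVol n a)) (hG : AEStronglyMeasurable G (wVol n a))
    (hv : VanishesInBall a u G u₀) (hα : 0 ≤ α) (κ : ℝ) :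
    Integrable (fun x => Carleman.bulk₁ α τ κ ‖x‖ (u x) (inner ℝ x (G x)) (‖G x‖ ^ 2))
      (wVol n a) := by
  refine (hi.quadratic hu hG hv hα α 0 (α * κ) (τ * α ^ 2) 0
    (α * κ ^ 2 / 2 - κ ^ 2 * α / 2 - α ^ 3) (κ * τ * α ^ 2 - 3 / 2 * τ * α ^ 3)
    (τ ^ 2 * α ^ 3) 0 (-(α / 2))).congr (ae_of_all _ fun x => ?_)
  simp only [Carleman.bulk₁]
  ring

theorem WeightedIntegrable.bulk₂ (hi : WeightedIntegrable a α τ u G u₀ F V Z)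
    (hu : AEStronglyMeasurable u (wVol n a)) (hG : AEStronglyMeasurable G (wVol n a))
    (hv : VanishesInBall a u G u₀) (hα : 0 ≤ α) :
    Integrable (fun x => Carleman.bulk₂ α τ ‖x‖ (u x)) (wVol n a) := by
  refine (hi.quadratic hu hG hv hα 0 0 0 0 0 (-(α ^ 2 / 2)) 0 0 0 0).congr
    (ae_of_all _ fun x => ?_)
  simp only [Carleman.bulk₂]
  ring

theorem WeightedIntegrable.source_term (hi : WeightedIntegrable a α τ u G u₀ F V Z)
    (hu : AEStronglyMeasurable u (wVol n a)) (hG : AEStronglyMeasurable G (wVol n a))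
    (hF : AEStronglyMeasurable F (wVol n a))
    (hv : VanishesInBall a u G u₀) (hα : 0 ≤ α) (κ : ℝ) :
    Integrable (fun x => Carleman.source α τ κ ‖x‖ (u x) (inner ℝ x (G x)) (F x)) (wVol n a) := by
  have hD : AEStronglyMeasurable (fun x => (inner ℝ x (G x) : ℝ)) (wVol n a) :=
    continuous_id.aestronglyMeasurable.inner hG
  have hp : Measurable fun x : EuclideanSpace ℝ (Fin (n + 1)) => ‖x‖ ^ α := by fun_prop
  -- The coefficients are those of `Q²`, where `Q = αp (D + (κ + ταp) u) + α²p u` is the multiplier.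
  -- The source density is then dominated through `|F Q| ≤ |x|² F² + Q² / |x|²`.
  have hQ := hi.quadratic hu hG hv hα 0 (α ^ 2) 0 (2 * α * (α * κ + α ^ 2)) (2 * α * (τ * α ^ 2)) 0
    ((α * κ + α ^ 2) ^ 2) (2 * (α * κ + α ^ 2) * (τ * α ^ 2)) ((τ * α ^ 2) ^ 2) 0
  refine Integrable.mono' (hi.source.add hQ) ?_ ?_
  · have h1 : AEStronglyMeasurable (fun x : EuclideanSpace ℝ (Fin (n + 1)) => ‖x‖ ^ α)
        (wVol n a) := hp.aestronglyMeasurable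
    have h2 : AEStronglyMeasurable (fun x : EuclideanSpace ℝ (Fin (n + 1)) =>
        Real.exp (2 * τ * ‖x‖ ^ α)) (wVol n a) :=
      (Real.measurable_exp.comp (hp.const_mul (2 * τ))).aestronglyMeasurable
    exact ((h2.mul hF).mul (((h1.const_mul α).mul (hD.add (((h1.const_mul α).const_mul τ).const_add
      κ |>.mul hu))).add ((h1.const_mul (α ^ 2)).mul hu))).neg
  · filter_upwards [hv.fn, hv.grad] with x h1 h2
    simp only [Pi.add_apply]
    by_cases h : ‖x‖ < 1
    · simp only [Carleman.source, h1 h, h2 h]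
      simp only [inner_zero_right, mul_zero, add_zero, neg_zero, norm_zero]
      simp only [zero_mul, ne_eq, OfNat.ofNat_ne_zero, not_false_eq_true, zero_pow, mul_zero,
        add_zero]
      positivity
    · rw [not_lt] at h
      have hr : 0 < ‖x‖ := by linarith
      simp only [Carleman.source]
      generalize (inner ℝ x (G x) : ℝ) = D
      generalize ‖x‖ ^ α = p
      have hw := Real.exp_pos (2 * τ * p)
      generalize Real.exp (2 * τ * p) = w at hw
      rw [norm_neg, Real.norm_eq_abs, mul_assoc w, abs_mul, abs_of_pos hw]
      set Q := α * p * (D + (κ + τ * (α * p)) * u x) + α ^ 2 * p * u x with hQ'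
      have e : w * ‖x‖ ^ 2 * F x ^ 2 + w / ‖x‖ ^ 2 * Q ^ 2
          = w * (‖x‖ ^ 2 * F x ^ 2 + (Q / ‖x‖) ^ 2) := by field_simp
      refine le_trans (b := w * (‖x‖ ^ 2 * F x ^ 2 + (Q / ‖x‖) ^ 2)) ?_ (le_of_eq ?_)
      · refine mul_le_mul_of_nonneg_left ?_ hw.le
        have e2 : F x * Q = (‖x‖ * F x) * (Q / ‖x‖) := by field_simp
        rw [e2, ← mul_pow, abs_le]
        constructor
        · nlinarith [sq_nonneg (‖x‖ * F x + Q / ‖x‖), sq_nonneg (‖x‖ * F x),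
            sq_nonneg (Q / ‖x‖)]
        · nlinarith [sq_nonneg (‖x‖ * F x - Q / ‖x‖), sq_nonneg (‖x‖ * F x),
            sq_nonneg (Q / ‖x‖)]
      · rw [← e, hQ']
        ring

theorem WeightedIntegrable.bdryDensity (hi : WeightedIntegrable a α τ u G u₀ F V Z) :
    Integrable fun x' => Carleman.bdryDensity a α τ ‖x'‖ (u₀ x') (V x') (Z x') := by
  refine ((hi.potential.const_mul (α * ((1 - a) / 2) - α ^ 2 / 2)).add
    (hi.radial.const_mul (α / 2))).congr (ae_of_all _ fun x => ?_)
  simp only [Carleman.bdryDensity, Pi.add_apply]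
  ring

theorem WeightedIntegrable.bdryDensity₁ (hi : WeightedIntegrable a α τ u G u₀ F V Z) :
    Integrable fun x' => Carleman.bdryDensity₁ α τ ‖x'‖ (u₀ x') (V x') := by
  refine (hi.potential.const_mul (α / 2)).congr (ae_of_all _ fun x => ?_)
  simp only [Carleman.bdryDensity₁]
  ring

/-- All densities are integrable, the cutoffs tend to one where `|x| ≥ 1`, and their Euler
derivatives tend to zero with a uniform bound. Dominated convergence does the rest. -/
theorem WeakSolution.carleman_identity (hw : WeakSolution a u G u₀ F V Z)
    (hv : VanishesInBall a u G u₀) (hi : WeightedIntegrable a α τ u G u₀ F V Z) (hα : 0 ≤ α)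
    (hκ : 2 * κ + 2 = (n : ℝ) + 1 + a) :
    ∫ x, bulk α τ κ ‖x‖ (u x) (inner ℝ x (G x)) (‖G x‖ ^ 2) ∂(wVol n a)
    = ∫ x, source α τ κ ‖x‖ (u x) (inner ℝ x (G x)) (F x) ∂(wVol n a)
      + ∫ x', bdryDensity a α τ ‖x'‖ (u₀ x') (V x') (Z x') := by
  obtain ⟨K, hK⟩ := exists_cutoff_bound
  have hu := hw.memLp.1
  have hG := hw.memLp_grad.1
  have i0 := hi.bulk hu hG hv hα κ
  have i1 := hi.bulk₁ hu hG hv hα κ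
  have i2 := hi.bulk₂ hu hG hv hα
  have iS := hi.source_term hu hG hw.memLp_source.1 hv hα κ
  have iB := hi.bdryDensity
  have iB1 := hi.bdryDensity₁
  have c0 := fun j => (contDiff_cutoff j).continuous
  have c1 := fun j => (contDiff_cutoff₁ j).continuous
  have c2 := fun j => (contDiff_cutoff₂ j).continuous
  have key := fun j => hw.cutoff_identity hv hκ α τ j
  have lhs : ∀ j, ∫ x, (cutoff j ‖x‖ * bulk α τ κ ‖x‖ (u x) (inner ℝ x (G x)) (‖G x‖ ^ 2)
      + cutoff₁ j ‖x‖ * bulk₁ α τ κ ‖x‖ (u x) (inner ℝ x (G x)) (‖G x‖ ^ 2)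
      + cutoff₂ j ‖x‖ * bulk₂ α τ ‖x‖ (u x)) ∂(wVol n a)
      = ∫ x, cutoff j ‖x‖ * bulk α τ κ ‖x‖ (u x) (inner ℝ x (G x)) (‖G x‖ ^ 2) ∂(wVol n a)
      + ∫ x, cutoff₁ j ‖x‖ * bulk₁ α τ κ ‖x‖ (u x) (inner ℝ x (G x)) (‖G x‖ ^ 2) ∂(wVol n a)
      + ∫ x, cutoff₂ j ‖x‖ * bulk₂ α τ ‖x‖ (u x) ∂(wVol n a) := by
    intro j
    have k0 := integrable_cutoff_mul i0 (c0 j) fun r => (hK j r).1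
    have k1 := integrable_cutoff_mul i1 (c1 j) fun r => (hK j r).2.1
    have k2 := integrable_cutoff_mul i2 (c2 j) fun r => (hK j r).2.2
    rw [integral_add (by exact k0.add k1) k2, integral_add k0 k1]
  have rhs : ∀ j, ∫ x', (cutoff j ‖x'‖ * bdryDensity a α τ ‖x'‖ (u₀ x') (V x') (Z x')
        + cutoff₁ j ‖x'‖ * bdryDensity₁ α τ ‖x'‖ (u₀ x') (V x'))
      = (∫ x', cutoff j ‖x'‖ * bdryDensity a α τ ‖x'‖ (u₀ x') (V x') (Z x'))
        + ∫ x', cutoff₁ j ‖x'‖ * bdryDensity₁ α τ ‖x'‖ (u₀ x') (V x') := fun j =>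
    integral_add (integrable_cutoff_mul iB (c0 j) fun r => (hK j r).1)
      (integrable_cutoff_mul iB1 (c1 j) fun r => (hK j r).2.1)
  simp only [lhs, rhs] at key
  have z0 : ∀ᵐ x ∂(wVol n a), ‖x‖ < 1 →
      bulk α τ κ ‖x‖ (u x) (inner ℝ x (G x)) (‖G x‖ ^ 2) = 0 := by
    filter_upwards [hv.fn, hv.grad] with x h1 h2 hx
    simp [h1 hx, h2 hx, bulk]
  have zS : ∀ᵐ x ∂(wVol n a), ‖x‖ < 1 →
      source α τ κ ‖x‖ (u x) (inner ℝ x (G x)) (F x) = 0 := by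
    filter_upwards [hv.fn, hv.grad] with x h1 h2 hx
    simp [h1 hx, h2 hx, source]
  have zB : ∀ᵐ x' : EuclideanSpace ℝ (Fin n), ‖x'‖ < 1 →
      bdryDensity a α τ ‖x'‖ (u₀ x') (V x') (Z x') = 0 := by
    filter_upwards [hv.trace] with x h1 hx
    simp [h1 hx, bdryDensity]
  have T1 := ((tendsto_integral_cutoff i0 z0).add (tendsto_integral_cutoff_zero i1 c1
    (fun j r => (hK j r).2.1) tendsto_cutoff₁)).add (tendsto_integral_cutoff_zero i2 c2
    (fun j r => (hK j r).2.2) tendsto_cutoff₂)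
  have T2 := (tendsto_integral_cutoff iS zS).add ((tendsto_integral_cutoff iB zB).add
    (tendsto_integral_cutoff_zero iB1 c1 (fun j r => (hK j r).2.1) tendsto_cutoff₁))
  simp only [key] at T1
  have := tendsto_nhds_unique T1 T2
  simpa using this

end Limit

/-! ### Positivity and the estimate under full integrability -/

section Estimate

/-- The density of the left-hand side of the Carleman estimate. -/
noncomputable def energyDensity (α τ r u g : ℝ) : ℝ :=
  Real.exp (2 * τ * r ^ α) * (τ ^ 3 * ((r ^ α) ^ 3 / r ^ 2) * u ^ 2 + τ * r ^ α * g)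

theorem energyDensity_nonneg {α τ r u g : ℝ} (hτ : 0 ≤ τ) (hr : 0 ≤ r) (hg : 0 ≤ g) :
    0 ≤ energyDensity α τ r u g := by
  have := Real.rpow_nonneg hr α
  unfold energyDensity
  positivity

/-- Two completed squares absorb the source. The square of `S + ταp P` takes `τ²α²p²/2` from the
coefficient `2τ²α²p²` of `P²`; the square of `2S + τα²p u / 2` takes `τ²α⁴p²/8` from that of `u²`.
Together they cost `5/2 S²`. -/
theorem quadratic_form_ge {α τ κ p u P S N : ℝ} (hα : 1 ≤ α) (hτ : 9 ≤ τ) (hp : 1 ≤ p)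
    (hN : 0 ≤ N) :
    3 / 2 * (τ * p) * P ^ 2 + τ * p / 2 * N + 1 / 4 * (τ ^ 3 * p ^ 3) * u ^ 2
    ≤ τ * ((3 / 2 * α ^ 2 * p + 2 * τ * α ^ 2 * p ^ 2) * P ^ 2 + α ^ 2 * p / 2 * N
        + (κ ^ 2 * α ^ 2 * p / 2 + τ ^ 2 * α ^ 4 * p ^ 3 / 2 - 2 * τ * α ^ 4 * p ^ 2
          - α ^ 4 * p / 2) * u ^ 2)
      + τ * (S * (α * p * P + α ^ 2 * p * u)) + 5 / 2 * S ^ 2 := by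
  have hα2 : 1 ≤ α ^ 2 := one_le_pow₀ hα
  have hα4 : 1 ≤ α ^ 4 := one_le_pow₀ hα
  have hτp : 9 ≤ τ * p := by nlinarith
  have hτ0 : 0 < τ := by linarith
  have hp0 : 0 < p := by linarith
  have m1 : τ * p ≤ τ * p * α ^ 2 := le_mul_of_one_le_right (by positivity) hα2
  have m2 : τ ^ 3 * p ^ 3 ≤ τ ^ 3 * p ^ 3 * α ^ 4 := le_mul_of_one_le_right (by positivity) hα4
  have h0 : 0 ≤ (τ * α * p) ^ 2 * P ^ 2 := by positivity
  have h1 := mul_le_mul_of_nonneg_right m1 (sq_nonneg P)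
  have h2 := mul_le_mul_of_nonneg_right m1 hN
  have h3 := mul_le_mul_of_nonneg_right m2 (sq_nonneg u)
  -- After a quarter of the cubic term is reserved for the conclusion, this is the condition on the
  -- coefficient of `u²`. Its larger root lies between `8` and `9`, whence the bound on `τ`.
  have h : 0 ≤ 1 / 4 * (τ * p) ^ 2 - (2 + 1 / 8) * (τ * p) - 1 / 2 := by nlinarith
  have h4 : 0 ≤ (κ ^ 2 * α ^ 2 * (τ * p) / 2 + α ^ 4 * (τ * p) *
      (1 / 4 * (τ * p) ^ 2 - (2 + 1 / 8) * (τ * p) - 1 / 2)) * u ^ 2 :=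
    mul_nonneg (add_nonneg (by positivity) (mul_nonneg (by positivity) h)) (sq_nonneg u)
  linear_combination 1 / 2 * sq_nonneg (S + τ * α * p * P)
    + 1 / 2 * sq_nonneg (2 * S + 1 / 2 * (τ * α ^ 2 * p) * u) + h4 + 3 / 2 * h1 + 1 / 2 * h2
    + 1 / 4 * h3 + 3 / 2 * h0

/-- Since `D = P - (κ + ταp) u`, its square is at most `2P² + 4κ²u² + 4τ²α²p²u²`. Multiplied by
`τp`, each term is controlled by the retained part, because `τp ≤ (τp)³`. -/
theorem quadratic_form_le {α τ κ p u P D N : ℝ} (hτ : 1 ≤ τ) (hp : 1 ≤ p)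
    (hP : P = D + (κ + τ * (α * p)) * u) (hN : 0 ≤ N) :
    τ ^ 3 * p ^ 3 * u ^ 2 + τ * p * (N + D ^ 2) ≤ 4 * (1 + 4 * κ ^ 2 + 4 * α ^ 2) *
      (3 / 2 * (τ * p) * P ^ 2 + τ * p / 2 * N + 1 / 4 * (τ ^ 3 * p ^ 3) * u ^ 2) := by
  have hτ0 : 0 < τ := by linarith
  have hp0 : 0 < p := by linarith
  have h1 : τ * p ≤ τ ^ 3 * p ^ 3 := by
    rw [← mul_pow]
    exact le_self_pow₀ (one_le_mul_of_one_le_of_one_le hτ hp) (by norm_num)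
  have h2 := mul_le_mul_of_nonneg_right h1 (by positivity : 0 ≤ 4 * κ ^ 2 * u ^ 2)
  have h3 : 0 ≤ τ * p * ((P + (κ * u + τ * α * p * u)) ^ 2
      + 2 * (κ * u - τ * α * p * u) ^ 2) := by positivity
  have h4 : 0 ≤ τ * p * P ^ 2 * (4 + 24 * κ ^ 2 + 24 * α ^ 2) := by positivity
  have h5 : 0 ≤ τ * p * N * (1 + 8 * κ ^ 2 + 8 * α ^ 2) := by positivity
  have hD : D = P - (κ + τ * (α * p)) * u := by rw [hP]; ring
  rw [hD]
  linear_combination h2 + h3 + h4 + h5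

theorem quadratic_form_lower_bound {α τ κ p u P S D g : ℝ} (hα : 1 ≤ α) (hτ : 9 ≤ τ) (hp : 1 ≤ p)
    (hP : P = D + (κ + τ * (α * p)) * u) (hg : D ^ 2 ≤ g) :
    τ ^ 3 * p ^ 3 * u ^ 2 + τ * p * g ≤ 4 * (1 + 4 * κ ^ 2 + 4 * α ^ 2) *
      (τ * ((3 / 2 * α ^ 2 * p + 2 * τ * α ^ 2 * p ^ 2) * P ^ 2 + α ^ 2 * p / 2 * (g - D ^ 2)
        + (κ ^ 2 * α ^ 2 * p / 2 + τ ^ 2 * α ^ 4 * p ^ 3 / 2 - 2 * τ * α ^ 4 * p ^ 2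
          - α ^ 4 * p / 2) * u ^ 2)
      + τ * (S * (α * p * P + α ^ 2 * p * u)) + 5 / 2 * S ^ 2) := by
  have h := quadratic_form_le (by linarith) hp hP (sub_nonneg.2 hg)
  rw [sub_add_cancel] at h
  exact h.trans (mul_le_mul_of_nonneg_left (quadratic_form_ge hα hτ hp (sub_nonneg.2 hg))
    (by positivity))

theorem energyDensity_le {α τ κ r u D g F : ℝ} (hα : 1 ≤ α) (hτ : 9 ≤ τ) (hr : 1 ≤ r)
    (hg : D ^ 2 ≤ r ^ 2 * g) :
    energyDensity α τ r u g ≤ 4 * (1 + 4 * κ ^ 2 + 4 * α ^ 2) * (τ * bulk α τ κ r u D g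
      - τ * source α τ κ r u D F + 5 / 2 * (Real.exp (2 * τ * r ^ α) * r ^ 2 * F ^ 2)) := by
  have hr0 : 0 < r := by linarith
  have hp : 1 ≤ r ^ α := Real.one_le_rpow hr (by linarith)
  -- The common factor `e^{2τp} / r²` is pulled out of all densities, so the source appears as `r²
  -- F`, and `S²` becomes the weighted `r² F²`.
  have key := quadratic_form_lower_bound (κ := κ) (S := r ^ 2 * F) (u := u) hα hτ hp rfl hg
  have hw : 0 ≤ Real.exp (2 * τ * r ^ α) / r ^ 2 := by positivity
  have := mul_le_mul_of_nonneg_left key hw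
  refine (le_of_eq ?_).trans (this.trans (le_of_eq ?_))
  · unfold energyDensity
    generalize Real.exp (2 * τ * r ^ α) = w
    generalize r ^ α = p
    field_simp
  · unfold bulk source
    generalize Real.exp (2 * τ * r ^ α) = w
    generalize r ^ α = p
    field_simp
    ring

theorem bdryDensity_le {a α τ r u V Z : ℝ} (ha : -1 < a) (ha' : a < 1) (hα : 1 ≤ α)
    (hr : 0 ≤ r) :
    bdryDensity a α τ r u V Z ≤ α * (1 + α) * (|Real.exp (2 * τ * r ^ α) * r ^ α * Z * u ^ 2|
      + |Real.exp (2 * τ * r ^ α) * r ^ α * V * u ^ 2|) := by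
  have hp := Real.rpow_nonneg hr α
  have hc : 0 ≤ Real.exp (2 * τ * r ^ α) * r ^ α * u ^ 2 := by positivity
  have e : ∀ W : ℝ, |Real.exp (2 * τ * r ^ α) * r ^ α * W * u ^ 2|
      = Real.exp (2 * τ * r ^ α) * r ^ α * u ^ 2 * |W| := fun W => by
    rw [mul_right_comm, abs_mul, abs_of_nonneg hc]
  rw [e, e]
  have h : (1 - a) / 2 * V + Z / 2 - α / 2 * V ≤ (1 + α) * (|Z| + |V|) := by
    have h1 : (1 - a) / 2 * V ≤ |V| := by
      rcases abs_cases V with ⟨h, h'⟩ | ⟨h, h'⟩ <;> rw [h] <;> nlinarith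
    have h2 : -(α / 2 * V) ≤ α * |V| := by
      rcases abs_cases V with ⟨h, h'⟩ | ⟨h, h'⟩ <;> rw [h] <;> nlinarith
    have h3 : Z / 2 ≤ |Z| := by
      rcases abs_cases Z with ⟨h, h'⟩ | ⟨h, h'⟩ <;> linarith
    have h4 : 0 ≤ α * |Z| := by positivity
    linarith
  have h5 := mul_le_mul_of_nonneg_left h (mul_nonneg (by linarith : 0 ≤ α) hc)
  unfold bdryDensity
  calc _ = α * (Real.exp (2 * τ * r ^ α) * r ^ α * u ^ 2) *
        ((1 - a) / 2 * V + Z / 2 - α / 2 * V) := by ring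
    _ ≤ _ := h5
    _ = _ := by ring

variable {n : ℕ} {a : ℝ} {u F : EuclideanSpace ℝ (Fin (n + 1)) → ℝ}
  {G : EuclideanSpace ℝ (Fin (n + 1)) → EuclideanSpace ℝ (Fin (n + 1))}
  {u₀ V Z : EuclideanSpace ℝ (Fin n) → ℝ} {α τ κ : ℝ}

/-- The constant of the Carleman estimate. -/
noncomputable def carlemanConst (α κ : ℝ) : ℝ :=
  4 * (1 + 4 * κ ^ 2 + 4 * α ^ 2) * (5 / 2 + α * (1 + α))

theorem one_lt_carlemanConst (hα : 1 ≤ α) : 1 < carlemanConst α κ := by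
  unfold carlemanConst
  have h1 : 1 ≤ 1 + 4 * κ ^ 2 + 4 * α ^ 2 := by nlinarith [sq_nonneg κ, sq_nonneg α]
  have h2 : 1 ≤ 5 / 2 + α * (1 + α) := by nlinarith
  nlinarith

theorem aestronglyMeasurable_energyDensity (hu : AEStronglyMeasurable u (wVol n a))
    (hG : AEStronglyMeasurable G (wVol n a)) (α τ : ℝ) :
    AEStronglyMeasurable (fun x => energyDensity α τ ‖x‖ (u x) (‖G x‖ ^ 2)) (wVol n a) := by
  have h1 : AEMeasurable (fun x : EuclideanSpace ℝ (Fin (n + 1)) => ‖x‖) (wVol n a) :=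
    measurable_norm.aemeasurable
  have h2 := hu.aemeasurable
  have h3 := hG.norm.aemeasurable
  unfold energyDensity
  exact AEMeasurable.aestronglyMeasurable (by fun_prop)

/-- Integrate the pointwise inequality `energyDensity_le`. By the Carleman identity the difference
of the `bulk` and `source` integrals is the boundary integral. -/
theorem WeakSolution.integral_energyDensity_le (hw : WeakSolution a u G u₀ F V Z)
    (hv : VanishesInBall a u G u₀) (hi : WeightedIntegrable a α τ u G u₀ F V Z) (hα : 1 ≤ α)
    (hτ : 9 ≤ τ) (hκ : 2 * κ + 2 = (n : ℝ) + 1 + a) :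
    Integrable (fun x => energyDensity α τ ‖x‖ (u x) (‖G x‖ ^ 2)) (wVol n a) ∧
    ∫ x, energyDensity α τ ‖x‖ (u x) (‖G x‖ ^ 2) ∂(wVol n a) ≤ carlemanConst α κ *
      (∫ x, Real.exp (2 * τ * ‖x‖ ^ α) * ‖x‖ ^ 2 * F x ^ 2 ∂(wVol n a)
      + τ * (∫ x', |Real.exp (2 * τ * ‖x'‖ ^ α) * ‖x'‖ ^ α * Z x' * u₀ x' ^ 2|)
      + τ * ∫ x', |Real.exp (2 * τ * ‖x'‖ ^ α) * ‖x'‖ ^ α * V x' * u₀ x' ^ 2|) := by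
  have hα0 : 0 ≤ α := by linarith
  have hu := hw.memLp.1
  have hG := hw.memLp_grad.1
  have i0 := hi.bulk hu hG hv hα0 κ
  have iS := hi.source_term hu hG hw.memLp_source.1 hv hα0 κ
  have hle : ∀ᵐ x ∂(wVol n a), energyDensity α τ ‖x‖ (u x) (‖G x‖ ^ 2)
      ≤ 4 * (1 + 4 * κ ^ 2 + 4 * α ^ 2) *
        (τ * bulk α τ κ ‖x‖ (u x) (inner ℝ x (G x)) (‖G x‖ ^ 2)
        - τ * source α τ κ ‖x‖ (u x) (inner ℝ x (G x)) (F x)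
        + 5 / 2 * (Real.exp (2 * τ * ‖x‖ ^ α) * ‖x‖ ^ 2 * F x ^ 2)) := by
    filter_upwards [hv.fn, hv.grad] with x h1 h2
    by_cases h : ‖x‖ < 1
    · have e1 : energyDensity α τ ‖x‖ (u x) (‖G x‖ ^ 2) = 0 := by
        simp [energyDensity, h1 h, h2 h]
      have e2 : bulk α τ κ ‖x‖ (u x) (inner ℝ x (G x)) (‖G x‖ ^ 2) = 0 := by
        simp [bulk, h1 h, h2 h]
      have e3 : source α τ κ ‖x‖ (u x) (inner ℝ x (G x)) (F x) = 0 := by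
        simp [source, h1 h, h2 h]
      rw [e1, e2, e3, sub_self, zero_add]
      positivity
    · exact energyDensity_le hα hτ (not_lt.1 h) (inner_sq_le x (G x))
  have iR : Integrable (fun x => τ * bulk α τ κ ‖x‖ (u x) (inner ℝ x (G x)) (‖G x‖ ^ 2)
        - τ * source α τ κ ‖x‖ (u x) (inner ℝ x (G x)) (F x)
        + 5 / 2 * (Real.exp (2 * τ * ‖x‖ ^ α) * ‖x‖ ^ 2 * F x ^ 2)) (wVol n a) :=
    ((i0.const_mul τ).sub (iS.const_mul τ)).add (hi.source.const_mul (5 / 2))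
  have iL : Integrable (fun x => energyDensity α τ ‖x‖ (u x) (‖G x‖ ^ 2)) (wVol n a) := by
    refine (iR.const_mul (4 * (1 + 4 * κ ^ 2 + 4 * α ^ 2))).mono' (aestronglyMeasurable_energyDensity hu hG α τ) ?_
    filter_upwards [hle] with x hx
    rwa [Real.norm_eq_abs, abs_of_nonneg
      (energyDensity_nonneg (by linarith) (norm_nonneg x) (sq_nonneg _))]
  refine ⟨iL, ?_⟩
  have h1 := integral_mono_ae iL (iR.const_mul _) hle
  have hid := hw.carleman_identity hv hi hα0 hκ
  have e : ∫ x, (τ * bulk α τ κ ‖x‖ (u x) (inner ℝ x (G x)) (‖G x‖ ^ 2)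
        - τ * source α τ κ ‖x‖ (u x) (inner ℝ x (G x)) (F x)
        + 5 / 2 * (Real.exp (2 * τ * ‖x‖ ^ α) * ‖x‖ ^ 2 * F x ^ 2)) ∂(wVol n a)
      = τ * (∫ x', bdryDensity a α τ ‖x'‖ (u₀ x') (V x') (Z x'))
        + 5 / 2 * ∫ x, Real.exp (2 * τ * ‖x‖ ^ α) * ‖x‖ ^ 2 * F x ^ 2 ∂(wVol n a) := by
    have k0 := i0.const_mul τ
    have k1 := iS.const_mul τ
    rw [integral_add (by exact k0.sub k1) (hi.source.const_mul (5 / 2)), integral_sub k0 k1,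
      integral_const_mul, integral_const_mul, integral_const_mul, hid]
    ring
  have hB : ∫ x', bdryDensity a α τ ‖x'‖ (u₀ x') (V x') (Z x') ≤ α * (1 + α) *
      ((∫ x', |Real.exp (2 * τ * ‖x'‖ ^ α) * ‖x'‖ ^ α * Z x' * u₀ x' ^ 2|)
      + ∫ x', |Real.exp (2 * τ * ‖x'‖ ^ α) * ‖x'‖ ^ α * V x' * u₀ x' ^ 2|) := by
    rw [← integral_add hi.radial.abs hi.potential.abs, ← integral_const_mul]
    exact integral_mono hi.bdryDensity ((hi.radial.abs.add hi.potential.abs).const_mul _)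
      fun x => bdryDensity_le hw.neg_one_lt hw.lt_one hα (norm_nonneg x)
  rw [integral_const_mul, e] at h1
  have p1 : 0 ≤ ∫ x, Real.exp (2 * τ * ‖x‖ ^ α) * ‖x‖ ^ 2 * F x ^ 2 ∂(wVol n a) :=
    integral_nonneg fun x => by positivity
  have p2 : 0 ≤ ∫ x', |Real.exp (2 * τ * ‖x'‖ ^ α) * ‖x'‖ ^ α * Z x' * u₀ x' ^ 2| :=
    integral_nonneg fun x => abs_nonneg _
  have p3 : 0 ≤ ∫ x', |Real.exp (2 * τ * ‖x'‖ ^ α) * ‖x'‖ ^ α * V x' * u₀ x' ^ 2| :=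
    integral_nonneg fun x => abs_nonneg _
  have hK : 0 ≤ 4 * (1 + 4 * κ ^ 2 + 4 * α ^ 2) := by positivity
  unfold carlemanConst
  refine h1.trans ((mul_le_mul_of_nonneg_left ?_ hK).trans (mul_assoc _ _ _).symm.le)
  have hτ0 : 0 ≤ τ := by linarith
  have h2 := mul_le_mul_of_nonneg_left hB hτ0
  -- The constant contains the sum of `5/2`, for the source, and `α (1 + α)`, for the boundary; the
  -- surplus products are nonnegative.
  have q1 : 0 ≤ α * (1 + α) * ∫ x, Real.exp (2 * τ * ‖x‖ ^ α) * ‖x‖ ^ 2 * F x ^ 2 ∂(wVol n a) :=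
    by positivity
  have q2 := mul_nonneg hτ0 p2
  have q3 := mul_nonneg hτ0 p3
  linarith

end Estimate

/-! ### Approaching the exponent from below -/

section Limiting

/-- The inequality `x⁴ / 4! ≤ e^x` at `x = 2 (τ - σ) p`: the gap between the exponents absorbs the
four powers. -/
theorem exp_mul_pow_four_le {τ σ p : ℝ} (h : σ < τ) (hp : 0 ≤ p) :
    Real.exp (2 * σ * p) * p ^ 4 ≤ 24 / (2 * (τ - σ)) ^ 4 * Real.exp (2 * τ * p) := by
  have hδ : 0 < 2 * (τ - σ) := by linarith
  have h1 := Real.pow_div_factorial_le_exp (2 * (τ - σ) * p) (by positivity) 4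
  have h2 : p ^ 4 ≤ 24 / (2 * (τ - σ)) ^ 4 * Real.exp (2 * (τ - σ) * p) := by
    rw [show ((Nat.factorial 4 : ℕ) : ℝ) = 24 by norm_num [Nat.factorial], mul_pow] at h1
    rw [div_mul_eq_mul_div, le_div_iff₀ (by positivity)]
    rw [div_le_iff₀ (by norm_num)] at h1
    linarith
  calc Real.exp (2 * σ * p) * p ^ 4
      ≤ Real.exp (2 * σ * p) * (24 / (2 * (τ - σ)) ^ 4 * Real.exp (2 * (τ - σ) * p)) := by gcongr
    _ = 24 / (2 * (τ - σ)) ^ 4 * (Real.exp (2 * σ * p) * Real.exp (2 * (τ - σ) * p)) := by ring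
    _ = _ := by
      rw [← Real.exp_add]
      ring_nf

theorem integrable_weight_mul_of_lt {E : Type*} [NormedAddCommGroup E] [MeasurableSpace E]
    [OpensMeasurableSpace E] {μ : Measure E} {α τ σ : ℝ} (h : σ < τ) {J : E → ℝ}
    (hm : AEStronglyMeasurable J μ)
    (hJ : Integrable (fun x => Real.exp (2 * τ * ‖x‖ ^ α) * J x) μ) :
    Integrable (fun x => Real.exp (2 * σ * ‖x‖ ^ α) * (‖x‖ ^ α) ^ 4 * J x) μ := by
  refine (hJ.norm.const_mul (24 / (2 * (τ - σ)) ^ 4)).mono' ?_ (ae_of_all _ fun x => ?_)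
  · exact (Measurable.aestronglyMeasurable (by fun_prop)).mul hm
  · have hp := Real.rpow_nonneg (norm_nonneg x) α
    have h0 : 0 ≤ Real.exp (2 * σ * ‖x‖ ^ α) * (‖x‖ ^ α) ^ 4 := by positivity
    rw [norm_mul, norm_mul (Real.exp (2 * τ * ‖x‖ ^ α)), ← mul_assoc, Real.norm_of_nonneg h0,
      Real.norm_of_nonneg (Real.exp_pos (2 * τ * ‖x‖ ^ α)).le]
    exact mul_le_mul_of_nonneg_right (exp_mul_pow_four_le h hp) (norm_nonneg _)

theorem integrable_weight_mul_of_le {E : Type*} [NormedAddCommGroup E] [MeasurableSpace E]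
    [OpensMeasurableSpace E] {μ : Measure E} {α τ σ : ℝ} (h : σ ≤ τ) {J : E → ℝ}
    (hm : AEStronglyMeasurable J μ)
    (hJ : Integrable (fun x => Real.exp (2 * τ * ‖x‖ ^ α) * J x) μ) :
    Integrable (fun x => Real.exp (2 * σ * ‖x‖ ^ α) * J x) μ := by
  refine hJ.mono ?_ (ae_of_all _ fun x => ?_)
  · exact (Measurable.aestronglyMeasurable (by fun_prop)).mul hm
  · rw [norm_mul, norm_mul, Real.norm_of_nonneg (Real.exp_pos _).le,
      Real.norm_of_nonneg (Real.exp_pos _).le]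
    gcongr

theorem integrable_weight_mul_of_bounded {E : Type*} [NormedAddCommGroup E] [MeasurableSpace E]
    [OpensMeasurableSpace E] {μ : Measure E} {F : E → ℝ} (hF : MemLp F 2 μ) {R : ℝ}
    (hR : ∀ᵐ x ∂μ, R < ‖x‖ → F x = 0) {α : ℝ} (hα : 0 ≤ α) (τ : ℝ) :
    Integrable (fun x => Real.exp (2 * τ * ‖x‖ ^ α) * ‖x‖ ^ 2 * F x ^ 2) μ := by
  refine (hF.integrable_sq.const_mul (Real.exp (2 * |τ| * |R| ^ α) * |R| ^ 2)).mono' ?_ ?_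
  · exact (Measurable.aestronglyMeasurable (by fun_prop)).mul (hF.1.pow 2)
  · filter_upwards [hR] with x hx
    rw [Real.norm_of_nonneg (by positivity)]
    by_cases h : R < ‖x‖
    · rw [hx h]
      simp
    · have h1 : ‖x‖ ≤ |R| := (not_lt.1 h).trans (le_abs_self R)
      have h2 : τ ≤ |τ| := le_abs_self τ
      have h3 : ‖x‖ ^ α ≤ |R| ^ α := Real.rpow_le_rpow (norm_nonneg x) h1 hα
      have h4 : 0 ≤ ‖x‖ ^ α := Real.rpow_nonneg (norm_nonneg x) α
      have h5 : 2 * τ * ‖x‖ ^ α ≤ 2 * |τ| * |R| ^ α := by gcongr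
      gcongr

theorem integral_weight_mul_le {E : Type*} [NormedAddCommGroup E] [MeasurableSpace E]
    {μ : Measure E} {α τ σ : ℝ} (h : σ ≤ τ) {J : E → ℝ} (h0 : ∀ x, 0 ≤ J x)
    (hσ : Integrable (fun x => Real.exp (2 * σ * ‖x‖ ^ α) * J x) μ)
    (hτ : Integrable (fun x => Real.exp (2 * τ * ‖x‖ ^ α) * J x) μ) :
    ∫ x, Real.exp (2 * σ * ‖x‖ ^ α) * J x ∂μ ≤ ∫ x, Real.exp (2 * τ * ‖x‖ ^ α) * J x ∂μ := by
  refine integral_mono hσ hτ fun x => ?_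
  refine mul_le_mul_of_nonneg_right ?_ (h0 x)
  gcongr

theorem integrable_iff_lintegral_abs_ne_top {Ω : Type*} [MeasurableSpace Ω] {μ : Measure Ω}
    {J : Ω → ℝ} (hm : AEStronglyMeasurable J μ) :
    Integrable J μ ↔ ∫⁻ x, ENNReal.ofReal |J x| ∂μ ≠ ∞ := by
  simp_rw [← Real.norm_eq_abs, ofReal_norm]
  exact ⟨fun h => h.2.ne, fun h => ⟨hm, h.lt_top⟩⟩

variable {n : ℕ} {a : ℝ} {u F : EuclideanSpace ℝ (Fin (n + 1)) → ℝ}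
  {G : EuclideanSpace ℝ (Fin (n + 1)) → EuclideanSpace ℝ (Fin (n + 1))}
  {u₀ V Z : EuclideanSpace ℝ (Fin n) → ℝ} {α τ κ : ℝ}

/-- At the exponent `σ` the polynomial moments are finite, so the estimate with full integrability
applies. Its right side increases with the exponent, and replacing `σ` by `τ` there gives a bound
independent of `σ`. -/
theorem WeakSolution.integral_energyDensity_le_of_lt (hw : WeakSolution a u G u₀ F V Z)
    (hv : VanishesInBall a u G u₀) (hα : 1 ≤ α) (hκ : 2 * κ + 2 = (n : ℝ) + 1 + a)
    (hu : Integrable (fun x => Real.exp (2 * τ * ‖x‖ ^ α) * u x ^ 2) (wVol n a))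
    (hG : Integrable (fun x => Real.exp (2 * τ * ‖x‖ ^ α) * ‖G x‖ ^ 2) (wVol n a))
    {R : ℝ} (hR : ∀ᵐ x ∂(wVol n a), R < ‖x‖ → F x = 0)
    (hV : Integrable fun x' => Real.exp (2 * τ * ‖x'‖ ^ α) * (‖x'‖ ^ α * V x' * u₀ x' ^ 2))
    (hZ : Integrable fun x' => Real.exp (2 * τ * ‖x'‖ ^ α) * (‖x'‖ ^ α * Z x' * u₀ x' ^ 2))
    {σ : ℝ} (hσ : 9 ≤ σ) (hστ : σ < τ) :
    ∫⁻ x, ENNReal.ofReal (energyDensity α σ ‖x‖ (u x) (‖G x‖ ^ 2)) ∂(wVol n a)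
    ≤ ENNReal.ofReal (carlemanConst α κ *
      (∫ x, Real.exp (2 * τ * ‖x‖ ^ α) * (‖x‖ ^ 2 * F x ^ 2) ∂(wVol n a)
      + τ * (∫ x', Real.exp (2 * τ * ‖x'‖ ^ α) * |‖x'‖ ^ α * Z x' * u₀ x' ^ 2|)
      + τ * ∫ x', Real.exp (2 * τ * ‖x'‖ ^ α) * |‖x'‖ ^ α * V x' * u₀ x' ^ 2|)) := by
  have mV : AEStronglyMeasurable (fun x' => ‖x'‖ ^ α * V x' * u₀ x' ^ 2) volume :=
    ((Measurable.aestronglyMeasurable (by fun_prop)).mul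
      hw.continuous.aestronglyMeasurable).mul (hw.memLp_trace.1.pow 2)
  have mZ : AEStronglyMeasurable (fun x' => ‖x'‖ ^ α * Z x' * u₀ x' ^ 2) volume :=
    ((Measurable.aestronglyMeasurable (by fun_prop)).mul
      hw.measurable.aestronglyMeasurable).mul (hw.memLp_trace.1.pow 2)
  have hV' := integrable_weight_mul_of_le hστ.le mV hV
  have hZ' := integrable_weight_mul_of_le hστ.le mZ hZ
  have hF := fun τ => integrable_weight_mul_of_bounded hw.memLp_source hR
    (by linarith : 0 ≤ α) τ
  have hi : WeightedIntegrable a α σ u G u₀ F V Z := by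
    refine ⟨integrable_weight_mul_of_lt hστ (hw.memLp.1.pow 2) hu,
      integrable_weight_mul_of_lt hστ (hw.memLp_grad.1.norm.pow 2) hG, hF σ, ?_, ?_⟩
    · simpa only [mul_assoc] using hV'
    · simpa only [mul_assoc] using hZ'
  obtain ⟨h1, h2⟩ := hw.integral_energyDensity_le hv hi hα hσ hκ
  rw [← ofReal_integral_eq_lintegral_ofReal h1 (ae_of_all _ fun x =>
    energyDensity_nonneg (by linarith) (norm_nonneg x) (sq_nonneg _))]
  refine ENNReal.ofReal_le_ofReal (h2.trans ?_)
  have e : ∀ (σ : ℝ) (x' : EuclideanSpace ℝ (Fin n)) (W : ℝ),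
      |Real.exp (2 * σ * ‖x'‖ ^ α) * ‖x'‖ ^ α * W * u₀ x' ^ 2|
      = Real.exp (2 * σ * ‖x'‖ ^ α) * |‖x'‖ ^ α * W * u₀ x' ^ 2| := by
    intro σ x' W
    rw [mul_assoc, mul_assoc, abs_mul, abs_of_pos (Real.exp_pos _), ← mul_assoc (‖x'‖ ^ α)]
  have A : ∀ {σ : ℝ} {W : EuclideanSpace ℝ (Fin n) → ℝ}, Integrable (fun x' : EuclideanSpace ℝ (Fin n) =>
      Real.exp (2 * σ * ‖x'‖ ^ α) * W x') → Integrable fun x' : EuclideanSpace ℝ (Fin n) =>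
      Real.exp (2 * σ * ‖x'‖ ^ α) * |W x'| := by
    intro σ W h
    refine h.abs.congr (ae_of_all _ fun x' => ?_)
    beta_reduce
    rw [abs_mul, abs_of_pos (Real.exp_pos _)]
  have b1 := integral_weight_mul_le hστ.le (fun x => abs_nonneg _) (A hV') (A hV)
  have b2 := integral_weight_mul_le hστ.le (fun x => abs_nonneg _) (A hZ') (A hZ)
  have b3 := integral_weight_mul_le (J := fun x => ‖x‖ ^ 2 * F x ^ 2) hστ.le
    (fun x => by positivity) (by simpa only [mul_assoc] using hF σ)
    (by simpa only [mul_assoc] using hF τ)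
  simp only [e]
  have hC := (one_lt_carlemanConst (κ := κ) hα).le
  have p1 : 0 ≤ ∫ x', Real.exp (2 * σ * ‖x'‖ ^ α) * |‖x'‖ ^ α * Z x' * u₀ x' ^ 2| :=
    integral_nonneg fun x => by positivity
  have p2 : 0 ≤ ∫ x', Real.exp (2 * σ * ‖x'‖ ^ α) * |‖x'‖ ^ α * V x' * u₀ x' ^ 2| :=
    integral_nonneg fun x => by positivity
  have c1 := mul_le_mul hστ.le b1 p2 (by linarith)
  have c2 := mul_le_mul hστ.le b2 p1 (by linarith)
  refine mul_le_mul_of_nonneg_left ?_ (by linarith)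
  simp only [mul_assoc] at b3 c1 c2 ⊢
  linarith

/-- If a boundary integral is infinite there is nothing to prove. Otherwise the bounds for `σ < τ`
are uniform, the densities converge pointwise as `σ` tends to `τ`, and Fatou's lemma applies. -/
theorem WeakSolution.lintegral_energyDensity_le (hw : WeakSolution a u G u₀ F V Z)
    (hv : VanishesInBall a u G u₀) (hα : 1 ≤ α) (hκ : 2 * κ + 2 = (n : ℝ) + 1 + a)
    (hu : Integrable (fun x => Real.exp (2 * τ * ‖x‖ ^ α) * u x ^ 2) (wVol n a))
    (hG : Integrable (fun x => Real.exp (2 * τ * ‖x‖ ^ α) * ‖G x‖ ^ 2) (wVol n a))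
    {R : ℝ} (hR : ∀ᵐ x ∂(wVol n a), R < ‖x‖ → F x = 0) (hτ : 9 < τ) :
    ∫⁻ x, ENNReal.ofReal (energyDensity α τ ‖x‖ (u x) (‖G x‖ ^ 2)) ∂(wVol n a)
    ≤ ENNReal.ofReal (carlemanConst α κ) *
      (∫⁻ x, ENNReal.ofReal (Real.exp (2 * τ * ‖x‖ ^ α) * (‖x‖ ^ 2 * F x ^ 2)) ∂(wVol n a)
      + ENNReal.ofReal τ *
        (∫⁻ x', ENNReal.ofReal (Real.exp (2 * τ * ‖x'‖ ^ α) * |‖x'‖ ^ α * Z x' * u₀ x' ^ 2|))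
      + ENNReal.ofReal τ *
        ∫⁻ x', ENNReal.ofReal (Real.exp (2 * τ * ‖x'‖ ^ α) * |‖x'‖ ^ α * V x' * u₀ x' ^ 2|)) := by
  have hC : 0 < carlemanConst α κ := by linarith [one_lt_carlemanConst (κ := κ) hα]
  have hC' : ENNReal.ofReal (carlemanConst α κ) ≠ 0 := by simpa using hC
  have hτ0 : 0 < τ := by linarith
  have hτ' : ENNReal.ofReal τ ≠ 0 := by simpa using hτ0
  have mw : Measurable fun x' : EuclideanSpace ℝ (Fin n) => Real.exp (2 * τ * ‖x'‖ ^ α) := by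
    fun_prop
  have mV : AEStronglyMeasurable
      (fun x' => Real.exp (2 * τ * ‖x'‖ ^ α) * (‖x'‖ ^ α * V x' * u₀ x' ^ 2)) volume :=
    mw.aestronglyMeasurable.mul (((Measurable.aestronglyMeasurable (by fun_prop)).mul
      hw.continuous.aestronglyMeasurable).mul (hw.memLp_trace.1.pow 2))
  have mZ : AEStronglyMeasurable
      (fun x' => Real.exp (2 * τ * ‖x'‖ ^ α) * (‖x'‖ ^ α * Z x' * u₀ x' ^ 2)) volume :=
    mw.aestronglyMeasurable.mul (((Measurable.aestronglyMeasurable (by fun_prop)).mul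
      hw.measurable.aestronglyMeasurable).mul (hw.memLp_trace.1.pow 2))
  have eabs : ∀ (x' : EuclideanSpace ℝ (Fin n)) (W : ℝ),
      |Real.exp (2 * τ * ‖x'‖ ^ α) * W| = Real.exp (2 * τ * ‖x'‖ ^ α) * |W| := fun x' W => by
    rw [abs_mul, abs_of_pos (Real.exp_pos _)]
  have iffZ := integrable_iff_lintegral_abs_ne_top mZ
  have iffV := integrable_iff_lintegral_abs_ne_top mV
  simp only [eabs] at iffZ iffV
  by_cases hZ : ∫⁻ x', ENNReal.ofReal
      (Real.exp (2 * τ * ‖x'‖ ^ α) * |‖x'‖ ^ α * Z x' * u₀ x' ^ 2|) = ∞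
  · rw [hZ, ENNReal.mul_top hτ', add_top, top_add, ENNReal.mul_top hC']
    exact le_top
  by_cases hV : ∫⁻ x', ENNReal.ofReal
      (Real.exp (2 * τ * ‖x'‖ ^ α) * |‖x'‖ ^ α * V x' * u₀ x' ^ 2|) = ∞
  · rw [hV, ENNReal.mul_top hτ', add_top, ENNReal.mul_top hC']
    exact le_top
  have iZ := iffZ.2 hZ
  have iV := iffV.2 hV
  have iF := integrable_weight_mul_of_bounded hw.memLp_source hR (by linarith : 0 ≤ α) τ
  simp only [mul_assoc (Real.exp _)] at iF
  have jZ := iZ.abs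
  have jV := iV.abs
  simp only [eabs] at jZ jV
  have hbound := fun σ (hσ : 9 ≤ σ) (hστ : σ < τ) =>
    hw.integral_energyDensity_le_of_lt hv hα hκ hu hG hR iV iZ hσ hστ
  have n1 : 0 ≤ ∫ x', Real.exp (2 * τ * ‖x'‖ ^ α) * |‖x'‖ ^ α * Z x' * u₀ x' ^ 2| :=
    integral_nonneg fun x => by positivity
  have n2 : 0 ≤ ∫ x', Real.exp (2 * τ * ‖x'‖ ^ α) * |‖x'‖ ^ α * V x' * u₀ x' ^ 2| :=
    integral_nonneg fun x => by positivity
  have n3 : 0 ≤ ∫ x, Real.exp (2 * τ * ‖x‖ ^ α) * (‖x‖ ^ 2 * F x ^ 2) ∂(wVol n a) :=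
    integral_nonneg fun x => by positivity
  rw [← ofReal_integral_eq_lintegral_ofReal iF (ae_of_all _ fun x => by positivity),
    ← ofReal_integral_eq_lintegral_ofReal jZ (ae_of_all _ fun x => by positivity),
    ← ofReal_integral_eq_lintegral_ofReal jV (ae_of_all _ fun x => by positivity),
    ← ENNReal.ofReal_mul hτ0.le, ← ENNReal.ofReal_mul hτ0.le,
    ← ENNReal.ofReal_add n3 (by positivity), ← ENNReal.ofReal_add (by positivity) (by positivity),
    ← ENNReal.ofReal_mul hC.le]
  -- The sequence starts at `9` and stays below `τ`, so each term is an admissible exponent.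
  set σ : ℕ → ℝ := fun k => τ - (τ - 9) / ((k : ℝ) + 1) with hσ
  have hσ9 : ∀ k, 9 ≤ σ k := fun k => by
    have : (τ - 9) / ((k : ℝ) + 1) ≤ τ - 9 :=
      div_le_self (by linarith) (by linarith [(Nat.cast_nonneg k : (0 : ℝ) ≤ k)])
    simp only [hσ]
    linarith
  have hστ : ∀ k, σ k < τ := fun k => by
    have : 0 < (τ - 9) / ((k : ℝ) + 1) := div_pos (by linarith) (by positivity)
    simp only [hσ]
    linarith
  have hlim : Tendsto σ atTop (𝓝 τ) := by
    have h1 := (tendsto_one_div_add_atTop_nhds_zero_nat (𝕜 := ℝ)).const_mul (τ - 9)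
    have h2 := h1.const_sub τ
    simpa [hσ, div_eq_mul_inv] using h2
  have hmeas : ∀ k, AEMeasurable
      (fun x => ENNReal.ofReal (energyDensity α (σ k) ‖x‖ (u x) (‖G x‖ ^ 2))) (wVol n a) :=
    fun k => (aestronglyMeasurable_energyDensity hw.memLp.1 hw.memLp_grad.1 α
      (σ k)).aemeasurable.ennreal_ofReal
  have hpt : ∀ x, Tendsto (fun k => ENNReal.ofReal (energyDensity α (σ k) ‖x‖ (u x) (‖G x‖ ^ 2)))
      atTop (𝓝 (ENNReal.ofReal (energyDensity α τ ‖x‖ (u x) (‖G x‖ ^ 2)))) := fun x => by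
    have hc : Continuous fun τ => energyDensity α τ ‖x‖ (u x) (‖G x‖ ^ 2) := by
      unfold energyDensity
      fun_prop
    exact ENNReal.tendsto_ofReal ((hc.tendsto τ).comp hlim)
  calc ∫⁻ x, ENNReal.ofReal (energyDensity α τ ‖x‖ (u x) (‖G x‖ ^ 2)) ∂(wVol n a)
      = ∫⁻ x, liminf (fun k => ENNReal.ofReal
          (energyDensity α (σ k) ‖x‖ (u x) (‖G x‖ ^ 2))) atTop ∂(wVol n a) :=
        lintegral_congr fun x => (hpt x).liminf_eq.symm
    _ ≤ liminf (fun k => ∫⁻ x, ENNReal.ofReal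
          (energyDensity α (σ k) ‖x‖ (u x) (‖G x‖ ^ 2)) ∂(wVol n a)) atTop :=
        lintegral_liminf_le' hmeas
    _ ≤ liminf (fun _ : ℕ => ENNReal.ofReal _) atTop :=
        liminf_le_liminf (Eventually.of_forall fun k => hbound (σ k) (hσ9 k) (hστ k))
    _ = _ := liminf_const _

end Limiting

/-! ### Translation between the weighted measure and the stated norms -/

section Main

variable {n : ℕ} {a : ℝ}

theorem lintegral_enorm_sq_wVol {H : Type*} [NormedAddCommGroup H] [NormedSpace ℝ H]
    (a : ℝ) (c : EuclideanSpace ℝ (Fin (n + 1)) → ℝ)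
    (v : EuclideanSpace ℝ (Fin (n + 1)) → H) :
    ∫⁻ x, ‖(c x * height x ^ (a / 2)) • v x‖ₑ ^ 2 ∂(halfVol n)
    = ∫⁻ x, ENNReal.ofReal (c x ^ 2 * ‖v x‖ ^ 2) ∂(wVol n a) := by
  rw [lintegral_wVol]
  refine lintegral_congr_ae ?_
  filter_upwards [ae_halfVol_pos] with x hx
  have h1 : height x ^ (a / 2) * height x ^ (a / 2) = height x ^ a := by
    rw [← Real.rpow_add hx, add_halves]
  rw [← ofReal_norm, ← ENNReal.ofReal_pow (norm_nonneg _),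
    ← ENNReal.ofReal_mul (Real.rpow_nonneg hx.le a), norm_smul, mul_pow, Real.norm_eq_abs, sq_abs,
    ← h1]
  ring_nf

/-- Measurability is known only for the product, so `v` is recovered by dividing by the factor,
which does not vanish in the half-space. -/
theorem memLp_wVol_of_halfVol {H : Type*} [NormedAddCommGroup H] [NormedSpace ℝ H]
    {v : EuclideanSpace ℝ (Fin (n + 1)) → H} {c : EuclideanSpace ℝ (Fin (n + 1)) → ℝ}
    (hc : Measurable c) (hc0 : ∀ x, c x ≠ 0)
    (h : MemLp (fun x => (c x * height x ^ (a / 2)) • v x) 2 (halfVol n)) :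
    MemLp (fun x => c x • v x) 2 (wVol n a) := by
  have hm : AEStronglyMeasurable v (halfVol n) := by
    have hw : Measurable fun x : EuclideanSpace ℝ (Fin (n + 1)) =>
        (c x * height x ^ (a / 2))⁻¹ := (hc.mul (measurable_height.pow_const _)).inv
    refine (hw.aestronglyMeasurable.smul h.1).congr ?_
    filter_upwards [ae_halfVol_pos] with x hx
    simp only [Pi.smul_apply', smul_smul]
    rw [inv_mul_cancel₀ (mul_ne_zero (hc0 x) (Real.rpow_pos_of_pos hx _).ne'), one_smul]
  refine ⟨(hc.aestronglyMeasurable.smul hm).mono_ac (wVol_absolutelyContinuous a), ?_⟩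
  have h1 : eLpNorm (fun x => c x • v x) 2 (wVol n a) ^ 2 < ∞ := by
    have h2 : eLpNorm (fun x => (c x * height x ^ (a / 2)) • v x) 2 (halfVol n) ^ 2 < ∞ :=
      ENNReal.pow_lt_top h.2
    rw [eLpNorm_two_sq, lintegral_enorm_sq_wVol] at h2
    rw [eLpNorm_two_sq]
    refine lt_of_eq_of_lt (lintegral_congr fun x => ?_) h2
    rw [← ofReal_norm, ← ENNReal.ofReal_pow (norm_nonneg _), norm_smul, mul_pow,
      Real.norm_eq_abs, sq_abs]
  exact (ENNReal.pow_lt_top_iff.1 h1).resolve_right (by norm_num)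

theorem hasDerivAt_comp_exp_smul_radialDeriv {V : EuclideanSpace ℝ (Fin n) → ℝ}
    (hV : IsRadiallyDifferentiable V) (x : EuclideanSpace ℝ (Fin n)) :
    HasDerivAt (fun h : ℝ => V (Real.exp h • x)) (radialDeriv V x) 0 := by
  have h1 := (hV.differentiableAt x).hasDerivAt
  rw [← Real.exp_zero] at h1
  have h2 := HasDerivAt.comp (h := Real.exp) (0 : ℝ) h1 (Real.hasDerivAt_exp 0)
  simpa [Function.comp_def, radialDeriv] using h2

/-- The radial derivative is a pointwise limit of difference quotients, which are continuous in `x`.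
-/
theorem measurable_radialDeriv {V : EuclideanSpace ℝ (Fin n) → ℝ}
    (hV : IsRadiallyDifferentiable V) : Measurable (radialDeriv V) := by
  refine measurable_of_tendsto_metrizable
    (f := fun (k : ℕ) x => (1 / ((k : ℝ) + 1))⁻¹ • (V ((1 + 1 / ((k : ℝ) + 1)) • x) - V x))
    (fun k => ?_) (tendsto_pi_nhds.2 fun x => ?_)
  · have := hV.continuous
    exact Continuous.measurable (by fun_prop)
  · have h1 := (hV.differentiableAt x).hasDerivAt.tendsto_slope_zero
    have h2 : Tendsto (fun k : ℕ => 1 / ((k : ℝ) + 1)) atTop (𝓝[≠] 0) :=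
      tendsto_nhdsWithin_iff.2 ⟨tendsto_one_div_add_atTop_nhds_zero_nat,
        Eventually.of_forall fun k => ne_of_gt (by positivity)⟩
    have h3 := h1.comp h2
    simpa [Function.comp_def, radialDeriv] using h3

variable {s : ℝ} {u f : EuclideanSpace ℝ (Fin (n + 1)) → ℝ}
  {G : EuclideanSpace ℝ (Fin (n + 1)) → EuclideanSpace ℝ (Fin (n + 1))}
  {u₀ V : EuclideanSpace ℝ (Fin n) → ℝ}

theorem MemWeightedH1.memLp_wVol (h : MemWeightedH1 s u G) : MemLp u 2 (wVol n (1 - 2 * s)) := by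
  have := memLp_wVol_of_halfVol (a := 1 - 2 * s) (v := u) (c := fun _ => 1) measurable_const
    (fun _ => one_ne_zero) (by simpa using h.memLp)
  simpa using this

theorem MemWeightedH1.memLp_grad_wVol (h : MemWeightedH1 s u G) :
    MemLp G 2 (wVol n (1 - 2 * s)) := by
  have := memLp_wVol_of_halfVol (a := 1 - 2 * s) (v := G) (c := fun _ => 1) measurable_const
    (fun _ => one_ne_zero) (by simpa using h.memLp_grad)
  simpa using this

/-- With `F = y^{-a} f` one has `y^a F² = y^{-a} f²`, and `-a = 2s - 1`. -/
theorem memLp_source_wVol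
    (hf : MemLp (fun x => height x ^ ((2 * s - 1) / 2) * f x) 2 (halfVol n)) :
    MemLp (fun x => height x ^ (-(1 - 2 * s)) * f x) 2 (wVol n (1 - 2 * s)) := by
  have h : MemLp (fun x => ((1 : ℝ) * height x ^ ((1 - 2 * s) / 2)) •
      (height x ^ (-(1 - 2 * s)) * f x)) 2 (halfVol n) := by
    refine (memLp_congr_ae ?_).1 hf
    filter_upwards [ae_halfVol_pos] with x hx
    rw [one_mul, smul_eq_mul, ← mul_assoc, ← Real.rpow_add hx]
    ring_nf
  have := memLp_wVol_of_halfVol (a := 1 - 2 * s) (c := fun _ => 1) measurable_const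
    (fun _ => one_ne_zero) h
  simpa using this

/-- The approximating functions are the mollifications of `u`; their gradients are those of `G`
almost everywhere, and their boundary values converge to the trace. -/
theorem weakSolution_of_isWeakSolution (hs0 : 0 < s) (hs1 : s < 1) (hu : MemWeightedH1 s u G)
    (ht : IsTrace u G u₀)
    (hf : MemLp (fun x => height x ^ ((2 * s - 1) / 2) * f x) 2 (halfVol n))
    (hV : IsRadiallyDifferentiable V) (hw : IsWeakSolution s G u₀ f V) :
    WeakSolution (1 - 2 * s) u G u₀ (fun x => height x ^ (-(1 - 2 * s)) * f x) V
      (radialDeriv V) := by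
  have ha : -1 < 1 - 2 * s := by linarith
  have ha' : 1 - 2 * s < 1 := by linarith
  have h1 := hu.memLp_wVol
  have h2 := hu.memLp_grad_wVol
  have hgrad : ∀ k, mollify k G =ᵐ[wVol n (1 - 2 * s)] gradient (mollify k u) := fun k => by
    filter_upwards [ae_wVol_pos (1 - 2 * s)] with x hx
    exact (gradient_mollify ha' k h1 h2 hu.weakGradient hx.le).symm
  have hT := tendstoL2_mollify ha ha' h2
  refine ⟨ha, ha', ⟨fun k => mollify k u, fun k => contDiff_mollify ha' k h1,
    tendstoL2_mollify ha ha' h1, ⟨fun k => (memLp_congr_ae (hgrad k)).1 (hT.memLp k), h2, ?_⟩,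
    tendstoL2_bdry_mollify ha ha' h1 h2 hu.weakGradient ht⟩, memLp_source_wVol hf, hV.continuous,
    hasDerivAt_comp_exp_smul_radialDeriv hV, measurable_radialDeriv hV, hV.locallyBounded,
    fun ψ hψ => ?_⟩
  · refine hT.tendsto.congr fun k => eLpNorm_congr_ae ?_
    filter_upwards [hgrad k] with x hx
    simp [hx]
  · have e1 := hw ψ hψ
    have e2 : ∫ x, inner ℝ (gradient ψ x) (G x) ∂(wVol n (1 - 2 * s))
        = ∫ x, height x ^ (1 - 2 * s) * fderiv ℝ ψ x (G x) ∂(halfVol n) := by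
      rw [integral_wVol]
      simp only [fderiv_eq_inner_gradient, smul_eq_mul]
    have e3 : ∫ x, height x ^ (-(1 - 2 * s)) * f x * ψ x ∂(wVol n (1 - 2 * s))
        = ∫ x, f x * ψ x ∂(halfVol n) := by
      rw [integral_wVol]
      refine integral_congr_ae ?_
      filter_upwards [ae_halfVol_pos] with x hx
      rw [smul_eq_mul, mul_assoc, ← mul_assoc, ← Real.rpow_add hx]
      simp
    rw [e2, e3, e1]

theorem vanishesInBall (hs0 : 0 < s) (hs1 : s < 1) (hu : MemWeightedH1 s u G)
    (ht : IsTrace u G u₀) (h0 : ∀ᵐ x ∂(halfVol n), ‖x‖ ≤ 1 → u x = 0) :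
    VanishesInBall (1 - 2 * s) u G u₀ where
  fn := by
    filter_upwards [(wVol_absolutelyContinuous (1 - 2 * s)).ae_le h0] with x h1 h2
    exact h1 h2.le
  grad := ae_gradient_eq_zero (by linarith) (by linarith) hu.memLp_wVol hu.memLp_grad_wVol
    hu.weakGradient h0
  trace := ae_trace_eq_zero (by linarith) (by linarith) hu.memLp_wVol hu.memLp_grad_wVol
    hu.weakGradient ht h0

theorem exp_mul_sq (τ p : ℝ) : Real.exp (τ * p) ^ 2 = Real.exp (2 * τ * p) := by
  rw [← Real.exp_nat_mul]
  ring_nf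

theorem rpow_sub_one_sq {α r : ℝ} (hr : 0 ≤ r) (hα : 1 ≤ α) :
    (r ^ (3 * α / 2 - 1)) ^ 2 = (r ^ α) ^ 3 / r ^ 2 := by
  rcases hr.eq_or_lt with rfl | hr
  -- At the origin both exponents are positive since `α ≥ 1`, and the quotient on the right is `0 /
  -- 0 = 0`.
  · rw [Real.zero_rpow (by linarith), Real.zero_rpow (by linarith)]
    simp
  · rw [← Real.rpow_natCast, ← Real.rpow_mul hr.le, ← Real.rpow_natCast (r ^ α),
      ← Real.rpow_mul hr.le, ← Real.rpow_natCast r, ← Real.rpow_sub hr]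
    congr 1
    push_cast
    ring

theorem rpow_half_sq {α r : ℝ} (hr : 0 ≤ r) : (r ^ (α / 2)) ^ 2 = r ^ α := by
  rw [← Real.rpow_natCast, ← Real.rpow_mul hr]
  congr 1
  push_cast
  ring

theorem lintegral_energyDensity (hu : MemLp u 2 (wVol n a)) {α τ : ℝ} (hα : 1 ≤ α) (hτ : 0 ≤ τ) :
    ∫⁻ x, ENNReal.ofReal (energyDensity α τ ‖x‖ (u x) (‖G x‖ ^ 2)) ∂(wVol n a)
    = ENNReal.ofReal (τ ^ 3) *
        eLpNorm (fun x => Real.exp (τ * ‖x‖ ^ α) * ‖x‖ ^ (3 * α / 2 - 1) *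
          height x ^ (a / 2) * u x) 2 (halfVol n) ^ 2
      + ENNReal.ofReal τ *
        eLpNorm (fun x => (Real.exp (τ * ‖x‖ ^ α) * ‖x‖ ^ (α / 2) *
          height x ^ (a / 2)) • G x) 2 (halfVol n) ^ 2 := by
  have e1 := lintegral_enorm_sq_wVol a
    (fun x => Real.exp (τ * ‖x‖ ^ α) * ‖x‖ ^ (3 * α / 2 - 1)) u
  have e2 := lintegral_enorm_sq_wVol a (fun x => Real.exp (τ * ‖x‖ ^ α) * ‖x‖ ^ (α / 2)) G
  simp only [smul_eq_mul] at e1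
  have hm : AEMeasurable (fun x => ENNReal.ofReal
      ((Real.exp (τ * ‖x‖ ^ α) * ‖x‖ ^ (3 * α / 2 - 1)) ^ 2 * ‖u x‖ ^ 2)) (wVol n a) := by
    have := hu.1.norm.aemeasurable
    have h1 : AEMeasurable (fun x : EuclideanSpace ℝ (Fin (n + 1)) => ‖x‖) (wVol n a) :=
      measurable_norm.aemeasurable
    fun_prop
  rw [eLpNorm_two_sq, eLpNorm_two_sq, e1, e2, ← lintegral_const_mul' _ _ ENNReal.ofReal_ne_top,
    ← lintegral_const_mul' _ _ ENNReal.ofReal_ne_top,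
    ← lintegral_add_left' (hm.const_mul _)]
  refine lintegral_congr fun x => ?_
  rw [← ENNReal.ofReal_mul (by positivity), ← ENNReal.ofReal_mul hτ,
    ← ENNReal.ofReal_add (by positivity) (by positivity)]
  congr 1
  rw [mul_pow, mul_pow, exp_mul_sq, rpow_sub_one_sq (norm_nonneg x) hα,
    rpow_half_sq (norm_nonneg x), Real.norm_eq_abs, sq_abs, energyDensity]
  ring

theorem lintegral_source (α τ : ℝ) (f : EuclideanSpace ℝ (Fin (n + 1)) → ℝ) :
    ∫⁻ x, ENNReal.ofReal (Real.exp (2 * τ * ‖x‖ ^ α) *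
        (‖x‖ ^ 2 * (height x ^ (-(1 - 2 * s)) * f x) ^ 2)) ∂(wVol n (1 - 2 * s))
    = eLpNorm (fun x => Real.exp (τ * ‖x‖ ^ α) * height x ^ ((2 * s - 1) / 2) * ‖x‖ * f x) 2
      (halfVol n) ^ 2 := by
  have e1 := lintegral_enorm_sq_wVol (1 - 2 * s) (fun x => Real.exp (τ * ‖x‖ ^ α) * ‖x‖)
    (fun x => height x ^ (-(1 - 2 * s)) * f x)
  rw [eLpNorm_two_sq]
  trans ∫⁻ x, ENNReal.ofReal ((Real.exp (τ * ‖x‖ ^ α) * ‖x‖) ^ 2 *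
    ‖height x ^ (-(1 - 2 * s)) * f x‖ ^ 2) ∂(wVol n (1 - 2 * s))
  · refine lintegral_congr fun x => ?_
    rw [mul_pow (Real.exp _), exp_mul_sq, Real.norm_eq_abs, sq_abs, ← mul_assoc (Real.exp _)]
  · rw [← e1]
    refine lintegral_congr_ae ?_
    filter_upwards [ae_halfVol_pos] with x hx
    have : height x ^ ((1 - 2 * s) / 2) * height x ^ (-(1 - 2 * s))
        = height x ^ ((2 * s - 1) / 2) := by
      rw [← Real.rpow_add hx]
      ring_nf
    rw [← this, smul_eq_mul]
    ring_nf

theorem lintegral_bdry (α τ : ℝ) (W u₀ : EuclideanSpace ℝ (Fin n) → ℝ) :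
    ∫⁻ x', ENNReal.ofReal (Real.exp (2 * τ * ‖x'‖ ^ α) * |‖x'‖ ^ α * W x' * u₀ x' ^ 2|)
    = eLpNorm (fun x' => Real.exp (τ * ‖x'‖ ^ α) * ‖x'‖ ^ (α / 2) * |W x'| ^ (1 / 2 : ℝ) * u₀ x')
      2 volume ^ 2 := by
  rw [eLpNorm_two_sq]
  refine lintegral_congr fun x => ?_
  have h : (|W x| ^ (1 / 2 : ℝ)) ^ 2 = |W x| := by
    rw [rpow_half_sq (abs_nonneg _), Real.rpow_one]
  have hp := Real.rpow_nonneg (norm_nonneg x) α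
  rw [← ofReal_norm, ← ENNReal.ofReal_pow (norm_nonneg _), Real.norm_eq_abs, sq_abs, mul_pow,
    mul_pow, mul_pow, exp_mul_sq, rpow_half_sq (norm_nonneg x), h, abs_mul, abs_mul,
    abs_of_nonneg hp, abs_of_nonneg (sq_nonneg (u₀ x)), ← mul_assoc, ← mul_assoc]

theorem integrable_weight_mul_norm_sq {H : Type*} [NormedAddCommGroup H] [NormedSpace ℝ H]
    {v : EuclideanSpace ℝ (Fin (n + 1)) → H} {α τ : ℝ}
    (h : MemLp (fun x => (Real.exp (τ * ‖x‖ ^ α) * height x ^ (a / 2)) • v x) 2 (halfVol n)) :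
    Integrable (fun x => Real.exp (2 * τ * ‖x‖ ^ α) * ‖v x‖ ^ 2) (wVol n a) := by
  have h1 := (memLp_wVol_of_halfVol (c := fun x => Real.exp (τ * ‖x‖ ^ α)) (by fun_prop)
    (fun x => (Real.exp_pos _).ne') h).integrable_norm_pow (by norm_num)
  refine h1.congr (ae_of_all _ fun x => ?_)
  simp only [norm_smul, mul_pow, Real.norm_eq_abs, sq_abs]
  rw [← exp_mul_sq]

end Main

end Carleman

theorem mainTheorem4 (n : ℕ) (hn : 1 ≤ n) (s : ℝ) (hs0 : 0 < s) (hs1 : s < 1)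
    (α : ℝ) (hα : 1 ≤ α) :
    ∃ C τ₀ : ℝ, 1 < C ∧ 1 < τ₀ ∧
      ∀ (u : EuclideanSpace ℝ (Fin (n + 1)) → ℝ)
        (G : EuclideanSpace ℝ (Fin (n + 1)) → EuclideanSpace ℝ (Fin (n + 1)))
        (u₀ : EuclideanSpace ℝ (Fin n) → ℝ)
        (f : EuclideanSpace ℝ (Fin (n + 1)) → ℝ)
        (V : EuclideanSpace ℝ (Fin n) → ℝ),
        Carleman.MemWeightedH1 s u G →
        Carleman.IsTrace u G u₀ →
        (∀ᵐ x ∂(Carleman.halfVol n), ‖x‖ ≤ 1 → u x = 0) →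
        MeasureTheory.MemLp (fun x => Carleman.height x ^ ((2 * s - 1) / 2) * f x) 2
          (Carleman.halfVol n) →
        (∃ R : ℝ, ∀ᵐ x ∂(Carleman.halfVol n), R < ‖x‖ → f x = 0) →
        Carleman.IsRadiallyDifferentiable V →
        Carleman.IsWeakSolution s G u₀ f V →
        ∀ τ : ℝ, τ₀ ≤ τ →
          MeasureTheory.MemLp (fun x => Real.exp (τ * ‖x‖ ^ α) *
            Carleman.height x ^ ((1 - 2 * s) / 2) * u x) 2 (Carleman.halfVol n) →
          MeasureTheory.MemLp (fun x => (Real.exp (τ * ‖x‖ ^ α) *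
            Carleman.height x ^ ((1 - 2 * s) / 2)) • G x) 2 (Carleman.halfVol n) →
          ENNReal.ofReal (τ ^ 3) *
              (MeasureTheory.eLpNorm (fun x => Real.exp (τ * ‖x‖ ^ α) * ‖x‖ ^ (3 * α / 2 - 1) *
                Carleman.height x ^ ((1 - 2 * s) / 2) * u x) 2 (Carleman.halfVol n)) ^ 2
            + ENNReal.ofReal τ *
              (MeasureTheory.eLpNorm (fun x => (Real.exp (τ * ‖x‖ ^ α) * ‖x‖ ^ (α / 2) *
                Carleman.height x ^ ((1 - 2 * s) / 2)) • G x) 2 (Carleman.halfVol n)) ^ 2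
          ≤ ENNReal.ofReal C *
            ((MeasureTheory.eLpNorm (fun x => Real.exp (τ * ‖x‖ ^ α) *
                Carleman.height x ^ ((2 * s - 1) / 2) * ‖x‖ * f x) 2 (Carleman.halfVol n)) ^ 2
            + ENNReal.ofReal τ *
              (MeasureTheory.eLpNorm (fun x' => Real.exp (τ * ‖x'‖ ^ α) * ‖x'‖ ^ (α / 2) *
                |Carleman.radialDeriv V x'| ^ (1 / 2 : ℝ) * u₀ x') 2 MeasureTheory.volume) ^ 2
            + ENNReal.ofReal τ *
              (MeasureTheory.eLpNorm (fun x' => Real.exp (τ * ‖x'‖ ^ α) * ‖x'‖ ^ (α / 2) *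
                |V x'| ^ (1 / 2 : ℝ) * u₀ x') 2 MeasureTheory.volume) ^ 2) := by
  -- The value of `κ` solves `2κ + 2 = n + 1 + a` for `a = 1 - 2s`. The threshold `10` exceeds `9`,
  -- which leaves room for exponents between `9` and `τ`.
  refine ⟨Carleman.carlemanConst α (((n : ℝ) - 2 * s) / 2), 10,
    Carleman.one_lt_carlemanConst hα, by norm_num, ?_⟩
  intro u G u₀ f V hu ht h0 hf hR hV hw τ hτ hiu hiG
  obtain ⟨R, hR⟩ := hR
  have hsol := Carleman.weakSolution_of_isWeakSolution hs0 hs1 hu ht hf hV hw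
  have hvan := Carleman.vanishesInBall hs0 hs1 hu ht h0
  have hR' : ∀ᵐ x ∂(Carleman.wVol n (1 - 2 * s)), R < ‖x‖ →
      Carleman.height x ^ (-(1 - 2 * s)) * f x = 0 := by
    filter_upwards [(Carleman.wVol_absolutelyContinuous (1 - 2 * s)).ae_le hR] with x h1 h2
    rw [h1 h2, mul_zero]
  have hiu' := Carleman.integrable_weight_mul_norm_sq (v := u) hiu
  simp only [Real.norm_eq_abs, sq_abs] at hiu'
  have key := hsol.lintegral_energyDensity_le (κ := ((n : ℝ) - 2 * s) / 2) hvan hα (by ring)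
    hiu' (Carleman.integrable_weight_mul_norm_sq hiG) hR' (by linarith)
  rwa [Carleman.lintegral_energyDensity hu.memLp_wVol hα (by linarith), Carleman.lintegral_source,
    Carleman.lintegral_bdry, Carleman.lintegral_bdry] at key
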